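/- Let $n\ge 2$, let $A:\mathbb R^n\to\mathbb R^n$ and $V:\mathbb R^n\to\mathbb R$ be $C^1$ on $\mathbb R^n\setminus\{0\}$, with $|A|^2\in L^1_{loc}(\mathbb R^n)$ and $\operatorname{div}A=0$ on $\mathbb R^n\setminus\{0\}$. Put $\nabla_A=\nabla-iA$, and let $H_A=-\nabla_A^2$ be the self-adjoint operator on $L^2(\mathbb R^n)$ with form domain $\{w\in L^2:\nabla_Aw\in L^2\}$ and quadratic form $\int|\nabla_Aw|^2\,dx$. Assume that $V$ is a Kato–Rellich perturbation of $H_A$: there are $\epsilon\in(0,1)$ and $C$ such that $\|Vw\|_{L^2}\le(1-\epsilon)\|H_Aw\|_{L^2}+C\|w\|_{L^2}$ for all $w$ in the domain of $H_A$. Let $H=H_A+V$, and write $$B_{ij}=\frac{\partial A^i}{\partial x^j}-\frac{\partial A^j}{\partial x^i},\qquad (B_\tau)_j=\sum_{i=1}^n\frac{x_i}{|x|}B_{ij},\qquad V_r=\nabla V\cdot\frac{x}{|x|}.$$ Let $f$ be in the domain of $H_A$ with $\int|x|^2|f|^2\,dx<\infty$, and let $u\in C^1(\mathbb R;L^2(\mathbb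 R^n))$, with $u(t)$ in the domain of $H_A$ for every $t$, solve the magnetic Schrödinger equation $iu_t-Hu=0$, $u(0)=f$. Assume that for every $t$ the functions $|x|V_r|u(t)|^2$ and $|x|\,u(t)\,B_\tau\cdot\overline{\nabla_Au(t)}$ are integrable on $\mathbb R^n$, and that their $L^1(\mathbb R^n)$ norms are locally integrable functions of $t\in\mathbb R$. Put $$Q(t)=\int_{\mathbb R^n}|x|^2|u|^2\,dx,\qquad F(t)=8\int_{\mathbb R^n}|\nabla_Au|^2\,dx-4\int_{\mathbb R^n}|x|V_r|u|^2\,dx+8\,\Im\int_{\mathbb R^n}|x|\,u\,B_\tau\cdot\overline{\nabla_Au}\,dx .$$ Then the variance $Q(t)$ is finite for every $t$, $Q\in C^1(\mathbb R)$, and $\ddot Q=F$ in the following sense: $F$ is locally integrable and $\dot Q(t)-\dot Q(s)=\int_s^tF(\tau)\,d\tau$ for all $s,t\in\mathbb R$; the second derivative $\ddot Q(t)$ exists and equals $F(t)$ for almost every $t$, and also at every $t$ at which $F$ is continuous. -/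

import Mathlib

open MeasureTheory
open scoped ContDiff

namespace MagneticVirial

/-- Euclidean space `ℝⁿ`. -/
abbrev Space (n : ℕ) : Type := EuclideanSpace ℝ (Fin n)

/-- The complex Hilbert space `L²(ℝⁿ; ℂ)`. -/
abbrev L2 (n : ℕ) : Type := Lp ℂ 2 (volume : Measure (Space n))

/-- The complex Hilbert space `L²(ℝⁿ; ℂⁿ)`. -/
abbrev L2Vec (n : ℕ) : Type :=
  Lp (EuclideanSpace ℂ (Fin n)) 2 (volume : Measure (Space n))

/-- The `j`-th standard basis vector of `ℝⁿ`. -/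
noncomputable def basisVec {n : ℕ} (j : Fin n) : Space n := EuclideanSpace.single j (1 : ℝ)

/-- `p = ∇_A w = ∇w - iAw` in the sense of distributions, for `w, p` in `L²`:
for every test function `φ ∈ C_c^∞(ℝⁿ; ℂ)` and every `j`,
`∫ w (∂_j φ + i A^j φ) = - ∫ p_j φ`. -/
def IsCovariantGradient {n : ℕ} (A : Space n → Space n) (w : L2 n) (p : L2Vec n) : Prop :=
  ∀ φ : Space n → ℂ, ContDiff ℝ ∞ φ → HasCompactSupport φ → ∀ j : Fin n,
    ∫ x, w x * (fderiv ℝ φ x (basisVec j) + Complex.I * (A x j : ℂ) * φ x)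
      = - ∫ x, p x j * φ x

/-- `w ∈ D(H_A)` and `h = H_A w`, where `H_A = -∇_A²` is the self-adjoint operator with form domain
`{w ∈ L² : ∇_A w ∈ L²}` and quadratic form `∫ |∇_A w|²`. That is, `w` is in the form domain and
`⟪∇_A v, ∇_A w⟫ = ⟪v, h⟫` for every `v` in the form domain. -/
def IsMagneticLaplacian {n : ℕ} (A : Space n → Space n) (w h : L2 n) : Prop :=
  ∃ p : L2Vec n, IsCovariantGradient A w p ∧
    ∀ (v : L2 n) (q : L2Vec n), IsCovariantGradient A v q → inner ℂ q p = inner ℂ v h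

/-- `k = H w`, where `H = H_A + V` with domain `D(H_A)`. -/
def IsHamiltonian {n : ℕ} (A : Space n → Space n) (V : Space n → ℝ) (w k : L2 n) : Prop :=
  ∃ h : L2 n, IsMagneticLaplacian A w h ∧
    ∀ᵐ x ∂(volume : Measure (Space n)), k x = h x + (V x : ℂ) * w x

/-- `V` is a perturbation of `H_A` in the Kato-Rellich sense:
`‖V w‖ ≤ (1 - ε) ‖H_A w‖ + C ‖w‖` for all `w ∈ D(H_A)`, for some `ε ∈ (0,1)` and some `C`
(in particular `V w ∈ L²`). -/
def IsKatoRellich {n : ℕ} (A : Space n → Space n) (V : Space n → ℝ) : Prop :=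
  ∃ ε C : ℝ, 0 < ε ∧ ε < 1 ∧ ∀ w h : L2 n, IsMagneticLaplacian A w h →
    ∃ v : L2 n, (∀ᵐ x ∂(volume : Measure (Space n)), v x = (V x : ℂ) * w x) ∧
      ‖v‖ ≤ (1 - ε) * ‖h‖ + C * ‖w‖

/-- `u` is a (strong) solution of `i u_t - H u = 0`, `u(0) = f`: it is a `C¹` curve in `L²`
with values in the domain of `H`, and the equation holds in `L²` at every time. -/
structure IsSchrodingerSolution {n : ℕ} (A : Space n → Space n) (V : Space n → ℝ)
    (f : L2 n) (u : ℝ → L2 n) : Prop where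
  contDiff : ContDiff ℝ 1 u
  initial : u 0 = f
  equation : ∀ t : ℝ, ∃ k : L2 n, IsHamiltonian A V (u t) k ∧ Complex.I • deriv u t - k = 0

/-- The divergence of a vector field. -/
noncomputable def divergence {n : ℕ} (A : Space n → Space n) (x : Space n) : ℝ :=
  ∑ j : Fin n, fderiv ℝ A x (basisVec j) j

/-- The magnetic field `B = DA - DAᵗ`, `B_{ij} = ∂A^i/∂x^j - ∂A^j/∂x^i`. -/
noncomputable def magneticField {n : ℕ} (A : Space n → Space n) (x : Space n) :
    Matrix (Fin n) (Fin n) ℝ :=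
  Matrix.of fun i j => fderiv ℝ A x (basisVec j) i - fderiv ℝ A x (basisVec i) j

/-- The tangential part `B_τ = (x/|x|) B` (row vector times matrix) of the magnetic field. -/
noncomputable def tangentialField {n : ℕ} (A : Space n → Space n) (x : Space n) : Fin n → ℝ :=
  Matrix.vecMul (fun i => x i / ‖x‖) (magneticField A x)

/-- The radial derivative `V_r = ∇V · x/|x|`. -/
noncomputable def radialDeriv {n : ℕ} (V : Space n → ℝ) (x : Space n) : ℝ :=
  fderiv ℝ V x (‖x‖⁻¹ • x)

/-- The variance `∫ |x|² |w|² dx`. -/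
noncomputable def variance {n : ℕ} (w : L2 n) : ℝ := ∫ x : Space n, ‖x‖ ^ 2 * ‖w x‖ ^ 2

/-- The density `|x| V_r |w|²`. -/
noncomputable def electricDensity {n : ℕ} (V : Space n → ℝ) (w : L2 n) (x : Space n) : ℝ :=
  ‖x‖ * radialDeriv V x * ‖w x‖ ^ 2

/-- The density `|x| w B_τ · conj(∇_A w)`, where `p = ∇_A w`. -/
noncomputable def magneticDensity {n : ℕ} (A : Space n → Space n) (w : L2 n) (p : L2Vec n)
    (x : Space n) : ℂ :=
  (‖x‖ : ℂ) * w x * ∑ j : Fin n, (tangentialField A x j : ℂ) * (starRingEnd ℂ) (p x j)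

/-- `8 ∫ |∇_A w|² - 4 ∫ |x| V_r |w|² + 8 Im ∫ |x| w B_τ · conj(∇_A w)`, where `p = ∇_A w`. -/
noncomputable def virialRHS {n : ℕ} (A : Space n → Space n) (V : Space n → ℝ)
    (w : L2 n) (p : L2Vec n) : ℝ :=
  8 * (∫ x : Space n, ‖p x‖ ^ 2) - 4 * (∫ x : Space n, electricDensity V w x)
    + 8 * (∫ x : Space n, magneticDensity A w p x).im

end MagneticVirial

/-! Formally `Q' = 4 M` with `M = Im ∫ conj u (x · ∇_A u)`, and `M' = 2 Re ⟪G u, H u⟫` for the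
dilation generator `G = x · ∇_A + n/2`. Integrating by parts and exchanging covariant derivatives by
`D_j D_k - D_k D_j = -i B_kj` turns the last pairing into a quarter of the virial expression. The
work lies in justifying this when `u(t)` is only in the domain of `H_A`, the potentials may be
singular at the origin and `x` is unbounded.

For the first derivative, `|x|²` is replaced by the bounded weight `|x|² / (1 + δ|x|²)`.
Multiplication by it preserves the form domain, so the weak equation gives the derivative of the
regularized variance (`im_inner_weight`). A Gronwall bound uniform in `δ` shows that the variance
stays finite (`IsFlow.exists_variance_le`), and `δ → 0` gives `Q' = 4 M` in integrated form
(`IsFlow.variance_sub`).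

For the second derivative, `x` is replaced by `X = χ(log|x|²) x`, with `χ` supported in `|s| ≤ 2N`;
this field lives on a compact annulus that avoids the origin. There `A` and `V` are `C¹`, and an
element of the domain of `H_A` is approximated by mollification so that the functions, their
covariant gradients and their magnetic Laplacians all converge in `L²` (`exists_smooth_approx`). For
smooth functions the identity says that a divergence integrates to zero (`virial_algebra`,
`integral_virialDensity_of_contDiff`); every term is continuous under this convergence
(`integral_pairing_eq_integral_virial`). The operator `X · ∇_A + ½ div X` is antisymmetric, which
allows `⟪u, G u⟫` to be differentiated without a derivative of `G u`
(`hasDerivAt_inner_of_antisymm`).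

As `N → ∞`, derivatives of `χ` gain a factor `1/N`. All terms but one are dominated by integrable
functions. The exception comes from `∇ div X` and has size `|w| |∇_A w| / (N|x|)`; the usual Hardy
inequality would control it for `n ≥ 3` but fails in the plane. The inequality of
`exists_hardy_const`, whose weight is `1/(N|x|)²` on the annulus and whose constant does not depend
on `N`, covers every `n ≥ 2`; it is obtained from the same antisymmetry applied to another radial
field. After weighted Cauchy–Schwarz only the gradient on `|log|x|²| ≥ N` remains, and this vanishes
in the limit (`tendsto_integral_radialVirial`).

The Kato–Rellich bound controls `H_A u` by `H u = i u_t` and `u`; hence `t ↦ ∇_A u(t)` is continuous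
in `L²`. This gives the local bounds in time needed for dominated convergence, and the integrated
formulas for `Q` and `M` yield all the claims about the second derivative
(`second_derivative_of_integral`). -/

namespace MagneticVirial

open Filter Topology Set Convolution ContinuousLinearMap

/-! ### Mollification converges in `L²`. -/

section Mollification

variable {n : ℕ}

/-- The partial derivative in the `j`-th coordinate direction. -/
noncomputable def pd {E : Type*} [NormedAddCommGroup E] [NormedSpace ℝ E] (j : Fin n)
    (f : Space n → E) (x : Space n) : E :=
  fderiv ℝ f x (basisVec j)

/-- Cauchy–Schwarz for the weighted measure `r dμ`: Hölder is applied to `r` and `r d²`, both with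
exponent `1/2`. With `r` of mass one it is Jensen's inequality. -/
lemma lintegral_mul_sq_le {α : Type*} [MeasurableSpace α] {μ : Measure α} {r d : α → ENNReal}
    (hr : AEMeasurable r μ) (hd : AEMeasurable d μ) :
    (∫⁻ x, r x * d x ∂μ) ^ 2 ≤ (∫⁻ x, r x ∂μ) * ∫⁻ x, r x * d x ^ 2 ∂μ := by
  have h := ENNReal.lintegral_mul_norm_pow_le hr (hr.mul (hd.pow_const 2))
    (p := 1 / 2) (q := 1 / 2) (by norm_num) (by norm_num) (by norm_num)
  have e : ∀ x, r x ^ (1 / 2 : ℝ) * (r x * d x ^ 2) ^ (1 / 2 : ℝ) = r x * d x := by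
    intro x
    rw [ENNReal.mul_rpow_of_nonneg _ _ (by norm_num), ← mul_assoc,
      ← ENNReal.rpow_add_of_nonneg _ _ (by norm_num) (by norm_num), ← ENNReal.rpow_natCast,
      ← ENNReal.rpow_mul]
    norm_num
  simp only [Pi.mul_apply, e] at h
  calc (∫⁻ x, r x * d x ∂μ) ^ 2
      ≤ ((∫⁻ x, r x ∂μ) ^ (1 / 2 : ℝ) * (∫⁻ x, r x * d x ^ 2 ∂μ) ^ (1 / 2 : ℝ)) ^ 2 := by gcongr
    _ = _ := by
      rw [mul_pow, ← ENNReal.rpow_natCast, ← ENNReal.rpow_natCast, ← ENNReal.rpow_mul,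
        ← ENNReal.rpow_mul]
      norm_num

lemma tendsto_eLpNorm_translate_sub {f : Space n → ℂ} (hf : MemLp f 2 volume) :
    Tendsto (fun y : Space n => eLpNorm (fun x => f (x - y) - f x) 2 volume) (𝓝 0) (𝓝 0) := by
  let g : Space n → C(Space n, Space n) := fun y => ⟨fun x => x - y, by fun_prop⟩
  have hg : Continuous g := by
    apply ContinuousMap.continuous_of_continuous_uncurry
    simp only [g, ContinuousMap.coe_mk, Function.uncurry_def]
    fun_prop
  have hgm : ∀ y, MeasurePreserving (g y) (volume : Measure (Space n)) volume :=
    fun y => measurePreserving_sub_right volume y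
  have h := (continuous_const (y := hf.toLp f)).compMeasurePreservingLp hg hgm (by norm_num)
  have h0 := h.tendsto 0
  have e0 : Lp.compMeasurePreserving (g 0) (hgm 0) (hf.toLp f) = hf.toLp f := by
    apply Lp.ext
    refine (Lp.coeFn_compMeasurePreserving _ _).trans ?_
    simp [g, Function.comp_def]
  rw [e0, Lp.tendsto_Lp_iff_tendsto_eLpNorm'] at h0
  refine h0.congr fun y => eLpNorm_congr_ae ?_
  filter_upwards [Lp.coeFn_compMeasurePreserving (hf.toLp f) (hgm y), hf.coeFn_toLp,
    (hgm y).quasiMeasurePreserving.ae hf.coeFn_toLp] with x h1 h2 h3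
  simp only [Pi.sub_apply, h1, h2, Function.comp_apply, h3]
  rfl

/-- A sequence of smooth bumps concentrating at the origin. -/
noncomputable def bumpSeq (n m : ℕ) : ContDiffBump (0 : Space n) where
  rIn := 1 / (m + 2)
  rOut := 1 / (m + 1)
  rIn_pos := by positivity
  rIn_lt_rOut := by gcongr; norm_num

/-- The standard mollification of a function at scale `1 / (m + 1)`. -/
noncomputable def mollify (m : ℕ) (f : Space n → ℂ) : Space n → ℂ :=
  (bumpSeq n m).normed volume ⋆[lsmul ℝ ℝ, volume] f

lemma locallyIntegrable_of_memLp_two {E : Type*} [NormedAddCommGroup E] {f : Space n → E}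
    (hf : MemLp f 2 volume) :
    LocallyIntegrable f volume :=
  hf.locallyIntegrable (by norm_num)

lemma contDiff_mollify {f : Space n → ℂ} (hf : LocallyIntegrable f volume) (m : ℕ) :
    ContDiff ℝ ∞ (mollify m f) :=
  (bumpSeq n m).hasCompactSupport_normed.contDiff_convolution_left _
    (bumpSeq n m).contDiff_normed hf

lemma hasCompactSupport_mollify {f : Space n → ℂ} (hf : HasCompactSupport f) (m : ℕ) :
    HasCompactSupport (mollify m f) :=
  (bumpSeq n m).hasCompactSupport_normed.convolution _ hf

/-- Since the kernel has mass one, the error is the average of `f (x - y) - f x`, and Jensen's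
inequality moves the square inside. -/
lemma enorm_mollify_sub_sq_le {f : Space n → ℂ} (hf : LocallyIntegrable f volume) (m : ℕ)
    (x : Space n) :
    ‖mollify m f x - f x‖ₑ ^ 2 ≤ ∫⁻ y, ‖(bumpSeq n m).normed volume y‖ₑ *
      ‖f (x - y) - f x‖ₑ ^ 2 := by
  set ρ := (bumpSeq n m).normed (volume : Measure (Space n)) with hρ
  have hρc : Continuous ρ := (bumpSeq n m).continuous_normed
  have hint : Integrable (fun y => ρ y • f (x - y)) volume :=
    (bumpSeq n m).hasCompactSupport_normed.convolutionExists_left (lsmul ℝ ℝ) hρc hf x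
  have hρi : Integrable ρ volume := (bumpSeq n m).integrable_normed
  have e : mollify m f x - f x = ∫ y, ρ y • (f (x - y) - f x) := by
    simp_rw [smul_sub]
    rw [integral_sub hint (hρi.smul_const _), integral_smul_const, (bumpSeq n m).integral_normed,
      one_smul]
    rfl
  have hm : AEStronglyMeasurable (fun y => f (x - y)) volume :=
    hf.aestronglyMeasurable.comp_quasiMeasurePreserving
      (quasiMeasurePreserving_sub_left volume x)
  have h1 : ∫⁻ y, ‖ρ y‖ₑ = 1 := by
    rw [← ofReal_integral_norm_eq_lintegral_enorm hρi]
    have : ∀ y, ‖ρ y‖ = ρ y := fun y => by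
      rw [Real.norm_eq_abs, abs_of_nonneg ((bumpSeq n m).nonneg_normed y)]
    simp only [this]
    rw [(bumpSeq n m).integral_normed, ENNReal.ofReal_one]
  calc ‖mollify m f x - f x‖ₑ ^ 2 ≤ (∫⁻ y, ‖ρ y‖ₑ * ‖f (x - y) - f x‖ₑ) ^ 2 := by
        rw [e]
        gcongr
        refine (enorm_integral_le_lintegral_enorm _).trans (le_of_eq ?_)
        simp_rw [enorm_smul]
    _ ≤ (∫⁻ y, ‖ρ y‖ₑ) * ∫⁻ y, ‖ρ y‖ₑ * ‖f (x - y) - f x‖ₑ ^ 2 :=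
        lintegral_mul_sq_le hρc.enorm.aemeasurable
          (hm.sub aestronglyMeasurable_const).enorm
    _ = _ := by rw [h1, one_mul]

/-- Integrating the pointwise Jensen bound in `x` and applying Tonelli leaves an average of `‖f(· -
y) - f‖²` over `y` in a shrinking ball, so continuity of translations suffices. -/
lemma tendsto_eLpNorm_mollify_sub {f : Space n → ℂ} (hf : MemLp f 2 volume) :
    Tendsto (fun m => eLpNorm (mollify m f - f) 2 volume) atTop (𝓝 0) := by
  rw [ENNReal.tendsto_nhds_zero]
  intro ε hε
  have h := (ENNReal.tendsto_nhds_zero.1 (tendsto_eLpNorm_translate_sub hf)) ε hε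
  obtain ⟨δ, hδ, hδ'⟩ := Metric.eventually_nhds_iff.1 h
  have hr : ∀ᶠ m : ℕ in atTop, (1 : ℝ) / (m + 1) < δ :=
    (tendsto_one_div_add_atTop_nhds_zero_nat).eventually_lt_const hδ
  filter_upwards [hr] with m hm
  set ρ := (bumpSeq n m).normed (volume : Measure (Space n)) with hρ
  have hρi : Integrable ρ volume := (bumpSeq n m).integrable_normed
  have h1 : ∫⁻ y, ‖ρ y‖ₑ = 1 := by
    rw [← ofReal_integral_norm_eq_lintegral_enorm hρi]
    have : ∀ y, ‖ρ y‖ = ρ y := fun y => by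
      rw [Real.norm_eq_abs, abs_of_nonneg ((bumpSeq n m).nonneg_normed y)]
    simp only [this]
    rw [(bumpSeq n m).integral_normed, ENNReal.ofReal_one]
  have sq_eLp : ∀ g : Space n → ℂ, eLpNorm g 2 volume ^ 2 = ∫⁻ x, ‖g x‖ₑ ^ 2 := by
    intro g
    rw [eLpNorm_eq_lintegral_rpow_enorm_toReal (by norm_num) (by norm_num), ← ENNReal.rpow_natCast,
      ← ENNReal.rpow_mul]
    norm_num
  have key : eLpNorm (mollify m f - f) 2 volume ^ 2 ≤ ε ^ 2 := by
    rw [sq_eLp]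
    calc ∫⁻ x, ‖(mollify m f - f) x‖ₑ ^ 2
        ≤ ∫⁻ x, ∫⁻ y, ‖ρ y‖ₑ * ‖f (x - y) - f x‖ₑ ^ 2 :=
          lintegral_mono fun x => enorm_mollify_sub_sq_le (locallyIntegrable_of_memLp_two hf) m x
      _ = ∫⁻ y, ∫⁻ x, ‖ρ y‖ₑ * ‖f (x - y) - f x‖ₑ ^ 2 := by
          apply lintegral_lintegral_swap
          have a1 : AEStronglyMeasurable (fun q : Space n × Space n => f (q.1 - q.2))
              (volume.prod volume) :=
            hf.1.comp_quasiMeasurePreserving (quasiMeasurePreserving_sub _ _)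
          have a2 : AEStronglyMeasurable (fun q : Space n × Space n => f q.1)
              (volume.prod volume) := hf.1.comp_fst
          have a3 : Continuous (fun q : Space n × Space n => ‖ρ q.2‖ₑ) :=
            ((bumpSeq n m).continuous_normed.comp continuous_snd).enorm
          exact a3.aemeasurable.mul ((a1.sub a2).enorm.pow_const 2)
      _ ≤ ∫⁻ y, ‖ρ y‖ₑ * ε ^ 2 := by
          refine lintegral_mono fun y => ?_
          simp only
          by_cases hy : ρ y = 0
          · simp [hy]
          have hy' : y ∈ Function.support ρ := hy
          rw [(bumpSeq n m).support_normed_eq, Metric.mem_ball] at hy'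
          rw [lintegral_const_mul' _ _ enorm_ne_top]
          gcongr
          rw [← sq_eLp (fun x => f (x - y) - f x)]
          gcongr
          exact hδ' (hy'.trans hm)
      _ = ε ^ 2 := by
          rw [lintegral_mul_const _ (bumpSeq n m).continuous_normed.enorm.measurable, h1, one_mul]
  exact (ENNReal.pow_le_pow_left_iff two_ne_zero).1 key

end Mollification

/-! ### Calculus of convergence in `Lᵖ`. -/

section TendstoLp

variable {α : Type*} [MeasurableSpace α] {μ : Measure α}
  {E : Type*} [NormedAddCommGroup E]

/-- Convergence of a sequence of functions in `Lᵖ`, all of them being in `Lᵖ`. -/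
structure TendstoLp (p : ENNReal) (μ : Measure α) (F : ℕ → α → E) (f : α → E) : Prop where
  memLp : ∀ m, MemLp (F m) p μ
  memLp_lim : MemLp f p μ
  tendsto : Tendsto (fun m => eLpNorm (fun x => F m x - f x) p μ) atTop (𝓝 0)

namespace TendstoLp

variable {p : ENNReal} {F G : ℕ → α → E} {f g : α → E}

lemma of_eLpNorm_le (hF : ∀ m, MemLp (F m) p μ) (hf : MemLp f p μ) {b : ℕ → ENNReal}
    (hb : Tendsto b atTop (𝓝 0)) (h : ∀ m, eLpNorm (fun x => F m x - f x) p μ ≤ b m) :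
    TendstoLp p μ F f :=
  ⟨hF, hf, tendsto_of_tendsto_of_tendsto_of_le_of_le tendsto_const_nhds hb (fun _ => zero_le) h⟩

lemma const (hf : MemLp f p μ) : TendstoLp p μ (fun _ => f) f :=
  ⟨fun _ => hf, hf, by simp⟩

lemma add (hp : 1 ≤ p) (hF : TendstoLp p μ F f) (hG : TendstoLp p μ G g) :
    TendstoLp p μ (fun m x => F m x + G m x) (fun x => f x + g x) := by
  refine of_eLpNorm_le (fun m => (hF.memLp m).add (hG.memLp m)) (hF.memLp_lim.add hG.memLp_lim)
    (by simpa using hF.tendsto.add hG.tendsto) fun m => ?_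
  refine le_trans (le_of_eq ?_) (eLpNorm_add_le ((hF.memLp m).sub hF.memLp_lim).1
    ((hG.memLp m).sub hG.memLp_lim).1 hp)
  congr 1
  ext x
  simp only [Pi.add_apply]
  abel

lemma neg (hF : TendstoLp p μ F f) : TendstoLp p μ (fun m x => - F m x) (fun x => - f x) := by
  refine of_eLpNorm_le (fun m => (hF.memLp m).neg) hF.memLp_lim.neg hF.tendsto fun m => ?_
  rw [← eLpNorm_neg]
  refine le_of_eq ?_
  congr 1
  ext x
  simp only [Pi.neg_apply]
  abel

lemma sub (hp : 1 ≤ p) (hF : TendstoLp p μ F f) (hG : TendstoLp p μ G g) :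
    TendstoLp p μ (fun m x => F m x - G m x) (fun x => f x - g x) := by
  simpa only [sub_eq_add_neg] using hF.add hp hG.neg

lemma sum {ι : Type*} (s : Finset ι) (hp : 1 ≤ p) {F : ι → ℕ → α → E} {f : ι → α → E}
    (h : ∀ i ∈ s, TendstoLp p μ (F i) (f i)) :
    TendstoLp p μ (fun m x => ∑ i ∈ s, F i m x) (fun x => ∑ i ∈ s, f i x) := by
  classical
  induction s using Finset.induction_on with
  | empty => simpa using const (μ := μ) (p := p) (f := fun _ => (0 : E)) MemLp.zero
  | insert a s ha ih =>
    simp only [Finset.sum_insert ha]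
    exact (h a (Finset.mem_insert_self _ _)).add hp
      (ih fun i hi => h i (Finset.mem_insert_of_mem hi))

lemma mono_measure {ν : Measure α} (hν : ν ≤ μ) (hF : TendstoLp p μ F f) : TendstoLp p ν F f :=
  of_eLpNorm_le (fun m => (hF.memLp m).mono_measure hν) (hF.memLp_lim.mono_measure hν) hF.tendsto
    fun _ => eLpNorm_mono_measure _ hν

lemma congr (hF : TendstoLp p μ F f) (hFG : ∀ m, F m =ᵐ[μ] G m) (hfg : f =ᵐ[μ] g) :
    TendstoLp p μ G g := by
  refine of_eLpNorm_le (fun m => (memLp_congr_ae (hFG m)).1 (hF.memLp m))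
    ((memLp_congr_ae hfg).1 hF.memLp_lim) hF.tendsto fun m => le_of_eq (eLpNorm_congr_ae ?_)
  filter_upwards [hFG m, hfg] with x h1 h2
  rw [h1, h2]

lemma congr_lim (hF : TendstoLp p μ F f) (hfg : f =ᵐ[μ] g) : TendstoLp p μ F g :=
  hF.congr (fun _ => ae_eq_rfl) hfg

lemma conj {F : ℕ → α → ℂ} {f : α → ℂ} (hF : TendstoLp p μ F f) :
    TendstoLp p μ (fun m x => (starRingEnd ℂ) (F m x)) (fun x => (starRingEnd ℂ) (f x)) := by
  refine of_eLpNorm_le (fun m => (hF.memLp m).star) hF.memLp_lim.star hF.tendsto fun m => ?_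
  refine le_of_eq (eLpNorm_congr_norm_ae (.of_forall fun x => ?_))
  rw [← map_sub, RCLike.norm_conj]

lemma bdd_mul {c : α → ℂ} {C : ℝ} (hc : AEStronglyMeasurable c μ)
    (hC : ∀ᵐ x ∂μ, ‖c x‖ ≤ C) {F : ℕ → α → ℂ} {f : α → ℂ} (hF : TendstoLp p μ F f) :
    TendstoLp p μ (fun m x => c x * F m x) (fun x => c x * f x) := by
  have key : ∀ g : α → ℂ, MemLp g p μ → MemLp (fun x => c x * g x) p μ ∧
      eLpNorm (fun x => c x * g x) p μ ≤ ENNReal.ofReal C * eLpNorm g p μ := by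
    intro g hg
    have hb : ∀ᵐ x ∂μ, ‖c x * g x‖ ≤ C * ‖g x‖ := by
      filter_upwards [hC] with x hx
      rw [norm_mul]
      gcongr
    exact ⟨hg.of_le_mul (hc.mul hg.1) hb, eLpNorm_le_mul_eLpNorm_of_ae_le_mul hb p⟩
  refine of_eLpNorm_le (fun m => (key _ (hF.memLp m)).1) (key _ hF.memLp_lim).1
    (b := fun m => ENNReal.ofReal C * eLpNorm (fun x => F m x - f x) p μ) ?_ fun m => ?_
  · simpa using ENNReal.Tendsto.const_mul hF.tendsto (Or.inr ENNReal.ofReal_ne_top)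
  · refine le_trans (le_of_eq ?_) (key _ ((hF.memLp m).sub hF.memLp_lim)).2
    congr 1
    ext x
    simp only [Pi.sub_apply, mul_sub]

lemma const_mul (c : ℂ) {F : ℕ → α → ℂ} {f : α → ℂ} (hF : TendstoLp p μ F f) :
    TendstoLp p μ (fun m x => c * F m x) (fun x => c * f x) :=
  hF.bdd_mul (C := ‖c‖) aestronglyMeasurable_const (.of_forall fun _ => le_rfl)

/-- All densities of the virial identity are quadratic, so this is what passes them to the limit.
The difference is split as `(F - f) G + f (G - g)`, and the norm of `G` is controlled through `G -
g` and `g`. -/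
lemma mul {F G : ℕ → α → ℂ} {f g : α → ℂ} (hF : TendstoLp 2 μ F f) (hG : TendstoLp 2 μ G g) :
    TendstoLp 1 μ (fun m x => F m x * G m x) (fun x => f x * g x) := by
  have hmul : ∀ a b : α → ℂ, MemLp a 2 μ → MemLp b 2 μ → MemLp (fun x => a x * b x) 1 μ ∧
      eLpNorm (fun x => a x * b x) 1 μ ≤ eLpNorm a 2 μ * eLpNorm b 2 μ := by
    intro a b ha hb
    refine ⟨hb.mul' ha, ?_⟩
    have := eLpNorm_smul_le_mul_eLpNorm (p := 2) (q := 2) (r := 1) hb.1 ha.1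
    exact this
  have hGb : Tendsto (fun m => eLpNorm (fun x => F m x - f x) 2 μ *
      (eLpNorm (fun x => G m x - g x) 2 μ + eLpNorm g 2 μ)
      + eLpNorm f 2 μ * eLpNorm (fun x => G m x - g x) 2 μ) atTop (𝓝 0) := by
    have h1 : Tendsto (fun m => eLpNorm (fun x => G m x - g x) 2 μ + eLpNorm g 2 μ) atTop
        (𝓝 (0 + eLpNorm g 2 μ)) := hG.tendsto.add tendsto_const_nhds
    have h2 := ENNReal.Tendsto.mul hF.tendsto (Or.inr (by simpa using hG.memLp_lim.2.ne)) h1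
      (Or.inr (by simp))
    have h3 := ENNReal.Tendsto.const_mul hG.tendsto (Or.inr hF.memLp_lim.2.ne)
    simpa using h2.add h3
  refine of_eLpNorm_le (fun m => (hmul _ _ (hF.memLp m) (hG.memLp m)).1)
    (hmul _ _ hF.memLp_lim hG.memLp_lim).1 hGb fun m => ?_
  have dF := (hF.memLp m).sub hF.memLp_lim
  have dG := (hG.memLp m).sub hG.memLp_lim
  have e : (fun x => F m x * G m x - f x * g x)
      = (fun x => (F m x - f x) * G m x) + (fun x => f x * (G m x - g x)) := by
    ext x
    simp only [Pi.add_apply]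
    ring
  have eG : G m = (fun x => G m x - g x) + g := by
    ext x
    simp
  rw [e]
  refine (eLpNorm_add_le (hmul _ _ dF (hG.memLp m)).1.1 (hmul _ _ hF.memLp_lim dG).1.1
    le_rfl).trans ?_
  gcongr
  · refine (hmul _ _ dF (hG.memLp m)).2.trans ?_
    gcongr
    · exact le_rfl
    · conv_lhs => rw [eG]
      exact eLpNorm_add_le dG.1 hG.memLp_lim.1 (by norm_num)
  · exact (hmul _ _ hF.memLp_lim dG).2

lemma tendsto_integral [NormedSpace ℝ E] (hF : TendstoLp 1 μ F f) :
    Tendsto (fun m => ∫ x, F m x ∂μ) atTop (𝓝 (∫ x, f x ∂μ)) :=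
  tendsto_integral_of_L1' f hF.memLp_lim.1
    (.of_forall fun m => memLp_one_iff_integrable.1 (hF.memLp m)) hF.tendsto

end TendstoLp

end TendstoLp

/-! ### Weak derivatives and their mollifications. -/

section WeakDerivative

variable {n : ℕ}

lemma contDiff_pd {E : Type*} [NormedAddCommGroup E] [NormedSpace ℝ E] {f : Space n → E}
    {k l : WithTop ℕ∞} (hf : ContDiff ℝ l f) (hkl : k + 1 ≤ l) (j : Fin n) :
    ContDiff ℝ k (pd j f) :=
  (hf.fderiv_right hkl).clm_apply contDiff_const

lemma continuous_pd {E : Type*} [NormedAddCommGroup E] [NormedSpace ℝ E] {f : Space n → E}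
    (hf : ContDiff ℝ 1 f) (j : Fin n) : Continuous (pd j f) :=
  (contDiff_pd (k := 0) hf (by norm_num) j).continuous

lemma tsupport_pd_subset {E : Type*} [NormedAddCommGroup E] [NormedSpace ℝ E] {f : Space n → E}
    (j : Fin n) : tsupport (pd j f) ⊆ tsupport f := by
  refine closure_minimal (fun x hx => ?_) (isClosed_tsupport f)
  by_contra h
  exact hx (by simp [pd, fderiv_of_notMem_tsupport (𝕜 := ℝ) h])

lemma HasCompactSupport.pd {E : Type*} [NormedAddCommGroup E] [NormedSpace ℝ E] {f : Space n → E}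
    (hf : HasCompactSupport f) (j : Fin n) : HasCompactSupport (pd j f) :=
  hf.of_isClosed_subset (isClosed_tsupport _) (tsupport_pd_subset j)

lemma pd_mul {f g : Space n → ℂ} {x : Space n} (hf : DifferentiableAt ℝ f x)
    (hg : DifferentiableAt ℝ g x) (j : Fin n) :
    pd j (fun y => f y * g y) x = pd j f x * g x + f x * pd j g x := by
  simp only [pd]
  rw [fderiv_fun_mul hf hg]
  simp
  ring

lemma pd_add {E : Type*} [NormedAddCommGroup E] [NormedSpace ℝ E] {f g : Space n → E}
    {x : Space n} (hf : DifferentiableAt ℝ f x) (hg : DifferentiableAt ℝ g x) (j : Fin n) :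
    pd j (fun y => f y + g y) x = pd j f x + pd j g x := by
  simp only [pd]
  rw [fderiv_fun_add hf hg]
  simp

lemma pd_sub {E : Type*} [NormedAddCommGroup E] [NormedSpace ℝ E] {f g : Space n → E}
    {x : Space n} (hf : DifferentiableAt ℝ f x) (hg : DifferentiableAt ℝ g x) (j : Fin n) :
    pd j (fun y => f y - g y) x = pd j f x - pd j g x := by
  simp only [pd]
  rw [fderiv_fun_sub hf hg]
  simp

lemma pd_neg {E : Type*} [NormedAddCommGroup E] [NormedSpace ℝ E] {f : Space n → E}
    {x : Space n} (j : Fin n) : pd j (fun y => - f y) x = - pd j f x := by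
  simp only [pd]
  rw [fderiv_fun_neg]
  simp

lemma pd_sum {ι : Type*} {E : Type*} [NormedAddCommGroup E] [NormedSpace ℝ E] (s : Finset ι)
    {f : ι → Space n → E} {x : Space n}
    (hf : ∀ i ∈ s, DifferentiableAt ℝ (f i) x) (j : Fin n) :
    pd j (fun y => ∑ i ∈ s, f i y) x = ∑ i ∈ s, pd j (f i) x := by
  simp only [pd]
  rw [fderiv_fun_sum hf]
  simp

lemma pd_const_mul (c : ℂ) {f : Space n → ℂ} {x : Space n} (hf : DifferentiableAt ℝ f x)
    (j : Fin n) : pd j (fun y => c * f y) x = c * pd j f x := by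
  simp only [pd]
  rw [fderiv_const_mul hf]
  simp

lemma pd_conj {f : Space n → ℂ} {x : Space n} (hf : DifferentiableAt ℝ f x) (j : Fin n) :
    pd j (fun y => (starRingEnd ℂ) (f y)) x = (starRingEnd ℂ) (pd j f x) := by
  simp only [pd]
  have := (Complex.conjCLE.toContinuousLinearMap.hasFDerivAt.comp x hf.hasFDerivAt).fderiv
  simp only [Function.comp_def] at this
  have h2 : (fun y => Complex.conjCLE.toContinuousLinearMap (f y))
    = fun y => (starRingEnd ℂ) (f y) := by ext y; simp
  rw [h2] at this
  rw [this]
  simp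

lemma pd_ofReal {f : Space n → ℝ} {x : Space n} (hf : DifferentiableAt ℝ f x) (j : Fin n) :
    pd j (fun y => (f y : ℂ)) x = ((pd j f x : ℝ) : ℂ) := by
  simp only [pd]
  have := (Complex.ofRealCLM.hasFDerivAt.comp x hf.hasFDerivAt).fderiv
  simp only [Function.comp_def, Complex.ofRealCLM_apply] at this
  rw [this]
  simp

lemma integral_pd_eq_zero {f : Space n → ℂ} (hf : ContDiff ℝ 1 f) (hfc : HasCompactSupport f)
    (j : Fin n) : ∫ x, pd j f x = 0 := by
  have h := integral_mul_fderiv_eq_neg_fderiv_mul_of_integrable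
    (μ := (volume : Measure (Space n))) (f := fun _ => (1 : ℂ)) (g := f) (v := basisVec j)
    (by simp) (by
      simpa using! (continuous_pd hf j).integrable_of_hasCompactSupport
        (HasCompactSupport.pd hfc j))
    (by simpa using hf.continuous.integrable_of_hasCompactSupport hfc)
    (fun x _ => differentiableAt_const _)
    (fun x _ => hf.differentiable one_ne_zero x)
  simpa [pd] using h

lemma integral_mul_pd {f g : Space n → ℂ} (hf : ContDiff ℝ 1 f) (hg : ContDiff ℝ 1 g)
    (hgc : HasCompactSupport g) (j : Fin n) :
    ∫ x, f x * pd j g x = - ∫ x, pd j f x * g x := by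
  have cp := continuous_pd hf j
  have cq := continuous_pd hg j
  exact integral_mul_fderiv_eq_neg_fderiv_mul_of_integrable
    ((cp.mul hg.continuous).integrable_of_hasCompactSupport hgc.mul_left)
    ((hf.continuous.mul cq).integrable_of_hasCompactSupport
      (HasCompactSupport.pd hgc j).mul_left)
    ((hf.continuous.mul hg.continuous).integrable_of_hasCompactSupport hgc.mul_left)
    (fun x _ => hf.differentiable one_ne_zero x) (fun x _ => hg.differentiable one_ne_zero x)

/-- `g` is the weak partial derivative `∂_j f` on the whole space. -/
def IsWeakPartial (j : Fin n) (f g : Space n → ℂ) : Prop :=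
  ∀ φ : Space n → ℂ, ContDiff ℝ ∞ φ → HasCompactSupport φ →
    ∫ x, f x * pd j φ x = - ∫ x, g x * φ x

/-- The test function `y ↦ ρ_m (x - y)`. -/
noncomputable def bumpTest (m : ℕ) (x y : Space n) : ℂ :=
  (((bumpSeq n m).normed (volume : Measure (Space n)) (x - y) : ℝ) : ℂ)

lemma contDiff_bumpTest (m : ℕ) (x : Space n) : ContDiff ℝ ∞ (bumpTest m x) :=
  Complex.ofRealCLM.contDiff.comp
    ((bumpSeq n m).contDiff_normed.comp (contDiff_const.sub contDiff_id))

lemma hasCompactSupport_bumpTest (m : ℕ) (x : Space n) : HasCompactSupport (bumpTest m x) := by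
  have : HasCompactSupport ((bumpSeq n m).normed (volume : Measure (Space n)) ∘
      Homeomorph.subLeft x) := (bumpSeq n m).hasCompactSupport_normed.comp_homeomorph _
  exact this.comp_left (g := fun r : ℝ => (r : ℂ)) (by simp)

lemma mollify_eq_integral (f : Space n → ℂ) (m : ℕ) (x : Space n) :
    mollify m f x = ∫ y, f y * bumpTest m x y := by
  simp only [mollify]
  rw [convolution_def, ← integral_sub_left_eq_self _ volume x]
  refine integral_congr_ae (.of_forall fun y => ?_)
  simp [bumpTest, mul_comm]

lemma pd_mollify_eq_integral {f : Space n → ℂ} (hf : LocallyIntegrable f volume) (j : Fin n)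
    (m : ℕ) (x : Space n) : pd j (mollify m f) x = - ∫ y, f y * pd j (bumpTest m x) y := by
  set ρ := (bumpSeq n m).normed (volume : Measure (Space n)) with hρ
  have hρs : ContDiff ℝ ∞ ρ := (bumpSeq n m).contDiff_normed
  have hρc : HasCompactSupport ρ := (bumpSeq n m).hasCompactSupport_normed
  have h1 := hρc.hasFDerivAt_convolution_left (lsmul ℝ ℝ) (hρs.of_le (by simp)) hf x
  have hφd : ∀ y, pd j (bumpTest m x) y = -((pd j ρ (x - y) : ℝ) : ℂ) := by
    intro y
    have d : DifferentiableAt ℝ (fun y => ρ (x - y)) y :=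
      ((hρs.comp (contDiff_const.sub contDiff_id)).differentiable (by simp)) y
    have h2 : pd j (fun y => ρ (x - y)) y = - pd j ρ (x - y) := by
      have := ((hρs.differentiable (by simp) (x - y)).hasFDerivAt.comp y
        ((hasFDerivAt_id y).const_sub x)).fderiv
      simp only [Function.comp_def] at this
      simp only [pd]
      rw [this]
      simp
    rw [show bumpTest m x = fun y => ((ρ (x - y) : ℝ) : ℂ) from rfl,
      pd_ofReal (f := fun y => ρ (x - y)) d, h2]
    simp
  have hex : ConvolutionExistsAt (fderiv ℝ ρ) f x ((lsmul ℝ ℝ).precompL (Space n)) volume :=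
    (hρc.fderiv ℝ).convolutionExists_left _ (hρs.continuous_fderiv (by simp)) hf x
  simp only [hφd]
  rw [← integral_neg]
  simp only [pd, mollify]
  rw [← hρ, h1.fderiv, convolution_def, ContinuousLinearMap.integral_apply hex,
    ← integral_sub_left_eq_self _ volume x]
  refine integral_congr_ae (.of_forall fun y => ?_)
  simp [precompL_apply, mul_comm]

/-- Differentiating the convolution kernel in `x` is minus differentiating it in `y`, and as a
function of `y` the kernel is an admissible test function. -/
lemma pd_mollify {f g : Space n → ℂ} {j : Fin n} (hf : LocallyIntegrable f volume)
    (hfg : IsWeakPartial j f g) (m : ℕ) : pd j (mollify m f) = mollify m g := by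
  ext x
  rw [pd_mollify_eq_integral hf, hfg _ (contDiff_bumpTest m x) (hasCompactSupport_bumpTest m x),
    mollify_eq_integral, neg_neg]

/-- Only the divergence is assumed to be a function, not the individual derivatives. This is the
information that an equation for the Laplacian provides about the gradient. -/
lemma sum_pd_mollify {f : Fin n → Space n → ℂ} {g : Space n → ℂ}
    (hf : ∀ j, LocallyIntegrable (f j) volume)
    (hfg : ∀ φ : Space n → ℂ, ContDiff ℝ ∞ φ → HasCompactSupport φ →
      ∑ j, ∫ x, f j x * pd j φ x = - ∫ x, g x * φ x) (m : ℕ) (x : Space n) :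
    ∑ j, pd j (mollify m (f j)) x = mollify m g x := by
  simp_rw [fun j => pd_mollify_eq_integral (hf j) j m x, Finset.sum_neg_distrib,
    hfg _ (contDiff_bumpTest m x) (hasCompactSupport_bumpTest m x), mollify_eq_integral, neg_neg]

lemma memLp_mollify {f : Space n → ℂ} (hf : MemLp f 2 volume) (hfc : HasCompactSupport f)
    (m : ℕ) : MemLp (mollify m f) 2 volume :=
  (contDiff_mollify (locallyIntegrable_of_memLp_two hf) m).continuous.memLp_of_hasCompactSupport
    (hasCompactSupport_mollify hfc m)

lemma tendstoLp_mollify {f : Space n → ℂ} (hf : MemLp f 2 volume) (hfc : HasCompactSupport f) :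
    TendstoLp 2 volume (fun m => mollify m f) f :=
  ⟨memLp_mollify hf hfc, hf, tendsto_eLpNorm_mollify_sub hf⟩

/-- As `c` is only `C¹`, the product `c φ` is not an admissible test function. The classical product
rule is used for the mollified `f` instead, and both sides converge. -/
lemma IsWeakPartial.mul_contDiff {f g c : Space n → ℂ} {j : Fin n} (hf : MemLp f 2 volume)
    (hg : MemLp g 2 volume) (hfc : HasCompactSupport f) (hgc : HasCompactSupport g)
    (hfg : IsWeakPartial j f g) (hc : ContDiff ℝ 1 c) :
    IsWeakPartial j (fun x => c x * f x) (fun x => pd j c x * f x + c x * g x) := by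
  intro φ hφ hφc
  have hφ1 : ContDiff ℝ 1 φ := hφ.of_le (by simp)
  have lf := tendstoLp_mollify hf hfc
  have lg := tendstoLp_mollify hg hgc
  have dφ := continuous_pd hφ1 j
  have dc := continuous_pd hc j
  have mk : ∀ b : Space n → ℂ, Continuous b → HasCompactSupport b →
      TendstoLp 2 volume (fun _ : ℕ => b) b := fun b hb hbc =>
    TendstoLp.const (hb.memLp_of_hasCompactSupport hbc)
  have t1 := (lf.mul (mk (fun x => c x * pd j φ x) (hc.continuous.mul dφ)
    (HasCompactSupport.pd hφc j).mul_left)).tendsto_integral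
  have t2 := ((lf.mul (mk (fun x => pd j c x * φ x) (dc.mul hφ.continuous) hφc.mul_left)).add le_rfl
    (lg.mul (mk (fun x => c x * φ x) (hc.continuous.mul hφ.continuous)
      hφc.mul_left))).tendsto_integral
  have e : ∀ m, ∫ x, mollify m f x * (c x * pd j φ x)
      = - ∫ x, (mollify m f x * (pd j c x * φ x) + mollify m g x * (c x * φ x)) := by
    intro m
    have hs := (contDiff_mollify (locallyIntegrable_of_memLp_two hf) m).of_le
      (show (1 : WithTop ℕ∞) ≤ ∞ by simp)
    have := integral_mul_pd (hs.mul hc) hφ1 hφc j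
    calc _ = ∫ x, (mollify m f x * c x) * pd j φ x := by
          refine integral_congr_ae (.of_forall fun y => ?_); simp only; ring
      _ = _ := this
      _ = _ := by
          congr 1
          refine integral_congr_ae (.of_forall fun y => ?_)
          simp only
          rw [pd_mul (hs.differentiable one_ne_zero y) (hc.differentiable one_ne_zero y),
            pd_mollify (locallyIntegrable_of_memLp_two hf) hfg]
          ring
  simp only [e] at t1
  have := tendsto_nhds_unique t1 t2.neg
  calc _ = ∫ x, f x * (c x * pd j φ x) := by
        refine integral_congr_ae (.of_forall fun y => ?_); simp only; ring
    _ = _ := this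
    _ = _ := by
        congr 1
        refine integral_congr_ae (.of_forall fun y => ?_); simp only; ring

end WeakDerivative

/-! ### The covariant gradient and the weak equation away from the origin. -/

section Covariant

variable {n : ℕ} {A : Space n → Space n}

lemma exists_cutoff {K U : Set (Space n)} (hK : IsCompact K) (hU : IsOpen U) (hKU : K ⊆ U) :
    ∃ ζ : Space n → ℂ, ContDiff ℝ ∞ ζ ∧ HasCompactSupport ζ ∧ tsupport ζ ⊆ U ∧
      ∀ᶠ x in 𝓝ˢ K, ζ x = 1 := by
  obtain ⟨L, hL, hKL, hLU⟩ := exists_compact_between hK hU hKU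
  obtain ⟨f, hf1, hf0, -⟩ := exists_contMDiffMap_one_nhds_of_subset_interior (n := (⊤ : ℕ∞))
    (modelWithCornersSelf ℝ (Space n)) hK.isClosed hKL
  have hsupp : tsupport (fun x => ((f x : ℝ) : ℂ)) ⊆ L := by
    refine closure_minimal (fun x hx => ?_) hL.isClosed
    by_contra h
    exact hx (by simp [hf0 x h])
  refine ⟨fun x => ((f x : ℝ) : ℂ), Complex.ofRealCLM.contDiff.comp f.contMDiff.contDiff,
    hL.of_isClosed_subset (isClosed_tsupport _) hsupp, hsupp.trans hLU, ?_⟩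
  filter_upwards [hf1] with x hx
  simp [hx]

/-- The `j`-th component of the covariant gradient of a differentiable function. -/
noncomputable def covD (A : Space n → Space n) (j : Fin n) (v : Space n → ℂ) (x : Space n) : ℂ :=
  pd j v x - Complex.I * (A x j : ℂ) * v x

/-- The operator `-∇_A²` on twice differentiable functions. -/
noncomputable def magLap (A : Space n → Space n) (v : Space n → ℂ) (x : Space n) : ℂ :=
  - ∑ j, covD A j (covD A j v) x

lemma contDiff_of_forall_mem_tsupport {E : Type*} [NormedAddCommGroup E] [NormedSpace ℝ E]
    {k : WithTop ℕ∞} {f : Space n → E} (h : ∀ x ∈ tsupport f, ContDiffAt ℝ k f x) :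
    ContDiff ℝ k f := by
  rw [contDiff_iff_contDiffAt]
  intro x
  by_cases hx : x ∈ tsupport f
  · exact h x hx
  · exact contDiffAt_const.congr_of_eventuallyEq (notMem_tsupport_iff_eventuallyEq.1 hx)

lemma contDiff_mul_of_tsupport {k : WithTop ℕ∞} {c ζ : Space n → ℂ} {U : Set (Space n)}
    (hU : IsOpen U) (hc : ContDiffOn ℝ k c U) (hζ : ContDiff ℝ k ζ) (hζU : tsupport ζ ⊆ U) :
    ContDiff ℝ k (fun x => c x * ζ x) := by
  refine contDiff_of_forall_mem_tsupport fun x hx => ?_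
  have hx' : x ∈ tsupport ζ := closure_mono (Function.support_mul_subset_right c ζ) hx
  exact (hc.contDiffAt (hU.mem_nhds (hζU hx'))).mul hζ.contDiffAt

lemma contDiffOn_component {k : WithTop ℕ∞} {U : Set (Space n)} (hA : ContDiffOn ℝ k A U)
    (j : Fin n) : ContDiffOn ℝ k (fun x => (A x j : ℂ)) U :=
  Complex.ofRealCLM.contDiff.comp_contDiffOn
    ((EuclideanSpace.proj (𝕜 := ℝ) j).contDiff.comp_contDiffOn hA)

lemma memLp_component (p : L2Vec n) (j : Fin n) : MemLp (fun x => p x j) 2 volume :=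
  (EuclideanSpace.proj j : EuclideanSpace ℂ (Fin n) →L[ℂ] ℂ).comp_memLp' (Lp.memLp p)

lemma integrable_mul_of_continuous {f g : Space n → ℂ} (hf : MemLp f 2 volume)
    (hg : Continuous g) (hgc : HasCompactSupport g) : Integrable (fun x => f x * g x) :=
  memLp_one_iff_integrable.1 ((hg.memLp_of_hasCompactSupport hgc : MemLp g 2 volume).mul' hf)

lemma integral_add_add {f g h : Space n → ℂ} (hf : Integrable f) (hg : Integrable g)
    (hh : Integrable h) :
    ∫ x, (f x + (g x + h x)) = (∫ x, f x) + ((∫ x, g x) + ∫ x, h x) := by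
  rw [← integral_add hg hh]
  exact integral_add hf (hg.add hh)

/-- The covariant gradient is tested against `ζ φ`. Because `ζ` vanishes near the origin, `A ζ` is
bounded and the magnetic term can be moved to the right side as an ordinary `L²` function. -/
lemma isWeakPartial_cutoff_mul (hA : ContDiffOn ℝ 1 A {0}ᶜ) {w : L2 n} {p : L2Vec n}
    (hp : IsCovariantGradient A w p) {ζ : Space n → ℂ} (hζ : ContDiff ℝ ∞ ζ)
    (hζc : HasCompactSupport ζ) (hζ0 : tsupport ζ ⊆ {0}ᶜ) (j : Fin n) :
    IsWeakPartial j (fun x => ζ x * w x)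
      (fun x => ζ x * p x j + Complex.I * ((A x j : ℂ) * ζ x) * w x + pd j ζ x * w x) := by
  intro φ hφ hφc
  have h := hp (fun x => ζ x * φ x) (hζ.mul hφ) hφc.mul_left j
  have hAζ : ContDiff ℝ 1 (fun x => (A x j : ℂ) * ζ x) :=
    contDiff_mul_of_tsupport isOpen_compl_singleton (contDiffOn_component hA j)
      (hζ.of_le (by simp)) hζ0
  have cζ := continuous_pd (hζ.of_le (by simp)) j
  have cφ := continuous_pd (hφ.of_le (by simp)) j
  have i1 : Integrable (fun x => w x * (ζ x * pd j φ x)) :=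
    integrable_mul_of_continuous (Lp.memLp w) (hζ.continuous.mul cφ) hζc.mul_right
  have i2 : Integrable (fun x => w x * (pd j ζ x * φ x)) :=
    integrable_mul_of_continuous (Lp.memLp w) (cζ.mul hφ.continuous) hφc.mul_left
  have i3 : Integrable (fun x => w x * (Complex.I * ((A x j : ℂ) * ζ x) * φ x)) :=
    integrable_mul_of_continuous (Lp.memLp w)
      ((continuous_const.mul hAζ.continuous).mul hφ.continuous) hφc.mul_left
  have i4 : Integrable (fun x => p x j * (ζ x * φ x)) :=
    integrable_mul_of_continuous (memLp_component p j) (hζ.continuous.mul hφ.continuous)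
      hφc.mul_left
  have e : ∀ x, w x * (fderiv ℝ (fun x => ζ x * φ x) x (basisVec j)
      + Complex.I * (A x j : ℂ) * (ζ x * φ x))
      = w x * (ζ x * pd j φ x) + (w x * (pd j ζ x * φ x)
        + w x * (Complex.I * ((A x j : ℂ) * ζ x) * φ x)) := by
    intro x
    have := pd_mul (hζ.differentiable (by simp) x) (hφ.differentiable (by simp) x) j
    rw [pd] at this
    rw [this]
    ring
  simp only [e] at h
  rw [integral_add_add i1 i2 i3] at h
  have r : ∫ x, (ζ x * p x j + Complex.I * ((A x j : ℂ) * ζ x) * w x + pd j ζ x * w x) * φ x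
      = ∫ x, (p x j * (ζ x * φ x) + (w x * (Complex.I * ((A x j : ℂ) * ζ x) * φ x)
        + w x * (pd j ζ x * φ x))) := by
    refine integral_congr_ae (.of_forall fun x => ?_)
    simp only
    ring
  rw [r, integral_add_add i4 i3 i2]
  have l : ∫ x, ζ x * w x * pd j φ x = ∫ x, w x * (ζ x * pd j φ x) := by
    refine integral_congr_ae (.of_forall fun x => ?_)
    simp only
    ring
  rw [l]
  linear_combination h

lemma continuous_covD_of_tsupport (hA : ContDiffOn ℝ 1 A {0}ᶜ) {φ : Space n → ℂ}
    (hφ : ContDiff ℝ 1 φ) (hφ0 : tsupport φ ⊆ {0}ᶜ) (j : Fin n) : Continuous (covD A j φ) := by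
  have hAφ : ContDiff ℝ 1 (fun x => (A x j : ℂ) * φ x) :=
    contDiff_mul_of_tsupport isOpen_compl_singleton (contDiffOn_component hA j) hφ hφ0
  have : covD A j φ = fun x => pd j φ x - Complex.I * ((A x j : ℂ) * φ x) := by
    ext x
    simp only [covD]
    ring
  rw [this]
  exact (continuous_pd hφ j).sub (continuous_const.mul hAφ.continuous)

lemma hasCompactSupport_covD {φ : Space n → ℂ} (hφc : HasCompactSupport φ) (j : Fin n) :
    HasCompactSupport (covD A j φ) :=
  (HasCompactSupport.pd hφc j).sub hφc.mul_left

/-- Supplies elements of the form domain against which the form equation for `H_A` can be tested.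
Admitting `C¹` functions rather than smooth ones costs nothing here. -/
lemma isCovariantGradient_of_contDiff (hA : ContDiffOn ℝ 1 A {0}ᶜ) {φ : Space n → ℂ}
    (hφ : ContDiff ℝ 1 φ) (hφc : HasCompactSupport φ) (hφ0 : tsupport φ ⊆ {0}ᶜ)
    {v : L2 n} {q : L2Vec n} (hv : v =ᵐ[volume] φ)
    (hq : ∀ j, (fun x => q x j) =ᵐ[volume] covD A j φ) : IsCovariantGradient A v q := by
  intro ψ hψ hψc j
  have hAφ : ContDiff ℝ 1 (fun x => (A x j : ℂ) * φ x) :=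
    contDiff_mul_of_tsupport isOpen_compl_singleton (contDiffOn_component hA j) hφ hφ0
  have hψ1 : ContDiff ℝ 1 ψ := hψ.of_le (by simp)
  have e1 : ∫ x, v x * (fderiv ℝ ψ x (basisVec j) + Complex.I * (A x j : ℂ) * ψ x)
      = ∫ x, (φ x * pd j ψ x + Complex.I * ((A x j : ℂ) * φ x) * ψ x) := by
    refine integral_congr_ae ?_
    filter_upwards [hv] with x hx
    rw [hx]
    simp only [pd]
    ring
  have e2 : ∫ x, q x j * ψ x
      = ∫ x, (pd j φ x * ψ x - Complex.I * ((A x j : ℂ) * φ x) * ψ x) := by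
    refine integral_congr_ae ?_
    filter_upwards [hq j] with x hx
    rw [hx]
    simp only [covD]
    ring
  have i1 : Integrable (fun x => φ x * pd j ψ x) :=
    (hφ.continuous.mul (continuous_pd hψ1 j)).integrable_of_hasCompactSupport hφc.mul_right
  have i2 : Integrable (fun x => Complex.I * ((A x j : ℂ) * φ x) * ψ x) :=
    ((continuous_const.mul hAφ.continuous).mul hψ.continuous).integrable_of_hasCompactSupport
      hψc.mul_left
  have i3 : Integrable (fun x => pd j φ x * ψ x) :=
    ((continuous_pd hφ j).mul hψ.continuous).integrable_of_hasCompactSupport hψc.mul_left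
  rw [e1, e2, integral_add i1 i2, integral_sub i3 i2, integral_mul_pd hφ hψ1 hψc]
  ring

lemma exists_toL2 {φ : Space n → ℂ} (hφ : MemLp φ 2 volume) : ∃ v : L2 n, v =ᵐ[volume] φ :=
  ⟨hφ.toLp φ, hφ.coeFn_toLp⟩

lemma exists_toL2Vec {φ : Fin n → Space n → ℂ} (hφ : ∀ j, MemLp (φ j) 2 volume) :
    ∃ q : L2Vec n, ∀ᵐ x, ∀ j, q x j = φ j x := by
  have hm : MemLp (fun x => (WithLp.toLp 2 (fun j => φ j x) : EuclideanSpace ℂ (Fin n)))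
      2 volume := by
    have : (fun x => (WithLp.toLp 2 (fun j => φ j x) : EuclideanSpace ℂ (Fin n)))
        = fun x => ∑ j, (φ j x) • EuclideanSpace.single j (1 : ℂ) := by
      ext x i
      simp [Finset.sum_apply, Pi.single_apply]
    rw [this]
    refine memLp_finsetSum _ fun j _ => ?_
    exact ((ContinuousLinearMap.id ℂ ℂ).smulRight
      (EuclideanSpace.single j (1 : ℂ))).comp_memLp' (hφ j)
  refine ⟨hm.toLp _, ?_⟩
  filter_upwards [hm.coeFn_toLp] with x hx j
  rw [hx]

/-- The weak form of `H_A w = h`, where `p = ∇_A w`. -/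
def IsFormSolution (A : Space n → Space n) (p : L2Vec n) (h : L2 n) : Prop :=
  ∀ (v : L2 n) (q : L2Vec n), IsCovariantGradient A v q → inner ℂ q p = inner ℂ v h

lemma inner_L2_eq (v h : L2 n) : inner ℂ v h = ∫ x, (starRingEnd ℂ) (v x) * h x := by
  rw [L2.inner_def]
  simp [mul_comm]

lemma inner_L2Vec_eq (q p : L2Vec n) :
    inner ℂ q p = ∑ j, ∫ x, (starRingEnd ℂ) (q x j) * p x j := by
  rw [L2.inner_def]
  simp only [PiLp.inner_apply, RCLike.inner_apply]
  rw [integral_finsetSum]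
  · simp [mul_comm]
  · intro j _
    exact memLp_one_iff_integrable.1 ((memLp_component q j).star.mul' (memLp_component p j))

/-- The form equation is tested with the conjugate of `φ`: conjugation turns `∂_j - i A^j` into `∂_j
+ i A^j` and removes the conjugate of the inner product. -/
lemma IsFormSolution.weak (hA : ContDiffOn ℝ 1 A {0}ᶜ) {p : L2Vec n} {h : L2 n}
    (hh : IsFormSolution A p h) {φ : Space n → ℂ} (hφ : ContDiff ℝ 1 φ)
    (hφc : HasCompactSupport φ) (hφ0 : tsupport φ ⊆ {0}ᶜ) :
    ∑ j, ∫ x, p x j * (pd j φ x + Complex.I * (A x j : ℂ) * φ x) = ∫ x, h x * φ x := by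
  let ψ : Space n → ℂ := fun x => (starRingEnd ℂ) (φ x)
  have hψ : ContDiff ℝ 1 ψ := Complex.conjCLE.contDiff.comp hφ
  have hψc : HasCompactSupport ψ := hφc.comp_left (g := starRingEnd ℂ) (by simp)
  have hψ0 : tsupport ψ ⊆ {0}ᶜ := by
    refine Subset.trans (closure_mono fun x hx => ?_) hφ0
    intro h0
    exact hx (by simp [ψ, h0])
  obtain ⟨v, hv⟩ := exists_toL2 (hψ.continuous.memLp_of_hasCompactSupport hψc)
  obtain ⟨q, hq⟩ := exists_toL2Vec (φ := fun j => covD A j ψ) fun j =>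
    (continuous_covD_of_tsupport hA hψ hψ0 j).memLp_of_hasCompactSupport
      (hasCompactSupport_covD hψc j)
  have key := hh v q (isCovariantGradient_of_contDiff hA hψ hψc hψ0 hv
    fun j => hq.mono fun x hx => hx j)
  rw [inner_L2_eq, inner_L2Vec_eq] at key
  calc _ = ∑ j, ∫ x, (starRingEnd ℂ) (q x j) * p x j := by
        refine Finset.sum_congr rfl fun j _ => integral_congr_ae ?_
        filter_upwards [hq] with x hx
        rw [hx j, covD, pd_conj (hφ.differentiable one_ne_zero x)]
        simp only [ψ, map_sub, map_mul, Complex.conj_conj, Complex.conj_I, Complex.conj_ofReal]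
        ring
    _ = _ := key
    _ = _ := by
        refine integral_congr_ae ?_
        filter_upwards [hv] with x hx
        rw [hx]
        simp only [ψ, Complex.conj_conj]
        ring

end Covariant

/-! ### Smooth approximation of the domain of `H_A` on compact sets avoiding the origin. -/

section Approximation

variable {n : ℕ} {A : Space n → Space n}

/-- The weak equation tested with `ζ φ`, solved for the divergence of `ζ p`; the result is an `L²`
function because `A ζ` is bounded. -/
lemma weakDiv_cutoff_mul (hA : ContDiffOn ℝ 1 A {0}ᶜ) {p : L2Vec n} {h : L2 n}
    (hh : IsFormSolution A p h) {ζ : Space n → ℂ} (hζ : ContDiff ℝ ∞ ζ)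
    (hζc : HasCompactSupport ζ) (hζ0 : tsupport ζ ⊆ {0}ᶜ) {φ : Space n → ℂ}
    (hφ : ContDiff ℝ ∞ φ) (hφc : HasCompactSupport φ) :
    ∑ j, ∫ x, (ζ x * p x j) * pd j φ x
      = - ∫ x, ((∑ j, (Complex.I * ((A x j : ℂ) * ζ x) + pd j ζ x) * p x j) - ζ x * h x) * φ x := by
  have hζφ : ContDiff ℝ 1 (fun x => ζ x * φ x) := (hζ.mul hφ).of_le (by simp)
  have hw := hh.weak hA (φ := fun x => ζ x * φ x) hζφ hφc.mul_left
    ((closure_mono (Function.support_mul_subset_left ζ φ)).trans hζ0)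
  have hAζ : ∀ j, ContDiff ℝ 1 (fun x => (A x j : ℂ) * ζ x) := fun j =>
    contDiff_mul_of_tsupport isOpen_compl_singleton (contDiffOn_component hA j)
      (hζ.of_le (by simp)) hζ0
  have cζ := fun j => continuous_pd (hζ.of_le (by simp)) j
  have cφ := fun j => continuous_pd (hφ.of_le (by simp)) j
  have i1 : ∀ j, Integrable (fun x => (ζ x * p x j) * pd j φ x) := by
    intro j
    have : Integrable (fun x => p x j * (ζ x * pd j φ x)) :=
      integrable_mul_of_continuous (memLp_component p j) (hζ.continuous.mul (cφ j)) hζc.mul_right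
    exact this.congr (.of_forall fun x => by simp only; ring)
  have i2 : ∀ j, Integrable (fun x =>
      ((Complex.I * ((A x j : ℂ) * ζ x) + pd j ζ x) * p x j) * φ x) := by
    intro j
    have : Integrable (fun x =>
        p x j * ((Complex.I * ((A x j : ℂ) * ζ x) + pd j ζ x) * φ x)) :=
      integrable_mul_of_continuous (memLp_component p j)
        (((continuous_const.mul (hAζ j).continuous).add (cζ j)).mul hφ.continuous) hφc.mul_left
    exact this.congr (.of_forall fun x => by simp only; ring)
  have i3 : Integrable (fun x => h x * (ζ x * φ x)) :=
    integrable_mul_of_continuous (Lp.memLp h) (hζ.continuous.mul hφ.continuous) hφc.mul_left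
  have e : ∀ j, ∫ x, p x j * (pd j (fun x => ζ x * φ x) x + Complex.I * (A x j : ℂ) * (ζ x * φ x))
      = (∫ x, (ζ x * p x j) * pd j φ x)
        + ∫ x, ((Complex.I * ((A x j : ℂ) * ζ x) + pd j ζ x) * p x j) * φ x := by
    intro j
    rw [← integral_add (i1 j) (i2 j)]
    refine integral_congr_ae (.of_forall fun x => ?_)
    simp only
    rw [pd_mul (hζ.differentiable (by simp) x) (hφ.differentiable (by simp) x)]
    ring
  simp only [e] at hw
  rw [Finset.sum_add_distrib, ← integral_finsetSum _ (fun j _ => i2 j)] at hw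
  have r : ∫ x, ((∑ j, (Complex.I * ((A x j : ℂ) * ζ x) + pd j ζ x) * p x j) - ζ x * h x) * φ x
      = (∫ x, ∑ j, ((Complex.I * ((A x j : ℂ) * ζ x) + pd j ζ x) * p x j) * φ x)
        - ∫ x, h x * (ζ x * φ x) := by
    rw [← integral_sub (integrable_finsetSum _ fun j _ => i2 j) i3]
    refine integral_congr_ae (.of_forall fun x => ?_)
    simp only
    rw [sub_mul, Finset.sum_mul]
    ring
  rw [r]
  linear_combination hw

lemma memLp_continuous_mul {c f : Space n → ℂ} (hc : Continuous c) (hcc : HasCompactSupport c)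
    (hf : MemLp f 2 volume) : MemLp (fun x => c x * f x) 2 volume :=
  hf.mul' (hc.memLp_of_hasCompactSupport hcc : MemLp c ⊤ volume)

lemma covD_covD (hA : ContDiffOn ℝ 1 A {0}ᶜ) {v : Space n → ℂ} (hv : ContDiff ℝ ∞ v) (j : Fin n)
    {x : Space n} (hx : x ≠ 0) :
    covD A j (covD A j v) x = pd j (pd j v) x - 2 * Complex.I * (A x j : ℂ) * pd j v x
      - (Complex.I * pd j (fun y => (A y j : ℂ)) x + (A x j : ℂ) ^ 2) * v x := by
  have hAx : DifferentiableAt ℝ (fun y => (A y j : ℂ)) x :=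
    ((contDiffOn_component hA j).contDiffAt (isOpen_compl_singleton.mem_nhds hx)).differentiableAt
      one_ne_zero
  have hvx : DifferentiableAt ℝ v x := hv.differentiable (by simp) x
  have hpv : DifferentiableAt ℝ (pd j v) x :=
    (contDiff_pd (k := 1) hv (by norm_cast) j).differentiable one_ne_zero x
  have e : covD A j v = fun y => pd j v y - Complex.I * ((A y j : ℂ) * v y) := by
    ext y
    simp only [covD]
    ring
  have hAv : DifferentiableAt ℝ (fun y => (A y j : ℂ) * v y) x := hAx.mul hvx
  rw [covD, e, pd_sub hpv (hAv.const_mul _), pd_const_mul _ hAv, pd_mul hAx hvx]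
  ring_nf
  rw [Complex.I_sq]
  ring

/-- Coefficients singular at the origin are bounded on a compact set that avoids it, so they may
multiply a convergent sequence there. -/
lemma TendstoLp.continuousOn_mul {K : Set (Space n)} (hK : IsCompact K) {p : ENNReal}
    {c : Space n → ℂ} (hc : ContinuousOn c K) {F : ℕ → Space n → ℂ} {f : Space n → ℂ}
    (hF : TendstoLp p (volume.restrict K) F f) :
    TendstoLp p (volume.restrict K) (fun m x => c x * F m x) (fun x => c x * f x) := by
  obtain ⟨C, hC⟩ := hK.exists_bound_of_continuousOn hc
  exact hF.bdd_mul (hc.aestronglyMeasurable hK.measurableSet)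
    ((ae_restrict_iff' hK.measurableSet).2 (.of_forall hC))

/-- The approximants are mollifications of `a = ζ w`, with `ζ = 1` near `K`. Both the gradient `g`
of `a` and its Laplacian `l` are in `L²`, and mollification commutes with these constant coefficient
operators. The coefficients involving `A` multiply after mollification, where they are bounded on
`K`, so no commutator estimate is needed. -/
lemma exists_smooth_approx (hA : ContDiffOn ℝ 1 A {0}ᶜ) {w h : L2 n} {p : L2Vec n}
    (hp : IsCovariantGradient A w p) (hh : IsFormSolution A p h) {K : Set (Space n)}
    (hK : IsCompact K) (hK0 : K ⊆ {0}ᶜ) :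
    ∃ v : ℕ → Space n → ℂ, (∀ m, ContDiff ℝ ∞ (v m)) ∧ (∀ m, HasCompactSupport (v m)) ∧
      TendstoLp 2 (volume.restrict K) v w ∧
      (∀ j, TendstoLp 2 (volume.restrict K) (fun m => covD A j (v m)) (fun x => p x j)) ∧
      TendstoLp 2 (volume.restrict K) (fun m => magLap A (v m)) h := by
  obtain ⟨ζ, hζ, hζc, hζ0, hζ1⟩ := exists_cutoff hK isOpen_compl_singleton hK0
  -- The second cutoff equals one on the support of `ζ`, so `A ζ w = (A η) a` with `A η` globally
  -- `C¹` and compactly supported; the weak product rule then applies to it.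
  obtain ⟨η, hη, hηc, hη0, hη1⟩ := exists_cutoff hζc.isCompact isOpen_compl_singleton hζ0
  have cA := fun j => contDiffOn_component hA j
  have hζ1' : ContDiff ℝ 1 ζ := hζ.of_le (by simp)
  have hAζ : ∀ j, ContDiff ℝ 1 (fun x => (A x j : ℂ) * ζ x) := fun j =>
    contDiff_mul_of_tsupport isOpen_compl_singleton (cA j) hζ1' hζ0
  have hAη : ∀ j, ContDiff ℝ 1 (fun x => (A x j : ℂ) * η x) := fun j =>
    contDiff_mul_of_tsupport isOpen_compl_singleton (cA j) (hη.of_le (by simp)) hη0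
  have mw := Lp.memLp w
  have mp := memLp_component p
  have mh := Lp.memLp h
  set a : Space n → ℂ := fun x => ζ x * w x with ha
  have hac : HasCompactSupport a := hζc.mul_right
  have ma : MemLp a 2 volume := memLp_continuous_mul hζ.continuous hζc mw
  set g : Fin n → Space n → ℂ := fun j x =>
    ζ x * p x j + Complex.I * ((A x j : ℂ) * ζ x) * w x + pd j ζ x * w x with hg
  have cpd := fun j => continuous_pd hζ1' j
  have mb : ∀ j, MemLp (fun x => ζ x * p x j) 2 volume := fun j =>
    memLp_continuous_mul hζ.continuous hζc (mp j)
  have mAw : ∀ j, MemLp (fun x => Complex.I * ((A x j : ℂ) * ζ x) * w x) 2 volume := fun j =>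
    memLp_continuous_mul (continuous_const.mul (hAζ j).continuous)
      (hζc.mul_left.mul_left) mw
  have mdw : ∀ j, MemLp (fun x => pd j ζ x * w x) 2 volume := fun j =>
    memLp_continuous_mul (cpd j) (HasCompactSupport.pd hζc j) mw
  have mg : ∀ j, MemLp (g j) 2 volume := fun j => ((mb j).add (mAw j)).add (mdw j)
  have hgc : ∀ j, HasCompactSupport (g j) := fun j =>
    (hζc.mul_right.add hζc.mul_left.mul_left.mul_right).add
      (HasCompactSupport.pd hζc j).mul_right
  have wg : ∀ j, IsWeakPartial j a (g j) := fun j =>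
    isWeakPartial_cutoff_mul hA hp hζ hζc hζ0 j
  -- the weak partial derivatives of the three parts of `g`
  set r : Fin n → Space n → ℂ := fun j x => pd j ζ x * p x j
    + Complex.I * ((A x j : ℂ) * pd j ζ x) * w x + pd j (pd j ζ) x * w x with hr
  have spd : ∀ j, ContDiff ℝ ∞ (pd j ζ) := fun j => contDiff_pd hζ (by simp) j
  have wr : ∀ j, IsWeakPartial j (fun x => pd j ζ x * w x) (r j) := fun j =>
    isWeakPartial_cutoff_mul hA hp (spd j) (HasCompactSupport.pd hζc j)
      ((tsupport_pd_subset j).trans hζ0) j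
  have hApd : ∀ j, ContDiff ℝ 1 (fun x => (A x j : ℂ) * pd j ζ x) := fun j =>
    contDiff_mul_of_tsupport isOpen_compl_singleton (cA j) ((spd j).of_le (by simp))
      ((tsupport_pd_subset j).trans hζ0)
  have hpdc := fun j => HasCompactSupport.pd hζc j
  have mr : ∀ j, MemLp (r j) 2 volume := fun j =>
    ((memLp_continuous_mul (cpd j) (hpdc j) (mp j)).add
      (memLp_continuous_mul (continuous_const.mul (hApd j).continuous)
        (hpdc j).mul_left.mul_left mw)).add
      (memLp_continuous_mul (continuous_pd ((spd j).of_le (by simp)) j)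
        (HasCompactSupport.pd (hpdc j) j) mw)
  set s : Fin n → Space n → ℂ := fun j x =>
    pd j (fun y => (A y j : ℂ) * η y) x * a x + (A x j : ℂ) * η x * g j x with hs
  have ws : ∀ j, IsWeakPartial j (fun x => (A x j : ℂ) * η x * a x) (s j) := fun j =>
    (wg j).mul_contDiff ma (mg j) hac (hgc j) (hAη j)
  have hAηc : ∀ j, HasCompactSupport (fun x => (A x j : ℂ) * η x) := fun j => hηc.mul_left
  have ms : ∀ j, MemLp (s j) 2 volume := fun j =>
    (memLp_continuous_mul (continuous_pd (hAη j) j) (HasCompactSupport.pd (hAηc j) j) ma).add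
      (memLp_continuous_mul (hAη j).continuous (hAηc j) (mg j))
  set b : Space n → ℂ := fun x =>
    (∑ j, (Complex.I * ((A x j : ℂ) * ζ x) + pd j ζ x) * p x j) - ζ x * h x with hb
  have mbb : MemLp b 2 volume :=
    (memLp_finsetSum _ fun j _ => memLp_continuous_mul
      ((continuous_const.mul (hAζ j).continuous).add (cpd j))
      (hζc.mul_left.mul_left.add (hpdc j)) (mp j)).sub
      (memLp_continuous_mul hζ.continuous hζc mh)
  set l : Space n → ℂ := fun x => b x + ∑ j, (r j x + Complex.I * s j x) with hl
  have ml : MemLp l 2 volume :=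
    mbb.add (memLp_finsetSum _ fun j _ => (mr j).add ((ms j).const_mul _))
  have hlc : HasCompactSupport l := by
    have h0 : ∀ x, x ∉ tsupport ζ → l x = 0 := by
      intro x hx
      have z : ζ x = 0 := image_eq_zero_of_notMem_tsupport hx
      have zd : ∀ j, pd j ζ x = 0 := fun j =>
        image_eq_zero_of_notMem_tsupport fun hx' => hx (tsupport_pd_subset j hx')
      have zdd : ∀ j, pd j (pd j ζ) x = 0 := fun j =>
        image_eq_zero_of_notMem_tsupport fun hx' =>
          hx (tsupport_pd_subset j (tsupport_pd_subset j hx'))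
      simp [hl, hb, hr, hs, hg, ha, z, zd, zdd]
    exact HasCompactSupport.intro hζc.isCompact h0
  have hηζ : ∀ x, η x * ζ x = ζ x := by
    intro x
    by_cases hx : x ∈ tsupport ζ
    · rw [hη1.self_of_nhdsSet x hx, one_mul]
    · rw [image_eq_zero_of_notMem_tsupport hx, mul_zero]
  have wl : ∀ φ : Space n → ℂ, ContDiff ℝ ∞ φ → HasCompactSupport φ →
      ∑ j, ∫ x, g j x * pd j φ x = - ∫ x, l x * φ x := by
    intro φ hφ hφc
    have hφ1 : ContDiff ℝ 1 φ := hφ.of_le (by simp)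
    have I1 : ∀ {f : Space n → ℂ} (j : Fin n), MemLp f 2 volume →
        Integrable (fun x => f x * pd j φ x) := fun j hf =>
      integrable_mul_of_continuous hf (continuous_pd hφ1 j) (HasCompactSupport.pd hφc j)
    have I2 : ∀ {f : Space n → ℂ}, MemLp f 2 volume → Integrable (fun x => f x * φ x) :=
      fun hf => integrable_mul_of_continuous hf hφ.continuous hφc
    have mAa : ∀ j, MemLp (fun x => Complex.I * ((A x j : ℂ) * η x * a x)) 2 volume := fun j =>
      (memLp_continuous_mul (hAη j).continuous (hAηc j) ma).const_mul _
    have e1 : ∀ j, ∫ x, g j x * pd j φ x = (∫ x, (ζ x * p x j) * pd j φ x)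
        + (- (∫ x, r j x * φ x) + - (∫ x, Complex.I * s j x * φ x)) := by
      intro j
      have h2 := wr j φ hφ hφc
      have h3 := ws j φ hφ hφc
      have h4 : ∫ x, Complex.I * ((A x j : ℂ) * η x * a x) * pd j φ x
          = - ∫ x, Complex.I * s j x * φ x := by
        simp_rw [mul_assoc Complex.I]
        rw [integral_const_mul, integral_const_mul, h3]
        ring
      rw [← h2, ← h4, ← integral_add_add (I1 j (mb j)) (I1 j (mdw j)) (I1 j (mAa j))]
      refine integral_congr_ae (.of_forall fun x => ?_)
      simp only [hg, ha]
      linear_combination (-Complex.I * (A x j : ℂ) * w x * pd j φ x) * hηζ x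
    simp_rw [e1]
    rw [Finset.sum_add_distrib, weakDiv_cutoff_mul hA hh hζ hζc hζ0 hφ hφc]
    have e2 : ∫ x, l x * φ x = (∫ x, b x * φ x)
        + ∑ j, ((∫ x, r j x * φ x) + ∫ x, Complex.I * s j x * φ x) := by
      have I3 : ∀ j, Integrable (fun x => r j x * φ x + Complex.I * s j x * φ x) := fun j =>
        (I2 (mr j)).add (I2 ((ms j).const_mul Complex.I))
      simp_rw [fun j => (integral_add (I2 (mr j)) (I2 ((ms j).const_mul Complex.I))).symm]
      rw [← integral_finsetSum _ fun j _ => I3 j,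
        ← integral_add (I2 mbb) (integrable_finsetSum _ fun j _ => I3 j)]
      refine integral_congr_ae (.of_forall fun x => ?_)
      simp only [hl, add_mul, Finset.sum_mul]
    rw [e2, neg_add, ← Finset.sum_neg_distrib]
    simp only [neg_add, hb]
  -- convergence
  have K0 : ∀ {x}, x ∈ K → x ≠ 0 := fun hx => hK0 hx
  have mulc : ∀ (c : Space n → ℂ), ContinuousOn c {0}ᶜ → ∀ {F : ℕ → Space n → ℂ}
      {f : Space n → ℂ}, TendstoLp 2 (volume.restrict K) F f →
      TendstoLp 2 (volume.restrict K) (fun m x => c x * F m x) (fun x => c x * f x) :=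
    fun c hc _ _ hF => hF.continuousOn_mul hK (hc.mono hK0)
  have ta : TendstoLp 2 (volume.restrict K) (fun m => mollify m a) a :=
    (tendstoLp_mollify ma hac).mono_measure Measure.restrict_le_self
  have tg : ∀ j, TendstoLp 2 (volume.restrict K) (fun m => mollify m (g j)) (g j) := fun j =>
    (tendstoLp_mollify (mg j) (hgc j)).mono_measure Measure.restrict_le_self
  have tl : TendstoLp 2 (volume.restrict K) (fun m => mollify m l) l :=
    (tendstoLp_mollify ml hlc).mono_measure Measure.restrict_le_self
  have z1 : ∀ x ∈ K, ζ x = 1 := hζ1.self_of_nhdsSet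
  have ze : ∀ x ∈ K, ζ =ᶠ[𝓝 x] fun _ => 1 := fun x hx => (eventually_nhdsSet_iff_forall.1 hζ1) x hx
  have zd : ∀ x ∈ K, ∀ j, pd j ζ =ᶠ[𝓝 x] fun _ => 0 := by
    intro x hx j
    refine ((ze x hx).fderiv (𝕜 := ℝ)).mono fun y hy => ?_
    simp only [pd, hy]
    simp
  have zdd : ∀ x ∈ K, ∀ j, pd j (pd j ζ) x = 0 := by
    intro x hx j
    have := (zd x hx j).fderiv_eq (𝕜 := ℝ)
    simp only [pd] at this ⊢
    rw [this]
    simp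
  -- Near `K` both cutoffs are constant, so all their derivatives drop out when the limits are
  -- identified.
  have ξ1 : ∀ x ∈ K, η =ᶠ[𝓝 x] fun _ => 1 := by
    intro x hx
    have : x ∈ tsupport ζ := subset_tsupport ζ (by simp [z1 x hx])
    exact (eventually_nhdsSet_iff_forall.1 hη1) x this
  have ξd : ∀ x ∈ K, ∀ j, pd j (fun y => (A y j : ℂ) * η y) x = pd j (fun y => (A y j : ℂ)) x := by
    intro x hx j
    have : (fun y => (A y j : ℂ) * η y) =ᶠ[𝓝 x] fun y => (A y j : ℂ) := by
      filter_upwards [ξ1 x hx] with y hy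
      rw [hy, mul_one]
    simp only [pd]
    rw [this.fderiv_eq]
  have la := locallyIntegrable_of_memLp_two ma
  have smol : ∀ m, ContDiff ℝ ∞ (mollify m a) := fun m => contDiff_mollify la m
  refine ⟨fun m => mollify m a, smol, fun m => hasCompactSupport_mollify hac m, ?_, ?_, ?_⟩
  · refine ta.congr_lim ((ae_restrict_iff' hK.measurableSet).2 (.of_forall fun x hx => ?_))
    simp [ha, z1 x hx]
  · intro j
    refine ((tg j).sub (by norm_num) (mulc (fun x => Complex.I * (A x j : ℂ))
      (continuousOn_const.mul (cA j).continuousOn) ta)).congr (fun m => ?_) ?_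
    · refine .of_forall fun x => ?_
      simp only [covD]
      rw [pd_mollify la (wg j)]
    · refine (ae_restrict_iff' hK.measurableSet).2 (.of_forall fun x hx => ?_)
      simp only [hg, ha, z1 x hx, (zd x hx j).self_of_nhds]
      ring
  · have cpA : ∀ j, ContinuousOn (fun x => pd j (fun y => (A y j : ℂ)) x) {0}ᶜ := fun j =>
      ((cA j).continuousOn_fderiv_of_isOpen isOpen_compl_singleton le_rfl).clm_apply
        continuousOn_const
    have t1 := fun j => mulc (fun x => 2 * Complex.I * (A x j : ℂ))
      (continuousOn_const.mul (cA j).continuousOn) (tg j)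
    have t2 := fun j => mulc (fun x => Complex.I * pd j (fun y => (A y j : ℂ)) x + (A x j : ℂ) ^ 2)
      ((continuousOn_const.mul (cpA j)).add ((cA j).continuousOn.pow 2)) ta
    have t := (TendstoLp.sum Finset.univ (by norm_num)
      fun j _ => (t1 j).add (by norm_num) (t2 j)).sub (by norm_num) tl
    refine t.congr (fun m => ?_) ?_
    · refine (ae_restrict_iff' hK.measurableSet).2 (.of_forall fun x hx => ?_)
      simp only [magLap, covD_covD hA (smol m) _ (K0 hx)]
      simp_rw [pd_mollify la (wg _)]
      -- The separate second derivatives need not be controlled: only their sum occurs, and it is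
      -- the mollification of `l`.
      rw [← sum_pd_mollify (fun j => locallyIntegrable_of_memLp_two (mg j)) wl,
        ← Finset.sum_neg_distrib, ← Finset.sum_sub_distrib]
      refine Finset.sum_congr rfl fun j _ => ?_
      ring
    · refine (ae_restrict_iff' hK.measurableSet).2 (.of_forall fun x hx => ?_)
      simp only [hl, hb, hr, hs, hg, ha, z1 x hx, (zd x hx _).self_of_nhds, zdd x hx,
        (ξ1 x hx).self_of_nhds, ξd x hx]
      have : ∀ u v w' : ℂ, u - (v - 1 * h x + w') = h x + (u - v - w') := fun u v w' => by ring
      rw [this, ← Finset.sum_sub_distrib, ← Finset.sum_sub_distrib, Finset.sum_eq_zero, add_zero]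
      intro j _
      ring_nf
      rw [Complex.I_sq]
      ring

end Approximation

/-! ### The virial identity for smooth functions. -/

section VirialIdentity

variable {n : ℕ} {A : Space n → Space n} {V : Space n → ℝ}

/-- The divergence of the vector field with components `X k`. -/
noncomputable def fieldDiv (X : Fin n → Space n → ℝ) (x : Space n) : ℝ := ∑ k, pd k (X k) x

/-- The density of `X · q + ½ (div X) v`. -/
noncomputable def symOp (X : Fin n → Space n → ℝ) (q : Fin n → Space n → ℂ) (v : Space n → ℂ)
    (x : Space n) : ℂ :=
  ∑ k, (X k x : ℂ) * q k x + 1 / 2 * (fieldDiv X x : ℂ) * v x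

/-- The density of `2 Re ⟪G v, h + V v⟫` where `G v = X · q + ½ (div X) v`. -/
noncomputable def pairingDensity (V : Space n → ℝ) (X : Fin n → Space n → ℝ)
    (q : Fin n → Space n → ℂ) (v h : Space n → ℂ) (x : Space n) : ℂ :=
  (starRingEnd ℂ) (symOp X q v x) * (h x + (V x : ℂ) * v x)
    + symOp X q v x * (starRingEnd ℂ) (h x + (V x : ℂ) * v x)

/-- The density of the virial identity for the field `X`. -/
noncomputable def virialDensity (A : Space n → Space n) (V : Space n → ℝ)
    (X : Fin n → Space n → ℝ) (q : Fin n → Space n → ℂ) (v : Space n → ℂ) (x : Space n) : ℂ :=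
  (∑ j, ∑ k, ((pd j (X k) x : ℝ) : ℂ) * ((starRingEnd ℂ) (q k x) * q j x
      + q k x * (starRingEnd ℂ) (q j x)))
    + 1 / 2 * (∑ j, ((pd j (fieldDiv X) x : ℝ) : ℂ) * ((starRingEnd ℂ) (v x) * q j x
      + v x * (starRingEnd ℂ) (q j x)))
    - (∑ j, (X j x : ℂ) * ((pd j V x : ℝ) : ℂ)) * (v x * (starRingEnd ℂ) (v x))
    + ∑ j, ∑ k, (X k x : ℂ) * (magneticField A x k j : ℂ) * (Complex.I *
      ((starRingEnd ℂ) (v x) * q j x - v x * (starRingEnd ℂ) (q j x)))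

/-- The pointwise content of the virial identity, with conjugates treated as independent variables
(primes) and `a j k` standing for `∂_j q_k`. The right side is the expanded divergence of the flux
`-2 Re(conj G q_j) + X_j (|q|² + V |v|²)`. -/
lemma virial_algebra (X A dD dV q q' : Fin n → ℂ) (dX a a' B : Fin n → Fin n → ℂ)
    (D G G' H H' v v' V : ℂ) (dG dG' dv dv' : Fin n → ℂ)
    (hD : D = ∑ k, dX k k)
    (hG : G = ∑ k, X k * q k + 1 / 2 * D * v) (hG' : G' = ∑ k, X k * q' k + 1 / 2 * D * v')
    (hdv : ∀ j, dv j = q j + Complex.I * A j * v)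
    (hdv' : ∀ j, dv' j = q' j - Complex.I * A j * v')
    (hdG : ∀ j, dG j = ∑ k, (dX j k * q k + X k * a j k)
      + 1 / 2 * (dD j * v + D * dv j))
    (hdG' : ∀ j, dG' j = ∑ k, (dX j k * q' k + X k * a' j k)
      + 1 / 2 * (dD j * v' + D * dv' j))
    (hH : H = - ∑ j, (a j j - Complex.I * A j * q j))
    (hH' : H' = - ∑ j, (a' j j + Complex.I * A j * q' j))
    (hc : ∀ j k, a j k = a k j + Complex.I * A j * q k - Complex.I * A k * q j
      - Complex.I * B k j * v)
    (hc' : ∀ j k, a' j k = a' k j - Complex.I * A j * q' k + Complex.I * A k * q' j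
      + Complex.I * B k j * v') :
    G' * (H + V * v) + G * (H' + V * v') - ((∑ j, ∑ k, dX j k * (q' k * q j + q k * q' j))
      + 1 / 2 * (∑ j, dD j * (v' * q j + v * q' j)) - (∑ j, X j * dV j) * (v * v')
      + ∑ j, ∑ k, X k * B k j * (Complex.I * (v' * q j - v * q' j)))
    = ∑ j, (-(dG' j * q j + G' * a j j + (dG j * q' j + G * a' j j))
      + (dX j j * (∑ i, q i * q' i) + X j * ∑ i, (a j i * q' i + q i * a' j i))
      + (dX j j * (V * (v * v')) + X j * (dV j * (v * v') + V * (dv j * v' + v * dv' j)))) := by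
  have e1 : ∑ j, (dG' j * q j + dG j * q' j) = (∑ j, ∑ k, dX j k * (q' k * q j + q k * q' j))
      + (∑ j, ∑ k, X k * (a' j k * q j + a j k * q' j))
      + 1 / 2 * (∑ j, dD j * (v' * q j + v * q' j)) + D * (∑ i, q i * q' i)
      - 1 / 2 * D * ∑ j, Complex.I * A j * (v' * q j - v * q' j) := by
    simp only [Finset.mul_sum, ← Finset.sum_add_distrib, ← Finset.sum_sub_distrib]
    refine Finset.sum_congr rfl fun j _ => ?_
    rw [hdG, hdG', hdv, hdv', add_mul, add_mul, Finset.sum_mul, Finset.sum_mul]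
    have : ∑ k, (dX j k * (q' k * q j + q k * q' j) + X k * (a' j k * q j + a j k * q' j))
      = ∑ k, (dX j k * q' k + X k * a' j k) * q j + ∑ k, (dX j k * q k + X k * a j k) * q' j := by
      rw [← Finset.sum_add_distrib]
      exact Finset.sum_congr rfl fun k _ => by ring
    linear_combination -this
  -- Replacing `∂_j q_k` by `∂_k q_j` is the one place where the magnetic field arises. The
  -- remaining terms with `A` itself match those of `e3`.
  have e2 : ∑ j, ∑ k, X k * (a' j k * q j + a j k * q' j)
      = (∑ j, X j * ∑ i, (a j i * q' i + q i * a' j i))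
        + (∑ j, ∑ k, X k * B k j * (Complex.I * (v' * q j - v * q' j)))
        - ∑ j, ∑ k, X k * (Complex.I * A j * (q' k * q j - q k * q' j)) := by
    have : ∑ j, X j * ∑ i, (a j i * q' i + q i * a' j i)
        = ∑ j, ∑ k, X k * (a k j * q' j + q j * a' k j) := by
      rw [Finset.sum_comm]
      simp only [Finset.mul_sum]
    rw [this]
    simp only [← Finset.sum_add_distrib, ← Finset.sum_sub_distrib]
    refine Finset.sum_congr rfl fun j _ => Finset.sum_congr rfl fun k _ => ?_
    rw [hc j k, hc' j k]
    ring
  have e3 : G' * H + G * H' = -(∑ j, (G' * a j j + G * a' j j))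
      + (∑ j, ∑ k, X k * (Complex.I * A j * (q' k * q j - q k * q' j)))
      + 1 / 2 * D * ∑ j, Complex.I * A j * (v' * q j - v * q' j) := by
    rw [hH, hH']
    simp only [mul_neg, Finset.mul_sum, ← Finset.sum_add_distrib, ← Finset.sum_neg_distrib]
    refine Finset.sum_congr rfl fun j _ => ?_
    have : ∑ k, X k * (Complex.I * A j * (q' k * q j - q k * q' j))
        = Complex.I * A j * ((∑ k, X k * q' k) * q j - (∑ k, X k * q k) * q' j) := by
      rw [Finset.sum_mul, Finset.sum_mul, ← Finset.sum_sub_distrib, Finset.mul_sum]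
      exact Finset.sum_congr rfl fun k _ => by ring
    rw [this, hG, hG']
    ring
  have e4 : G' * (V * v) + G * (V * v') + (∑ j, X j * dV j) * (v * v')
      = ∑ j, (dX j j * (V * (v * v')) + X j * (dV j * (v * v') + V * (dv j * v' + v * dv' j))) := by
    have : ∑ j, (dX j j * (V * (v * v')) + X j * (dV j * (v * v') + V * (dv j * v' + v * dv' j)))
        = (∑ j, dX j j) * (V * (v * v')) + (∑ j, X j * dV j) * (v * v')
          + V * v' * (∑ j, X j * q j) + V * v * ∑ j, X j * q' j := by
      rw [Finset.sum_mul, Finset.sum_mul, Finset.mul_sum, Finset.mul_sum]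
      simp only [← Finset.sum_add_distrib]
      refine Finset.sum_congr rfl fun j _ => ?_
      rw [hdv, hdv']
      ring
    rw [this, ← hD, hG, hG']
    ring
  have e5 : ∑ j, (-(dG' j * q j + G' * a j j + (dG j * q' j + G * a' j j))
      + (dX j j * (∑ i, q i * q' i) + X j * ∑ i, (a j i * q' i + q i * a' j i))
      + (dX j j * (V * (v * v')) + X j * (dV j * (v * v') + V * (dv j * v' + v * dv' j))))
      = -(∑ j, (dG' j * q j + dG j * q' j)) - (∑ j, (G' * a j j + G * a' j j))
        + D * (∑ i, q i * q' i) + (∑ j, X j * ∑ i, (a j i * q' i + q i * a' j i))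
        + ∑ j, (dX j j * (V * (v * v')) + X j * (dV j * (v * v')
          + V * (dv j * v' + v * dv' j))) := by
    rw [hD, Finset.sum_mul, ← Finset.sum_neg_distrib]
    simp only [← Finset.sum_add_distrib, ← Finset.sum_sub_distrib]
    refine Finset.sum_congr rfl fun j _ => ?_
    ring
  rw [e5, e1, e2, ← e4]
  linear_combination e3

lemma pd_comm {v : Space n → ℂ} (hv : ContDiff ℝ 2 v) (j k : Fin n) (x : Space n) :
    pd j (pd k v) x = pd k (pd j v) x := by
  have hd : DifferentiableAt ℝ (fderiv ℝ v) x :=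
    ((hv.fderiv_right (m := 1) (by norm_num)).differentiable one_ne_zero) x
  have key : ∀ i l : Fin n, pd i (pd l v) x
      = fderiv ℝ (fderiv ℝ v) x (basisVec i) (basisVec l) := by
    intro i l
    have : fderiv ℝ (fun y => fderiv ℝ v y (basisVec l)) x
        = (fderiv ℝ (fderiv ℝ v) x).flip (basisVec l) := by
      rw [fderiv_clm_apply hd (differentiableAt_const _)]
      simp
    simp only [pd] at this ⊢
    rw [show (pd l v) = fun y => fderiv ℝ v y (basisVec l) from rfl, this]
    rfl
  rw [key, key]
  exact (hv.contDiffAt.isSymmSndFDerivAt (by simp)) _ _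

lemma pd_component {x : Space n} (hA : DifferentiableAt ℝ A x) (j k : Fin n) :
    pd j (fun y => (A y k : ℂ)) x = ((fderiv ℝ A x (basisVec j) k : ℝ) : ℂ) := by
  have h := ((EuclideanSpace.proj k : Space n →L[ℝ] ℝ).hasFDerivAt.comp x hA.hasFDerivAt)
  have h2 : pd j (fun y => A y k) x = fderiv ℝ A x (basisVec j) k := by
    have := h.fderiv
    simp only [Function.comp_def] at this
    simp only [pd]
    erw [this]
    rfl
  rw [pd_ofReal (f := fun y => A y k) h.differentiableAt, h2]

/-- The commutator `D_j D_k - D_k D_j = -i B_kj`, from the symmetry of second derivatives; only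
first derivatives of `A` enter. -/
lemma pd_covD_comm {v : Space n → ℂ} (hv : ContDiff ℝ 2 v) {x : Space n}
    (hA : DifferentiableAt ℝ A x) (j k : Fin n) :
    pd j (covD A k v) x = pd k (covD A j v) x + Complex.I * (A x j : ℂ) * covD A k v x
      - Complex.I * (A x k : ℂ) * covD A j v x
      - Complex.I * (magneticField A x k j : ℂ) * v x := by
  have hAc : ∀ i, DifferentiableAt ℝ (fun y => (A y i : ℂ)) x := fun i =>
    Complex.ofRealCLM.differentiableAt.comp x
      ((EuclideanSpace.proj i : Space n →L[ℝ] ℝ).differentiableAt.comp x hA)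
  have hvx : DifferentiableAt ℝ v x := hv.differentiable (by simp) x
  have key : ∀ i l : Fin n, pd i (covD A l v) x = pd i (pd l v) x
      - Complex.I * (((fderiv ℝ A x (basisVec i) l : ℝ) : ℂ) * v x + (A x l : ℂ) * pd i v x) := by
    intro i l
    have hAv : DifferentiableAt ℝ (fun y => (A y l : ℂ) * v y) x := (hAc l).mul hvx
    have hpv : DifferentiableAt ℝ (pd l v) x :=
      (contDiff_pd (k := 1) hv (by norm_num) l).differentiable one_ne_zero x
    have e : covD A l v = fun y => pd l v y - Complex.I * ((A y l : ℂ) * v y) := by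
      ext y
      simp only [covD]
      ring
    rw [e, pd_sub hpv (hAv.const_mul _), pd_const_mul _ hAv, pd_mul (hAc l) hvx, pd_component hA]
  rw [key, key, pd_comm hv j k]
  simp only [covD, magneticField, Matrix.of_apply]
  push_cast
  ring

lemma contDiffOn_covD {v : Space n → ℂ} (hA : ContDiffOn ℝ 1 A {0}ᶜ) (hv : ContDiff ℝ 2 v)
    (k : Fin n) : ContDiffOn ℝ 1 (covD A k v) {0}ᶜ :=
  (contDiff_pd hv (by norm_num) k).contDiffOn.sub
    ((contDiffOn_const.mul (contDiffOn_component hA k)).mul (hv.of_le (by norm_num)).contDiffOn)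

lemma contDiff_fieldDiv {X : Fin n → Space n → ℝ} {k l : WithTop ℕ∞}
    (hX : ∀ i, ContDiff ℝ l (X i)) (hkl : k + 1 ≤ l) :
    ContDiff ℝ k (fieldDiv X) :=
  ContDiff.sum fun i _ => contDiff_pd (hX i) hkl i

lemma fieldDiv_eq_zero {X : Fin n → Space n → ℝ} {K : Set (Space n)}
    (hXK : ∀ k, tsupport (X k) ⊆ K) {x : Space n} (hx : x ∉ K) : fieldDiv X x = 0 :=
  Finset.sum_eq_zero fun k _ => image_eq_zero_of_notMem_tsupport
    fun h => hx (hXK k (tsupport_pd_subset k h))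

lemma tsupport_fieldDiv_subset {X : Fin n → Space n → ℝ} {K : Set (Space n)} (hK : IsClosed K)
    (hXK : ∀ k, tsupport (X k) ⊆ K) : tsupport (fieldDiv X) ⊆ K :=
  closure_minimal (fun _ hx => by_contra fun h => hx (fieldDiv_eq_zero hXK h)) hK

lemma symOp_eq_zero {X : Fin n → Space n → ℝ} {K : Set (Space n)}
    (hXK : ∀ k, tsupport (X k) ⊆ K) {q : Fin n → Space n → ℂ} {v : Space n → ℂ} {x : Space n}
    (hx : x ∉ K) : symOp X q v x = 0 := by
  have h : ∀ k, X k x = 0 := fun k =>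
    image_eq_zero_of_notMem_tsupport fun h => hx (hXK k h)
  simp [symOp, h, fieldDiv_eq_zero hXK hx]

lemma virialDensity_eq_zero {X : Fin n → Space n → ℝ} {K : Set (Space n)} (hK : IsClosed K)
    (hXK : ∀ k, tsupport (X k) ⊆ K) {q : Fin n → Space n → ℂ} {v : Space n → ℂ} {x : Space n}
    (hx : x ∉ K) : virialDensity A V X q v x = 0 := by
  have h : ∀ k, X k x = 0 := fun k =>
    image_eq_zero_of_notMem_tsupport fun h => hx (hXK k h)
  have h2 : ∀ j k, pd j (X k) x = 0 := fun j k =>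
    image_eq_zero_of_notMem_tsupport fun h => hx (hXK k (tsupport_pd_subset j h))
  have h3 : ∀ j, pd j (fieldDiv X) x = 0 := fun j =>
    image_eq_zero_of_notMem_tsupport fun h =>
      hx (tsupport_fieldDiv_subset hK hXK (tsupport_pd_subset j h))
  simp [virialDensity, h, h2, h3]

lemma differentiableAt_conj {f : Space n → ℂ} {x : Space n} (hf : DifferentiableAt ℝ f x) :
    DifferentiableAt ℝ (fun y => (starRingEnd ℂ) (f y)) x :=
  Complex.conjCLE.differentiableAt.comp x hf

lemma contDiffOn_conj {f : Space n → ℂ} {k : WithTop ℕ∞} {s : Set (Space n)}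
    (hf : ContDiffOn ℝ k f s) : ContDiffOn ℝ k (fun y => (starRingEnd ℂ) (f y)) s :=
  Complex.conjCLE.contDiff.comp_contDiffOn hf

/-- The integrand is the divergence of a compactly supported `C¹` field, hence integrates to zero.
-/
lemma integral_virialDensity_of_contDiff (hA : ContDiffOn ℝ 1 A {0}ᶜ) (hV : ContDiffOn ℝ 1 V {0}ᶜ)
    {X : Fin n → Space n → ℝ} (hX : ∀ k, ContDiff ℝ 2 (X k)) {K : Set (Space n)}
    (hK : IsCompact K) (hK0 : K ⊆ {0}ᶜ) (hXK : ∀ k, tsupport (X k) ⊆ K)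
    {v : Space n → ℂ} (hv : ContDiff ℝ 2 v) :
    ∫ x, (pairingDensity V X (fun k => covD A k v) v (magLap A v) x
      - virialDensity A V X (fun k => covD A k v) v x) = 0 := by
  set q : Fin n → Space n → ℂ := fun k => covD A k v with hq
  set G : Space n → ℂ := symOp X q v with hG
  have U : IsOpen ({0}ᶜ : Set (Space n)) := isOpen_compl_singleton
  have hqC : ∀ k, ContDiffOn ℝ 1 (q k) {0}ᶜ := fun k => contDiffOn_covD hA hv k
  have hXc : ∀ k, ContDiff ℝ 2 (fun x => (X k x : ℂ)) := fun k =>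
    Complex.ofRealCLM.contDiff.comp (hX k)
  have hdiv : ContDiff ℝ 1 (fun x => (fieldDiv X x : ℂ)) :=
    Complex.ofRealCLM.contDiff.comp (contDiff_fieldDiv hX (by norm_num))
  have hVc : ContDiffOn ℝ 1 (fun x => (V x : ℂ)) {0}ᶜ :=
    Complex.ofRealCLM.contDiff.comp_contDiffOn hV
  have hv1 : ContDiff ℝ 1 v := hv.of_le (by norm_num)
  have hGC : ContDiffOn ℝ 1 G {0}ᶜ :=
    (ContDiffOn.sum fun k _ => ((hXc k).of_le (by norm_num)).contDiffOn.mul (hqC k)).add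
      ((contDiffOn_const.mul hdiv.contDiffOn).mul hv1.contDiffOn)
  -- The flux. It is `C¹` off the origin only, but every term carries `X` or `div X`, so its support
  -- lies in `K` and it is `C¹` on the whole space.
  let Y : Fin n → Space n → ℂ := fun j x =>
    -((starRingEnd ℂ) (G x) * q j x + G x * (starRingEnd ℂ) (q j x))
      + (X j x : ℂ) * (∑ i, q i x * (starRingEnd ℂ) (q i x))
      + (X j x : ℂ) * ((V x : ℂ) * (v x * (starRingEnd ℂ) (v x)))
  have hYC : ∀ j, ContDiffOn ℝ 1 (Y j) {0}ᶜ := by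
    intro j
    have hXj := ((hXc j).of_le (m := 1) (by norm_num)).contDiffOn (s := {0}ᶜ)
    exact ((((contDiffOn_conj hGC).mul (hqC j)).add (hGC.mul (contDiffOn_conj (hqC j)))).neg.add
      (hXj.mul (ContDiffOn.sum fun i _ => (hqC i).mul (contDiffOn_conj (hqC i))))).add
      (hXj.mul (hVc.mul (hv1.contDiffOn.mul (contDiffOn_conj hv1.contDiffOn))))
  have hX0 : ∀ {x}, x ∉ K → ∀ k, X k x = 0 := fun hx k =>
    image_eq_zero_of_notMem_tsupport fun h => hx (hXK k h)
  have hYs : ∀ j, tsupport (Y j) ⊆ K := by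
    intro j
    refine closure_minimal (fun x hx => by_contra fun h => hx ?_) hK.isClosed
    have : G x = 0 := symOp_eq_zero hXK h
    simp [Y, this, hX0 h]
  have hYd : ∀ j, ContDiff ℝ 1 (Y j) := fun j =>
    contDiff_of_forall_mem_tsupport fun x hx =>
      (hYC j).contDiffAt (U.mem_nhds (hK0 (hYs j hx)))
  have hYc : ∀ j, HasCompactSupport (Y j) := fun j =>
    hK.of_isClosed_subset (isClosed_tsupport _) (hYs j)
  have key : ∀ x, pairingDensity V X q v (magLap A v) x - virialDensity A V X q v x
      = ∑ j, pd j (Y j) x := by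
    intro x
    by_cases hx : x ∈ K
    swap
    · rw [virialDensity_eq_zero hK.isClosed hXK hx, pairingDensity, symOp_eq_zero hXK hx]
      simp only [map_zero, zero_mul, add_zero, sub_zero]
      refine (Finset.sum_eq_zero fun j _ => ?_).symm
      exact image_eq_zero_of_notMem_tsupport fun h => hx (hYs j (tsupport_pd_subset j h))
    have hU := U.mem_nhds (hK0 hx)
    have dA : DifferentiableAt ℝ A x := (hA.contDiffAt hU).differentiableAt one_ne_zero
    have dV : DifferentiableAt ℝ V x := (hV.contDiffAt hU).differentiableAt one_ne_zero
    have dVc : DifferentiableAt ℝ (fun y => (V y : ℂ)) x :=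
      (hVc.contDiffAt hU).differentiableAt one_ne_zero
    have dq : ∀ k, DifferentiableAt ℝ (q k) x := fun k =>
      ((hqC k).contDiffAt hU).differentiableAt one_ne_zero
    have dq' := fun k => differentiableAt_conj (dq k)
    have dG : DifferentiableAt ℝ G x := (hGC.contDiffAt hU).differentiableAt one_ne_zero
    have dG' := differentiableAt_conj dG
    have dv : DifferentiableAt ℝ v x := hv1.differentiable one_ne_zero x
    have dv' := differentiableAt_conj dv
    have dXr : ∀ k, DifferentiableAt ℝ (X k) x := fun k => (hX k).differentiable (by simp) x
    have dX : ∀ k, DifferentiableAt ℝ (fun y => (X k y : ℂ)) x := fun k =>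
      (hXc k).differentiable (by simp) x
    have dDr : DifferentiableAt ℝ (fieldDiv X) x :=
      (contDiff_fieldDiv (k := 1) hX (by norm_num)).differentiable one_ne_zero x
    have dD : DifferentiableAt ℝ (fun y => (fieldDiv X y : ℂ)) x :=
      hdiv.differentiable one_ne_zero x
    have pX : ∀ j k, pd j (fun y => (X k y : ℂ)) x = ((pd j (X k) x : ℝ) : ℂ) := fun j k =>
      pd_ofReal (dXr k) j
    have hpv : ∀ j, pd j v x = q j x + Complex.I * (A x j : ℂ) * v x := by
      intro j
      simp only [hq, covD]
      ring
    have hpG : ∀ j, pd j G x = ∑ k, (((pd j (X k) x : ℝ) : ℂ) * q k x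
        + (X k x : ℂ) * pd j (q k) x)
        + 1 / 2 * (((pd j (fieldDiv X) x : ℝ) : ℂ) * v x + (fieldDiv X x : ℂ) * pd j v x) := by
      intro j
      have e : G = fun y => (∑ k, (X k y : ℂ) * q k y)
          + 1 / 2 * ((fieldDiv X y : ℂ) * v y) := by
        ext y
        simp only [hG, symOp]
        ring
      have d1 : ∀ k, DifferentiableAt ℝ (fun y => (X k y : ℂ) * q k y) x := fun k =>
        (dX k).mul (dq k)
      have d2 : DifferentiableAt ℝ (fun y => (fieldDiv X y : ℂ) * v y) x := dD.mul dv
      rw [e, pd_add (DifferentiableAt.fun_sum fun k _ => d1 k) (d2.const_mul _),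
        pd_sum _ fun k _ => d1 k, pd_const_mul _ d2, pd_mul dD dv, pd_ofReal dDr]
      simp_rw [fun k => pd_mul (dX k) (dq k) j, pX]
    have hpY : ∀ j, pd j (Y j) x = -((starRingEnd ℂ) (pd j G x) * q j x
        + (starRingEnd ℂ) (G x) * pd j (q j) x + (pd j G x * (starRingEnd ℂ) (q j x)
        + G x * (starRingEnd ℂ) (pd j (q j) x)))
        + (((pd j (X j) x : ℝ) : ℂ) * (∑ i, q i x * (starRingEnd ℂ) (q i x))
        + (X j x : ℂ) * ∑ i, (pd j (q i) x * (starRingEnd ℂ) (q i x)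
          + q i x * (starRingEnd ℂ) (pd j (q i) x)))
        + (((pd j (X j) x : ℝ) : ℂ) * ((V x : ℂ) * (v x * (starRingEnd ℂ) (v x)))
        + (X j x : ℂ) * (((pd j V x : ℝ) : ℂ) * (v x * (starRingEnd ℂ) (v x))
          + (V x : ℂ) * (pd j v x * (starRingEnd ℂ) (v x)
          + v x * (starRingEnd ℂ) (pd j v x)))) := by
      intro j
      have d1 : DifferentiableAt ℝ (fun y => (starRingEnd ℂ) (G y) * q j y) x := dG'.mul (dq j)
      have d2 : DifferentiableAt ℝ (fun y => G y * (starRingEnd ℂ) (q j y)) x := dG.mul (dq' j)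
      have d3 : ∀ i, DifferentiableAt ℝ (fun y => q i y * (starRingEnd ℂ) (q i y)) x := fun i =>
        (dq i).mul (dq' i)
      have d4 : DifferentiableAt ℝ (fun y => ∑ i, q i y * (starRingEnd ℂ) (q i y)) x :=
        DifferentiableAt.fun_sum fun i _ => d3 i
      have d5 : DifferentiableAt ℝ (fun y => v y * (starRingEnd ℂ) (v y)) x := dv.mul dv'
      have d6 : DifferentiableAt ℝ (fun y => (V y : ℂ) * (v y * (starRingEnd ℂ) (v y))) x :=
        dVc.mul d5
      have d12 : DifferentiableAt ℝ (fun y => (starRingEnd ℂ) (G y) * q j y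
        + G y * (starRingEnd ℂ) (q j y)) x := d1.add d2
      simp only [Y]
      rw [pd_add (d12.fun_neg.fun_add ((dX j).fun_mul d4)) ((dX j).fun_mul d6),
        pd_add d12.fun_neg ((dX j).fun_mul d4), pd_neg, pd_add d1 d2, pd_mul dG' (dq j),
        pd_mul dG (dq' j), pd_mul (dX j) d4, pd_mul (dX j) d6, pd_mul dVc d5, pd_mul dv dv',
        pd_sum _ fun i _ => d3 i, pd_conj dG, pd_conj (dq j), pd_conj dv, pX, pd_ofReal dV]
      simp_rw [fun i => pd_mul (dq i) (dq' i) j, fun i => pd_conj (dq i) j]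
    simp_rw [hpY]
    have hH : magLap A v x = - ∑ j, (pd j (q j) x - Complex.I * (A x j : ℂ) * q j x) := rfl
    rw [pairingDensity, virialDensity, ← hG, map_add, map_mul, Complex.conj_ofReal]
    refine virial_algebra (fun k => (X k x : ℂ)) (fun k => (A x k : ℂ))
      (fun j => ((pd j (fieldDiv X) x : ℝ) : ℂ)) (fun j => ((pd j V x : ℝ) : ℂ))
      (fun k => q k x) (fun k => (starRingEnd ℂ) (q k x)) (fun j k => ((pd j (X k) x : ℝ) : ℂ))
      (fun j k => pd j (q k) x) (fun j k => (starRingEnd ℂ) (pd j (q k) x))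
      (fun k j => (magneticField A x k j : ℂ)) (fieldDiv X x) (G x) ((starRingEnd ℂ) (G x))
      (magLap A v x) ((starRingEnd ℂ) (magLap A v x)) (v x) ((starRingEnd ℂ) (v x)) (V x)
      (fun j => pd j G x) (fun j => (starRingEnd ℂ) (pd j G x))
      (fun j => pd j v x) (fun j => (starRingEnd ℂ) (pd j v x))
      ?_ ?_ ?_ hpv ?_ hpG ?_ hH ?_ ?_ ?_
    · simp [fieldDiv]
    · rfl
    · simp [hG, symOp, Complex.conj_ofNat]
    · intro j
      simp [hpv j]
      ring
    · intro j
      simp [hpG j, Complex.conj_ofNat]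
    · simp only [hH, map_neg, map_sum, map_sub, map_mul, Complex.conj_I, Complex.conj_ofReal]
      refine congrArg Neg.neg (Finset.sum_congr rfl fun j _ => ?_)
      ring
    · intro j k
      exact pd_covD_comm hv dA j k
    · intro j k
      have := congrArg (starRingEnd ℂ) (pd_covD_comm hv dA j k)
      simp only [map_sub, map_add, map_mul, Complex.conj_I, Complex.conj_ofReal] at this
      simp only [hq]
      rw [this]
      ring
  simp_rw [key]
  rw [integral_finsetSum _ fun j _ => (continuous_pd (hYd j) j).integrable_of_hasCompactSupport
    (HasCompactSupport.pd (hYc j) j)]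
  exact Finset.sum_eq_zero fun j _ => integral_pd_eq_zero (hYd j) (hYc j) j

end VirialIdentity

/-! ### The virial identity and antisymmetry on the domain of `H_A`. -/

section WeakVirial

variable {n : ℕ} {A : Space n → Space n} {V : Space n → ℝ}

lemma continuousOn_magneticField (hA : ContDiffOn ℝ 1 A {0}ᶜ) (k j : Fin n) :
    ContinuousOn (fun x => magneticField A x k j) {0}ᶜ := by
  have h : ∀ i l : Fin n, ContinuousOn (fun x => fderiv ℝ A x (basisVec i) l) {0}ᶜ := fun i l =>
    (EuclideanSpace.proj (𝕜 := ℝ) l).continuous.comp_continuousOn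
      ((hA.continuousOn_fderiv_of_isOpen isOpen_compl_singleton le_rfl).clm_apply
        continuousOn_const)
  exact (h j k).sub (h k j)

lemma continuousOn_pd {f : Space n → ℝ} {U : Set (Space n)} (hU : IsOpen U)
    (hf : ContDiffOn ℝ 1 f U) (j : Fin n) : ContinuousOn (pd j f) U :=
  (hf.continuousOn_fderiv_of_isOpen hU le_rfl).clm_apply continuousOn_const

lemma TendstoLp.symOp {X : Fin n → Space n → ℝ} (hX : ∀ k, ContDiff ℝ 1 (X k))
    {K : Set (Space n)} (hK : IsCompact K) {q : ℕ → Fin n → Space n → ℂ}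
    {p : Fin n → Space n → ℂ} {v : ℕ → Space n → ℂ} {w : Space n → ℂ}
    (hq : ∀ k, TendstoLp 2 (volume.restrict K) (fun m => q m k) (p k))
    (hv : TendstoLp 2 (volume.restrict K) v w) :
    TendstoLp 2 (volume.restrict K) (fun m => symOp X (q m) (v m)) (symOp X p w) := by
  refine (TendstoLp.sum _ (by norm_num) fun k _ => (hq k).continuousOn_mul hK
    (c := fun x => (X k x : ℂ)) ?_).add (by norm_num)
      (hv.continuousOn_mul hK (c := fun x => 1 / 2 * (fieldDiv X x : ℂ)) ?_)
  · exact (Complex.continuous_ofReal.comp (hX k).continuous).continuousOn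
  · exact (continuous_const.mul (Complex.continuous_ofReal.comp
      (contDiff_fieldDiv (k := 0) hX (by norm_num)).continuous)).continuousOn

lemma integrable_of_restrict {f : Space n → ℂ} {K : Set (Space n)} (hK : MeasurableSet K)
    (hf : ∀ x, x ∉ K → f x = 0) (h : Integrable f (volume.restrict K)) : Integrable f := by
  have : IntegrableOn f K volume := h
  rw [← integrable_indicator_iff hK] at this
  refine this.congr (.of_forall fun x => ?_)
  by_cases hx : x ∈ K
  · simp [hx]
  · simp [hx, hf x hx]

/-- The virial identity for the elements of the domain of `H_A`, and a field `X` supported away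
from the singularity. -/
theorem integral_pairing_eq_integral_virial (hA : ContDiffOn ℝ 1 A {0}ᶜ)
    (hV : ContDiffOn ℝ 1 V {0}ᶜ)
    {X : Fin n → Space n → ℝ} (hX : ∀ k, ContDiff ℝ 2 (X k)) {K : Set (Space n)}
    (hK : IsCompact K) (hK0 : K ⊆ {0}ᶜ) (hXK : ∀ k, tsupport (X k) ⊆ K)
    {w h : L2 n} {p : L2Vec n} (hp : IsCovariantGradient A w p) (hh : IsFormSolution A p h) :
    Integrable (virialDensity A V X (fun k x => p x k) w) ∧
    ∫ x, pairingDensity V X (fun k x => p x k) w h x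
      = ∫ x, virialDensity A V X (fun k x => p x k) w x := by
  obtain ⟨v, hv, -, tv, tq, th⟩ := exists_smooth_approx hA hp hh hK hK0
  have U : IsOpen ({0}ᶜ : Set (Space n)) := isOpen_compl_singleton
  have one_le : (1 : ENNReal) ≤ 2 := by norm_num
  have hX1 : ∀ k, ContDiff ℝ 1 (X k) := fun k => (hX k).of_le (by norm_num)
  have re : ∀ {f : Space n → ℝ}, ContinuousOn f {0}ᶜ → ContinuousOn (fun x => (f x : ℂ)) K :=
    fun hf => Complex.continuous_ofReal.comp_continuousOn (hf.mono hK0)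
  have tG := TendstoLp.symOp hX1 hK (q := fun m k => covD A k (v m)) tq tv
  have tH := th.add one_le (tv.continuousOn_mul hK (re hV.continuousOn))
  -- Both densities are sums of products of two `L²(K)`-convergent factors with coefficients bounded
  -- on `K`, so they converge in `L¹(K)`.
  have tE : TendstoLp 1 (volume.restrict K)
      (fun m => pairingDensity V X (fun k => covD A k (v m)) (v m) (magLap A (v m)))
      (pairingDensity V X (fun k x => p x k) w h) :=
    (tG.conj.mul tH).add le_rfl (tG.mul tH.conj)
  have cX : ∀ k, ContinuousOn (fun x => (X k x : ℂ)) K := fun k =>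
    re (hX k).continuous.continuousOn
  have tR : TendstoLp 1 (volume.restrict K)
      (fun m => virialDensity A V X (fun k => covD A k (v m)) (v m))
      (virialDensity A V X (fun k x => p x k) w) := by
    refine (((TendstoLp.sum _ le_rfl fun j _ => TendstoLp.sum _ le_rfl fun k _ =>
      ((((tq k).conj.mul (tq j)).add le_rfl ((tq k).mul (tq j).conj)).continuousOn_mul hK
        (re (continuous_pd (hX1 k) j).continuousOn))).add le_rfl
      ((TendstoLp.sum _ le_rfl fun j _ =>
      (((tv.conj.mul (tq j)).add le_rfl (tv.mul (tq j).conj)).continuousOn_mul hK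
        (re (continuous_pd (contDiff_fieldDiv hX (by norm_num)) j).continuousOn))).const_mul
          (1 / 2))).sub le_rfl ((tv.mul tv.conj).continuousOn_mul hK
        (continuousOn_finsetSum _ fun j _ => (cX j).mul (re (continuousOn_pd U hV j))))).add
        le_rfl (TendstoLp.sum _ le_rfl fun j _ => TendstoLp.sum _ le_rfl fun k _ =>
        ((((tv.conj.mul (tq j)).sub le_rfl (tv.mul (tq j).conj)).const_mul
          Complex.I).continuousOn_mul hK
          ((cX k).mul (re (continuousOn_magneticField hA k j)))))
  have zE : ∀ {q : Fin n → Space n → ℂ} {u g : Space n → ℂ} (x : Space n), x ∉ K →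
      pairingDensity V X q u g x = 0 := by
    intro q u g x hx
    simp [pairingDensity, symOp_eq_zero hXK hx]
  have zR : ∀ {q : Fin n → Space n → ℂ} {u : Space n → ℂ} (x : Space n), x ∉ K →
      virialDensity A V X q u x = 0 := fun x hx => virialDensity_eq_zero hK.isClosed hXK hx
  have iR : Integrable (virialDensity A V X (fun k x => p x k) w) :=
    integrable_of_restrict hK.measurableSet zR (memLp_one_iff_integrable.1 tR.memLp_lim)
  refine ⟨iR, ?_⟩
  have t := (tE.sub le_rfl tR).tendsto_integral
  have z : ∀ m, ∫ x in K, (pairingDensity V X (fun k => covD A k (v m)) (v m) (magLap A (v m)) x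
      - virialDensity A V X (fun k => covD A k (v m)) (v m) x) = 0 := by
    intro m
    rw [setIntegral_eq_integral_of_forall_compl_eq_zero
      fun x hx => by rw [zE x hx, zR x hx, sub_zero]]
    exact integral_virialDensity_of_contDiff hA hV hX hK hK0 hXK
      (contDiff_infty.1 (hv m) 2)
  have t0 := tendsto_nhds_unique t (tendsto_const_nhds.congr fun m => (z m).symm)
  rw [setIntegral_eq_integral_of_forall_compl_eq_zero
    fun x hx => by rw [zE x hx, zR x hx, sub_zero]] at t0
  rw [← sub_eq_zero, ← integral_sub _ iR, t0]
  exact integrable_of_restrict hK.measurableSet zE (memLp_one_iff_integrable.1 tE.memLp_lim)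

/-- The integrand is the divergence of `X conj(v) v'`: the magnetic terms of the two covariant
derivatives cancel, and the two halves of `div X` add up. -/
lemma integral_symOp_of_contDiff {X : Fin n → Space n → ℝ} (hX : ∀ k, ContDiff ℝ 1 (X k))
    (hXc : ∀ k, HasCompactSupport (X k)) {v v' : Space n → ℂ} (hv : ContDiff ℝ 1 v)
    (hv' : ContDiff ℝ 1 v') :
    ∫ x, ((starRingEnd ℂ) (v x) * symOp X (fun k => covD A k v') v' x
      + (starRingEnd ℂ) (symOp X (fun k => covD A k v) v x) * v' x) = 0 := by
  have hXC : ∀ k, ContDiff ℝ 1 (fun x => (X k x : ℂ)) := fun k =>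
    Complex.ofRealCLM.contDiff.comp (hX k)
  have hXCc : ∀ k, HasCompactSupport (fun x => (X k x : ℂ)) := fun k =>
    (hXc k).comp_left (g := fun r : ℝ => (r : ℂ)) (by simp)
  have hcv : ContDiff ℝ 1 (fun x => (starRingEnd ℂ) (v x)) := Complex.conjCLE.contDiff.comp hv
  have hY : ∀ k, ContDiff ℝ 1 (fun x => (X k x : ℂ) * ((starRingEnd ℂ) (v x) * v' x)) := fun k =>
    (hXC k).mul (hcv.mul hv')
  have e : ∀ x, (starRingEnd ℂ) (v x) * symOp X (fun k => covD A k v') v' x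
      + (starRingEnd ℂ) (symOp X (fun k => covD A k v) v x) * v' x
      = ∑ k, pd k (fun x => (X k x : ℂ) * ((starRingEnd ℂ) (v x) * v' x)) x := by
    intro x
    have dv := hv.differentiable one_ne_zero x
    have dv' := hv'.differentiable one_ne_zero x
    have dcv := hcv.differentiable one_ne_zero x
    have h1 : ∀ k, pd k (fun x => (X k x : ℂ) * ((starRingEnd ℂ) (v x) * v' x)) x
        = ((pd k (X k) x : ℝ) : ℂ) * ((starRingEnd ℂ) (v x) * v' x)
          + (X k x : ℂ) * ((starRingEnd ℂ) (covD A k v x) * v' x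
            + (starRingEnd ℂ) (v x) * covD A k v' x) := by
      intro k
      have dvv : DifferentiableAt ℝ (fun x => (starRingEnd ℂ) (v x) * v' x) x := dcv.mul dv'
      rw [pd_mul ((hXC k).differentiable one_ne_zero x) dvv, pd_mul dcv dv',
        pd_ofReal ((hX k).differentiable one_ne_zero x), pd_conj dv]
      simp only [covD, map_sub, map_mul, Complex.conj_I, Complex.conj_ofReal]
      ring
    simp only [h1, symOp, fieldDiv]
    rw [Finset.sum_add_distrib, ← Finset.sum_mul]
    simp only [map_add, map_sum, map_mul, Complex.conj_ofReal, map_div₀, map_one,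
      Complex.conj_ofNat]
    push_cast
    simp only [mul_add, add_mul, Finset.sum_add_distrib]
    have e1 : ∑ k, (X k x : ℂ) * ((starRingEnd ℂ) (covD A k v x) * v' x)
        = (∑ k, (X k x : ℂ) * (starRingEnd ℂ) (covD A k v x)) * v' x := by
      rw [Finset.sum_mul]
      exact Finset.sum_congr rfl fun k _ => by ring
    have e2 : ∑ k, (X k x : ℂ) * ((starRingEnd ℂ) (v x) * covD A k v' x)
        = (starRingEnd ℂ) (v x) * (∑ k, (X k x : ℂ) * covD A k v' x) := by
      rw [Finset.mul_sum]
      exact Finset.sum_congr rfl fun k _ => by ring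
    rw [e1, e2]
    ring
  simp_rw [e]
  rw [integral_finsetSum _ fun k _ => (continuous_pd (hY k) k).integrable_of_hasCompactSupport
    (HasCompactSupport.pd (hXCc k).mul_right k)]
  exact Finset.sum_eq_zero fun k _ => integral_pd_eq_zero (hY k) (hXCc k).mul_right k

/-- The operator `X · ∇_A + ½ div X` is antisymmetric on the domain of `H_A`. -/
theorem integral_symOp_antisymm (hA : ContDiffOn ℝ 1 A {0}ᶜ)
    {X : Fin n → Space n → ℝ} (hX : ∀ k, ContDiff ℝ 1 (X k)) {K : Set (Space n)}
    (hK : IsCompact K) (hK0 : K ⊆ {0}ᶜ) (hXK : ∀ k, tsupport (X k) ⊆ K)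
    {w h w' h' : L2 n} {p p' : L2Vec n} (hp : IsCovariantGradient A w p)
    (hh : IsFormSolution A p h) (hp' : IsCovariantGradient A w' p')
    (hh' : IsFormSolution A p' h') :
    Integrable (fun x => (starRingEnd ℂ) (w x) * symOp X (fun k x => p' x k) w' x
      + (starRingEnd ℂ) (symOp X (fun k x => p x k) w x) * w' x) ∧
    ∫ x, ((starRingEnd ℂ) (w x) * symOp X (fun k x => p' x k) w' x
      + (starRingEnd ℂ) (symOp X (fun k x => p x k) w x) * w' x) = 0 := by
  obtain ⟨v, hv, -, tv, tq, -⟩ := exists_smooth_approx hA hp hh hK hK0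
  obtain ⟨v', hv', -, tv', tq', -⟩ := exists_smooth_approx hA hp' hh' hK hK0
  have tG := TendstoLp.symOp hX hK (q := fun m k => covD A k (v m)) tq tv
  have tG' := TendstoLp.symOp hX hK (q := fun m k => covD A k (v' m)) tq' tv'
  have tL := (tv.conj.mul tG').add le_rfl (tG.conj.mul tv')
  have t := tL.tendsto_integral
  have z : ∀ m, ∫ x in K, ((starRingEnd ℂ) (v m x) * symOp X (fun k => covD A k (v' m)) (v' m) x
      + (starRingEnd ℂ) (symOp X (fun k => covD A k (v m)) (v m) x) * v' m x) = 0 := by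
    intro m
    rw [setIntegral_eq_integral_of_forall_compl_eq_zero fun x hx => by
      simp [symOp_eq_zero hXK hx]]
    exact integral_symOp_of_contDiff hX
      (fun k => hK.of_isClosed_subset (isClosed_tsupport _) (hXK k))
      ((hv m).of_le (by simp)) ((hv' m).of_le (by simp))
  have t0 := tendsto_nhds_unique t (tendsto_const_nhds.congr fun m => (z m).symm)
  rw [setIntegral_eq_integral_of_forall_compl_eq_zero
    fun x hx => by simp [symOp_eq_zero hXK hx]] at t0
  exact ⟨integrable_of_restrict hK.measurableSet (fun x hx => by simp [symOp_eq_zero hXK hx])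
    (memLp_one_iff_integrable.1 tL.memLp_lim), t0⟩

end WeakVirial

/-! ### Radial fields `χ(log|x|²) x`. -/

section Radial

variable {n : ℕ} {A : Space n → Space n} {V : Space n → ℝ}

/-- The logarithm of `|x|²`. -/
noncomputable def logSq (x : Space n) : ℝ := Real.log (‖x‖ ^ 2)

/-- The radial vector field `χ(log |x|²) x`. -/
noncomputable def radialField (χ : ℝ → ℝ) (i : Fin n) (x : Space n) : ℝ := χ (logSq x) * x i

/-- The compact annulus `|log |x|²| ≤ R`. -/
def annulus (n : ℕ) (R : ℝ) : Set (Space n) :=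
  {x | Real.exp (-R) ≤ ‖x‖ ^ 2 ∧ ‖x‖ ^ 2 ≤ Real.exp R}

lemma isCompact_annulus (R : ℝ) : IsCompact (annulus n R) := by
  have hc : IsClosed (annulus n R) := by
    have hn : Continuous fun x : Space n => ‖x‖ ^ 2 := by fun_prop
    exact (isClosed_le continuous_const hn).inter (isClosed_le hn continuous_const)
  refine (isCompact_closedBall (0 : Space n) (Real.exp R + 1)).of_isClosed_subset hc ?_
  rintro x ⟨-, hx⟩
  rw [mem_closedBall_zero_iff]
  nlinarith [sq_nonneg (‖x‖ - 1)]

lemma annulus_subset (R : ℝ) : annulus n R ⊆ {0}ᶜ := by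
  rintro x ⟨hx, -⟩ rfl
  simp at hx
  exact absurd hx (not_le.2 (Real.exp_pos _))

lemma mem_annulus {R : ℝ} {x : Space n} (hx : x ≠ 0) : x ∈ annulus n R ↔ |logSq x| ≤ R := by
  have h : 0 < ‖x‖ ^ 2 := by positivity
  rw [abs_le, logSq, Real.le_log_iff_exp_le h, Real.log_le_iff_le_exp h]
  rfl

lemma exp_neg_logSq {x : Space n} (hx : x ≠ 0) : Real.exp (-logSq x) = (‖x‖ ^ 2)⁻¹ := by
  rw [logSq, Real.exp_neg, Real.exp_log (by positivity)]

lemma contDiffAt_logSq {x : Space n} (hx : x ≠ 0) {k : WithTop ℕ∞} : ContDiffAt ℝ k logSq x :=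
  (contDiff_norm_sq ℝ).contDiffAt.log (by positivity)

lemma pd_logSq {x : Space n} (hx : x ≠ 0) (j : Fin n) : pd j logSq x = 2 * x j / ‖x‖ ^ 2 := by
  have h := ((hasStrictFDerivAt_norm_sq x).hasFDerivAt.log (by positivity : ‖x‖ ^ 2 ≠ 0)).fderiv
  have h2 : fderiv ℝ (logSq : Space n → ℝ) x = _ := h
  rw [pd, h2]
  simp [basisVec, EuclideanSpace.inner_single_right]
  ring

lemma pd_coord (x : Space n) (i j : Fin n) :
    pd j (fun y : Space n => y i) x = if i = j then 1 else 0 := by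
  have h := (EuclideanSpace.proj i : Space n →L[ℝ] ℝ).hasFDerivAt (x := x)
  have h2 : fderiv ℝ (fun y : Space n => y i) x = _ := h.fderiv
  rw [pd, h2]
  simp [basisVec]

lemma differentiableAt_coord (x : Space n) (i : Fin n) :
    DifferentiableAt ℝ (fun y : Space n => y i) x :=
  (EuclideanSpace.proj i : Space n →L[ℝ] ℝ).differentiableAt

lemma pd_mul_real {f g : Space n → ℝ} {x : Space n} (hf : DifferentiableAt ℝ f x)
    (hg : DifferentiableAt ℝ g x) (j : Fin n) :
    pd j (fun y => f y * g y) x = pd j f x * g x + f x * pd j g x := by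
  simp only [pd]
  rw [fderiv_fun_mul hf hg]
  simp
  ring

lemma pd_comp_logSq {χ : ℝ → ℝ} {x : Space n} (hx : x ≠ 0) (hχ : DifferentiableAt ℝ χ (logSq x))
    (j : Fin n) : pd j (fun y => χ (logSq y)) x = deriv χ (logSq x) * (2 * x j / ‖x‖ ^ 2) := by
  have h1 : DifferentiableAt ℝ (logSq : Space n → ℝ) x :=
    (contDiffAt_logSq (k := 1) hx).differentiableAt one_ne_zero
  have h2 : fderiv ℝ (fun y => χ (logSq y)) x = _ :=
    (hχ.hasDerivAt.comp_hasFDerivAt x h1.hasFDerivAt).fderiv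
  rw [← pd_logSq hx, pd, h2]
  simp [pd]

variable {χ : ℝ → ℝ}

lemma radialField_eq_zero {R : ℝ} (hR : ∀ s, R < |s| → χ s = 0) {x : Space n}
    (hx : x ∉ annulus n R) (i : Fin n) : radialField χ i x = 0 := by
  rcases eq_or_ne x 0 with rfl | h0
  · simp [radialField]
  · rw [mem_annulus h0, not_le] at hx
    simp [radialField, hR _ hx]

lemma tsupport_radialField {R : ℝ} (hR : ∀ s, R < |s| → χ s = 0) (i : Fin n) :
    tsupport (radialField χ i : Space n → ℝ) ⊆ annulus n R :=
  closure_minimal (fun _ hx => by_contra fun h => hx (radialField_eq_zero hR h i))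
    (isCompact_annulus R).isClosed

lemma contDiff_radialField (hχ : ContDiff ℝ ∞ χ) {R : ℝ} (hR : ∀ s, R < |s| → χ s = 0)
    (i : Fin n) : ContDiff ℝ ∞ (radialField χ i : Space n → ℝ) := by
  refine contDiff_of_forall_mem_tsupport fun x hx => ?_
  have hx0 : x ≠ 0 := annulus_subset R (tsupport_radialField hR i hx)
  exact (hχ.contDiffAt.comp x (contDiffAt_logSq hx0)).mul
    (EuclideanSpace.proj i : Space n →L[ℝ] ℝ).contDiff.contDiffAt

lemma pd_radialField (hχ : ContDiff ℝ ∞ χ) {x : Space n} (hx : x ≠ 0) (i j : Fin n) :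
    pd j (radialField χ i) x = χ (logSq x) * (if i = j then 1 else 0)
      + deriv χ (logSq x) * (2 / ‖x‖ ^ 2) * (x i * x j) := by
  have hd : DifferentiableAt ℝ χ (logSq x) := hχ.differentiable (by simp) _
  have h1 : DifferentiableAt ℝ (fun y : Space n => χ (logSq y)) x :=
    hd.comp x ((contDiffAt_logSq (k := 1) hx).differentiableAt one_ne_zero)
  rw [show (radialField χ i : Space n → ℝ) = fun y => χ (logSq y) * y i from rfl,
    pd_mul_real h1 (differentiableAt_coord x i), pd_comp_logSq hx hd, pd_coord]
  ring

lemma sum_sq_coord (x : Space n) : ∑ i, x i * x i = ‖x‖ ^ 2 := by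
  rw [EuclideanSpace.real_norm_sq_eq]
  exact Finset.sum_congr rfl fun i _ => by ring

lemma fieldDiv_radialField (hχ : ContDiff ℝ ∞ χ) {x : Space n} (hx : x ≠ 0) :
    fieldDiv (radialField χ) x = n * χ (logSq x) + 2 * deriv χ (logSq x) := by
  have h : ‖x‖ ^ 2 ≠ 0 := by positivity
  simp only [fieldDiv, pd_radialField hχ hx, if_true, mul_one]
  rw [Finset.sum_add_distrib, ← Finset.mul_sum, sum_sq_coord]
  simp
  field_simp

lemma pd_fieldDiv_radialField (hχ : ContDiff ℝ ∞ χ) {x : Space n} (hx : x ≠ 0) (j : Fin n) :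
    pd j (fieldDiv (radialField χ)) x
      = (n * deriv χ (logSq x) + 2 * deriv (deriv χ) (logSq x)) * (2 * x j / ‖x‖ ^ 2) := by
  have e : fieldDiv (radialField χ) =ᶠ[𝓝 x]
      fun y : Space n => (fun s => n * χ s + 2 * deriv χ s) (logSq y) := by
    filter_upwards [isOpen_compl_singleton.mem_nhds hx] with y hy
    exact fieldDiv_radialField hχ hy
  have d1 : Differentiable ℝ χ := hχ.differentiable (by simp)
  have d2 : Differentiable ℝ (deriv χ) :=
    ((contDiff_infty_iff_deriv.1 hχ).2).differentiable (by simp)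
  have e2 : pd j (fieldDiv (radialField χ)) x
      = pd j (fun y : Space n => (fun s => n * χ s + 2 * deriv χ s) (logSq y)) x := by
    simp only [pd]
    rw [e.fderiv_eq]
  have d3 : deriv (fun s => n * χ s + 2 * deriv χ s) (logSq x)
      = n * deriv χ (logSq x) + 2 * deriv (deriv χ) (logSq x) := by
    rw [deriv_fun_add ((d1 _).const_mul _) ((d2 _).const_mul _), deriv_const_mul _ (d1 _),
      deriv_const_mul _ (d2 _)]
  have d4 : DifferentiableAt ℝ (fun s => n * χ s + 2 * deriv χ s) (logSq x) :=
    ((d1 _).const_mul _).add ((d2 _).const_mul _)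
  rw [e2, pd_comp_logSq hx d4, d3]

lemma norm_mul_radialDeriv {x : Space n} (hx : x ≠ 0) :
    ‖x‖ * radialDeriv V x = ∑ j, x j * pd j V x := by
  have h : ‖x‖ ≠ 0 := by positivity
  have e : x = ∑ j, x j • (basisVec j : Space n) := by
    ext i
    simp [basisVec, Finset.sum_apply, Pi.single_apply]
  rw [radialDeriv, map_smul, smul_eq_mul, ← mul_assoc, mul_inv_cancel₀ h, one_mul]
  conv_lhs => rw [e]
  simp only [map_sum, map_smul, pd, smul_eq_mul]
  rw [← e]

lemma norm_sq_eq_sum (p : EuclideanSpace ℂ (Fin n)) :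
    ((‖p‖ ^ 2 : ℝ) : ℂ) = ∑ k, p k * (starRingEnd ℂ) (p k) := by
  rw [EuclideanSpace.norm_sq_eq]
  push_cast
  exact Finset.sum_congr rfl fun k _ => by rw [Complex.mul_conj, Complex.normSq_eq_norm_sq]; simp

/-- The real density of the virial identity for the field `χ(log |x|²) x`. -/
noncomputable def radialVirial (A : Space n → Space n) (V : Space n → ℝ) (χ : ℝ → ℝ) (w : L2 n)
    (p : L2Vec n) (x : Space n) : ℝ :=
  2 * χ (logSq x) * ‖p x‖ ^ 2
    + 4 * deriv χ (logSq x) / ‖x‖ ^ 2 * ‖∑ j, (x j : ℂ) * p x j‖ ^ 2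
    + (n * deriv χ (logSq x) + 2 * deriv (deriv χ) (logSq x)) * (2 / ‖x‖ ^ 2)
      * ((starRingEnd ℂ) (w x) * ∑ j, (x j : ℂ) * p x j).re
    - χ (logSq x) * electricDensity V w x
    + 2 * χ (logSq x) * (magneticDensity A w p x).im

/-- Here `∂_j X_k = χ δ_jk + 2 χ' x_j x_k / |x|²` and `div X = n χ + 2 χ'`. In the logarithmic
variable no power of `|x|` multiplies `χ'` in either, so scaling `χ` by `N` makes these terms small
uniformly in `x`. -/
lemma virialDensity_radialField (hχ : ContDiff ℝ ∞ χ) (w : L2 n) (p : L2Vec n) {x : Space n}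
    (hx : x ≠ 0) : virialDensity A V (radialField χ) (fun k x => p x k) w x
      = (radialVirial A V χ w p x : ℂ) := by
  have hr : (‖x‖ : ℂ) ≠ 0 := by exact_mod_cast norm_ne_zero_iff.2 hx
  set S : ℂ := ∑ j, (x j : ℂ) * p x j with hS
  have hS' : (starRingEnd ℂ) S = ∑ j, (x j : ℂ) * (starRingEnd ℂ) (p x j) := by
    simp [hS]
  have e1 : ∑ j, ∑ k, ((pd j (radialField χ k) x : ℝ) : ℂ)
      * ((starRingEnd ℂ) (p x k) * p x j + p x k * (starRingEnd ℂ) (p x j))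
      = 2 * χ (logSq x) * ((‖p x‖ ^ 2 : ℝ) : ℂ)
        + 4 * ((deriv χ (logSq x) : ℝ) : ℂ) / (‖x‖ : ℂ) ^ 2 * ((‖S‖ ^ 2 : ℝ) : ℂ) := by
    have a1 : ∀ j k, ((pd j (radialField χ k) x : ℝ) : ℂ)
        * ((starRingEnd ℂ) (p x k) * p x j + p x k * (starRingEnd ℂ) (p x j))
        = (χ (logSq x) : ℂ) * (if k = j then (starRingEnd ℂ) (p x k) * p x j
          + p x k * (starRingEnd ℂ) (p x j) else 0)
          + ((deriv χ (logSq x) : ℝ) : ℂ) * (2 / (‖x‖ : ℂ) ^ 2) *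
            (((x k : ℂ) * (starRingEnd ℂ) (p x k)) * ((x j : ℂ) * p x j)
              + ((x k : ℂ) * p x k) * ((x j : ℂ) * (starRingEnd ℂ) (p x j))) := by
      intro j k
      rw [pd_radialField hχ hx]
      split_ifs <;> push_cast <;> ring
    simp_rw [a1, Finset.sum_add_distrib, ← Finset.mul_sum]
    have a2 : ∑ j, ∑ k, (if k = j then (starRingEnd ℂ) (p x k) * p x j
          + p x k * (starRingEnd ℂ) (p x j) else 0) = 2 * ((‖p x‖ ^ 2 : ℝ) : ℂ) := by
      rw [norm_sq_eq_sum, Finset.mul_sum]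
      refine Finset.sum_congr rfl fun j _ => ?_
      rw [Finset.sum_ite_eq' Finset.univ j]
      simp only [Finset.mem_univ, if_true]
      ring
    have a3 : ∑ j, ∑ k, (((x k : ℂ) * (starRingEnd ℂ) (p x k)) * ((x j : ℂ) * p x j)
              + ((x k : ℂ) * p x k) * ((x j : ℂ) * (starRingEnd ℂ) (p x j)))
        = 2 * ((‖S‖ ^ 2 : ℝ) : ℂ) := by
      have : ((‖S‖ ^ 2 : ℝ) : ℂ) = S * (starRingEnd ℂ) S := by
        rw [Complex.mul_conj, Complex.normSq_eq_norm_sq]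
      simp_rw [Finset.sum_add_distrib, ← Finset.sum_mul, ← Finset.mul_sum]
      rw [this, hS', ← hS]
      ring
    simp only [Finset.sum_add_distrib] at a3
    rw [a2]
    simp only [← Finset.sum_add_distrib] at a3 ⊢
    rw [a3]
    ring
  have e2 : ∑ j, ((pd j (fieldDiv (radialField χ)) x : ℝ) : ℂ)
      * ((starRingEnd ℂ) (w x) * p x j + w x * (starRingEnd ℂ) (p x j))
      = (n * ((deriv χ (logSq x) : ℝ) : ℂ) + 2 * ((deriv (deriv χ) (logSq x) : ℝ) : ℂ))
        * (2 / (‖x‖ : ℂ) ^ 2)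
        * (2 * ((((starRingEnd ℂ) (w x) * S).re : ℝ) : ℂ)) := by
    have : (2 * ((((starRingEnd ℂ) (w x) * S).re : ℝ) : ℂ))
        = (starRingEnd ℂ) (w x) * S + w x * (starRingEnd ℂ) S := by
      rw [← Complex.ofReal_ofNat 2, ← Complex.ofReal_mul, ← Complex.add_conj]
      simp
    rw [this, hS', hS, Finset.mul_sum, Finset.mul_sum, ← Finset.sum_add_distrib, Finset.mul_sum]
    refine Finset.sum_congr rfl fun j _ => ?_
    rw [pd_fieldDiv_radialField hχ hx]
    push_cast
    ring
  have e3 : (∑ j, (radialField χ j x : ℂ) * ((pd j V x : ℝ) : ℂ)) * (w x * (starRingEnd ℂ) (w x))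
      = (χ (logSq x) : ℂ) * (electricDensity V w x : ℂ) := by
    rw [electricDensity, norm_mul_radialDeriv hx, Complex.mul_conj, Complex.normSq_eq_norm_sq]
    push_cast
    rw [← mul_assoc, Finset.mul_sum]
    congr 1
    refine Finset.sum_congr rfl fun j _ => ?_
    simp only [radialField]
    push_cast
    ring
  have e4 : ∑ j, ∑ k, (radialField χ k x : ℂ) * (magneticField A x k j : ℂ) * (Complex.I *
      ((starRingEnd ℂ) (w x) * p x j - w x * (starRingEnd ℂ) (p x j)))
      = 2 * χ (logSq x) * (((magneticDensity A w p x).im : ℝ) : ℂ) := by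
    have b1 : magneticDensity A w p x
        = ∑ j, ∑ k, (x k : ℂ) * (magneticField A x k j : ℂ)
          * (w x * (starRingEnd ℂ) (p x j)) := by
      rw [magneticDensity, Finset.mul_sum]
      refine Finset.sum_congr rfl fun j _ => ?_
      simp only [tangentialField, Matrix.vecMul, dotProduct]
      push_cast
      rw [Finset.sum_mul, Finset.mul_sum]
      refine Finset.sum_congr rfl fun k _ => ?_
      field_simp
    have b2 : ∀ z : ℂ, Complex.I * ((starRingEnd ℂ) z - z) = 2 * ((z.im : ℝ) : ℂ) := by
      intro z
      apply Complex.ext <;> simp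
      ring
    have b3 : 2 * (((magneticDensity A w p x).im : ℝ) : ℂ)
        = ∑ j, ∑ k, (x k : ℂ) * (magneticField A x k j : ℂ) * (Complex.I *
      ((starRingEnd ℂ) (w x) * p x j - w x * (starRingEnd ℂ) (p x j))) := by
      rw [← b2, b1]
      simp only [map_sum, map_mul, Complex.conj_ofReal, Complex.conj_conj]
      simp only [← Finset.sum_sub_distrib, Finset.mul_sum]
      exact Finset.sum_congr rfl fun j _ => Finset.sum_congr rfl fun k _ => by ring
    rw [mul_comm (2 : ℂ), mul_assoc, b3, Finset.mul_sum]
    refine Finset.sum_congr rfl fun j _ => ?_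
    rw [Finset.mul_sum]
    refine Finset.sum_congr rfl fun k _ => ?_
    simp only [radialField]
    push_cast
    ring
  rw [virialDensity, e1, e2, e3, e4, radialVirial, ← hS]
  push_cast
  ring

end Radial

/-! ### A bump function in the logarithmic variable. -/

section LogBump

/-- A smooth bump, equal to `1` on `[-1, 1]` and supported in `[-2, 2]`. -/
noncomputable def logBump (s : ℝ) : ℝ :=
  Real.smoothTransition (2 + s) * Real.smoothTransition (2 - s)

lemma contDiff_logBump : ContDiff ℝ ∞ logBump :=
  (Real.smoothTransition.contDiff.comp (contDiff_const.add contDiff_id)).mul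
    (Real.smoothTransition.contDiff.comp (contDiff_const.sub contDiff_id))

lemma logBump_nonneg (s : ℝ) : 0 ≤ logBump s :=
  mul_nonneg (Real.smoothTransition.nonneg _) (Real.smoothTransition.nonneg _)

lemma logBump_le_one (s : ℝ) : logBump s ≤ 1 :=
  mul_le_one₀ (Real.smoothTransition.le_one _) (Real.smoothTransition.nonneg _)
    (Real.smoothTransition.le_one _)

lemma logBump_eq_one {s : ℝ} (hs : |s| ≤ 1) : logBump s = 1 := by
  rw [abs_le] at hs
  rw [logBump, Real.smoothTransition.one_of_one_le (by linarith),
    Real.smoothTransition.one_of_one_le (by linarith), one_mul]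

lemma logBump_eq_zero {s : ℝ} (hs : 2 ≤ |s|) : logBump s = 0 := by
  rcases le_abs.1 hs with h | h
  · rw [logBump, Real.smoothTransition.zero_of_nonpos (x := 2 - s) (by linarith), mul_zero]
  · rw [logBump, Real.smoothTransition.zero_of_nonpos (x := 2 + s) (by linarith), zero_mul]

/-- To the left of `1` only the increasing factor is active. The Hardy inequality needs this sign on
the side of the origin. -/
lemma deriv_logBump_nonneg {s : ℝ} (hs : s ≤ 0) : 0 ≤ deriv logBump s := by
  have e : logBump =ᶠ[𝓝 s] fun s => Real.smoothTransition (2 + s) := by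
    filter_upwards [Iio_mem_nhds (show s < 1 by linarith)] with r hr
    rw [logBump, Real.smoothTransition.one_of_one_le (x := 2 - r) (by linarith [mem_Iio.1 hr]),
      mul_one]
  rw [e.deriv_eq]
  exact (Real.smoothTransition.monotone.comp (monotone_id.const_add 2)).deriv_nonneg

lemma deriv_logBump_eq_zero {s : ℝ} (hs : |s| < 1) : deriv logBump s = 0 ∧
    deriv (deriv logBump) s = 0 := by
  have e : logBump =ᶠ[𝓝 s] fun _ => 1 := by
    filter_upwards [(continuous_abs.isOpen_preimage _ isOpen_Iio).mem_nhds hs] with r hr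
    exact logBump_eq_one (le_of_lt hr)
  have e2 : deriv logBump =ᶠ[𝓝 s] fun _ => 0 := e.deriv.trans (.of_eq (by simp))
  exact ⟨e2.self_of_nhds, by rw [e2.deriv_eq]; simp⟩

lemma deriv_logBump_eq_zero' {s : ℝ} (hs : 2 < |s|) : deriv logBump s = 0 ∧
    deriv (deriv logBump) s = 0 := by
  have e : logBump =ᶠ[𝓝 s] fun _ => 0 := by
    filter_upwards [(continuous_abs.isOpen_preimage _ isOpen_Ioi).mem_nhds hs] with r hr
    exact logBump_eq_zero (le_of_lt hr)
  have e2 : deriv logBump =ᶠ[𝓝 s] fun _ => 0 := e.deriv.trans (.of_eq (by simp))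
  exact ⟨e2.self_of_nhds, by rw [e2.deriv_eq]; simp⟩

lemma exists_bound_deriv_logBump : ∃ C : ℝ, 0 ≤ C ∧ ∀ s, |deriv logBump s| ≤ C ∧
    |deriv (deriv logBump) s| ≤ C := by
  have hc : HasCompactSupport logBump := HasCompactSupport.intro (K := Icc (-2) 2) isCompact_Icc
    fun s hs => logBump_eq_zero (by
      by_contra h
      exact hs (abs_le.1 (not_le.1 h).le))
  have h1 := (contDiff_infty_iff_deriv.1 contDiff_logBump).2
  have h2 := (contDiff_infty_iff_deriv.1 h1).2
  obtain ⟨C, hC⟩ := h1.continuous.bounded_above_of_compact_support hc.deriv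
  obtain ⟨D, hD⟩ := h2.continuous.bounded_above_of_compact_support hc.deriv.deriv
  refine ⟨max C D, (norm_nonneg _).trans ((hC 0).trans (le_max_left _ _)), fun s => ⟨?_, ?_⟩⟩
  · exact (hC s).trans (le_max_left _ _)
  · exact (hD s).trans (le_max_right _ _)

end LogBump

/-! ### A logarithmic Hardy inequality. -/

section Hardy

variable {n : ℕ} {A : Space n → Space n}

lemma integral_norm_sq_eq {E : Type*} [NormedAddCommGroup E] [InnerProductSpace ℂ E]
    (f : Lp E 2 (volume : Measure (Space n))) : ∫ x, ‖f x‖ ^ 2 = ‖f‖ ^ 2 := by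
  have h : inner ℂ f f = ∫ x, inner ℂ (f x) (f x) := L2.inner_def f f
  simp only [inner_self_eq_norm_sq_to_K] at h
  have h2 : (((‖f‖ ^ 2 : ℝ)) : ℂ) = ((∫ x, ‖f x‖ ^ 2 : ℝ) : ℂ) := by
    rw [← integral_complex_ofReal]
    simpa using h
  exact_mod_cast h2.symm

lemma integrable_norm_sq {E : Type*} [NormedAddCommGroup E]
    (f : Lp E 2 (volume : Measure (Space n))) : Integrable (fun x => ‖f x‖ ^ 2) :=
  (Lp.memLp f).integrable_norm_pow (by norm_num)

lemma norm_sum_coord_mul_le (x : Space n) (p : EuclideanSpace ℂ (Fin n)) :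
    ‖∑ j, (x j : ℂ) * p j‖ ≤ ‖x‖ * ‖p‖ := by
  calc ‖∑ j, (x j : ℂ) * p j‖ ≤ ∑ j, ‖x j‖ * ‖p j‖ := by
        refine (norm_sum_le _ _).trans (le_of_eq (Finset.sum_congr rfl fun j _ => ?_))
        rw [norm_mul, Complex.norm_real]
    _ ≤ √(∑ j, ‖x j‖ ^ 2) * √(∑ j, ‖p j‖ ^ 2) := Real.sum_mul_le_sqrt_mul_sqrt _ _ _
    _ = ‖x‖ * ‖p‖ := by rw [EuclideanSpace.norm_eq, EuclideanSpace.norm_eq]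

lemma measurable_logSq : Measurable (logSq : Space n → ℝ) :=
  Real.measurable_log.comp (by fun_prop)

/-- The weight of the logarithmic Hardy inequality at scale `N`. -/
noncomputable def hardyWeight (N : ℝ) (x : Space n) : ℝ :=
  logBump (logSq x / N) ^ 2 / (N ^ 2 * ‖x‖ ^ 2)

lemma hardyWeight_nonneg (N : ℝ) (x : Space n) : 0 ≤ hardyWeight N x := by
  unfold hardyWeight
  positivity

lemma measurable_hardyWeight (N : ℝ) : Measurable (hardyWeight N : Space n → ℝ) :=
  (((contDiff_logBump.continuous.measurable.comp (measurable_logSq.div_const N)).pow_const 2).div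
    (by fun_prop))

lemma hardyWeight_le {N : ℝ} (hN : 1 ≤ N) (x : Space n) : hardyWeight N x ≤ Real.exp (2 * N) := by
  rcases eq_or_ne x 0 with rfl | hx
  · simp [hardyWeight, Real.exp_nonneg]
  unfold hardyWeight
  by_cases h : 2 ≤ |logSq x / N|
  · simp [logBump_eq_zero h, Real.exp_nonneg]
  have h1 : -(2 * N) ≤ logSq x := by
    have := (abs_lt.1 (not_le.1 h)).1
    rw [lt_div_iff₀ (by linarith)] at this
    linarith
  have h2 : (‖x‖ ^ 2)⁻¹ ≤ Real.exp (2 * N) := by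
    rw [← exp_neg_logSq hx]
    exact Real.exp_le_exp.2 (by linarith)
  have h3 : logBump (logSq x / N) ^ 2 ≤ 1 := pow_le_one₀ (logBump_nonneg _) (logBump_le_one _)
  have h4 : (N ^ 2)⁻¹ ≤ 1 := inv_le_one_of_one_le₀ (one_le_pow₀ hN)
  rw [div_eq_mul_inv, mul_inv]
  calc _ ≤ 1 * (1 * Real.exp (2 * N)) := by gcongr
    _ = _ := by ring

lemma integrable_hardyWeight_mul {N : ℝ} (hN : 1 ≤ N) (w : L2 n) :
    Integrable (fun x => hardyWeight N x * ‖w x‖ ^ 2) :=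
  (integrable_norm_sq w).bdd_mul (measurable_hardyWeight N).aestronglyMeasurable
    (.of_forall fun x => by
      rw [Real.norm_eq_abs, abs_of_nonneg (hardyWeight_nonneg N x)]
      exact hardyWeight_le hN x)

lemma ae_ne_zero (hn : 2 ≤ n) : ∀ᵐ x : Space n, x ≠ 0 := by
  have : Nonempty (Fin n) := ⟨⟨0, by omega⟩⟩
  exact Measure.ae_ne volume 0

/-- A logarithmic Hardy inequality, uniform in the scale `N`, for functions with magnetic
derivatives in `L²`. -/
theorem exists_hardy_const (hn : 2 ≤ n) (hA : ContDiffOn ℝ 1 A {0}ᶜ) :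
    ∃ C : ℝ, 0 ≤ C ∧ ∀ (N : ℝ), 1 ≤ N → ∀ (w h : L2 n) (p : L2Vec n),
      IsCovariantGradient A w p → IsFormSolution A p h →
      ∫ x, hardyWeight N x * ‖w x‖ ^ 2 ≤ C * (‖p‖ ^ 2 + ‖w‖ ^ 2) := by
  obtain ⟨D, hD0, hD⟩ := exists_bound_deriv_logBump
  -- The `25` is the square of `5`, the bound of `κ / b`, where `b` is the bump; `2 + 10 D` bounds
  -- `b² - κ'` on `s ≥ 0`.
  refine ⟨25 + 2 * (2 + 10 * D), by positivity, fun N hN w h p hp hh => ?_⟩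
  have hN0 : 0 < N := by linarith
  -- The shift by `3` keeps `σ + 3` between `1` and `5` on the support of the bump, so `κ ≥ 0`,
  -- while its slope one makes `κ'` reproduce the Hardy weight `logBump²`. The factor `exp(-s) =
  -- |x|⁻²` in `χ` makes the field behave like `x / |x|²`.
  let κ : ℝ → ℝ := fun σ => (σ + 3) * logBump σ ^ 2
  let χ : ℝ → ℝ := fun s => Real.exp (-s) * κ (s / N) / N
  have hκ : ContDiff ℝ ∞ κ := (contDiff_id.add contDiff_const).mul (contDiff_logBump.pow 2)
  have hχ : ContDiff ℝ ∞ χ :=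
    ((Real.contDiff_exp.comp contDiff_neg).mul (hκ.comp (contDiff_id.div_const N))).div_const N
  have hκd : ∀ σ, HasDerivAt κ (logBump σ ^ 2 + (σ + 3) * (2 * logBump σ * deriv logBump σ)) σ := by
    intro σ
    have h1 := (contDiff_logBump.differentiable (by simp) σ).hasDerivAt
    have h2 := ((hasDerivAt_id σ).add_const 3).mul (h1.pow 2)
    refine h2.congr_deriv ?_
    simp
  set κ' : ℝ → ℝ := fun σ => logBump σ ^ 2 + (σ + 3) * (2 * logBump σ * deriv logBump σ) with hκ'
  have hχd : ∀ s, deriv χ s = - χ s + Real.exp (-s) * κ' (s / N) / N ^ 2 := by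
    intro s
    have h1 : HasDerivAt (fun s => Real.exp (-s)) (-Real.exp (-s)) s := by
      simpa using (hasDerivAt_neg s).exp
    have h2 : HasDerivAt (fun s => κ (s / N)) (κ' (s / N) * (1 / N)) s :=
      HasDerivAt.comp (h₂ := κ) s (hκd (s / N)) ((hasDerivAt_id s).div_const N)
    have h3 : deriv χ s = _ := ((h1.mul h2).div_const N).deriv
    rw [h3]
    simp only [χ]
    field_simp
  have hR : ∀ s, 2 * N < |s| → χ s = 0 := by
    intro s hs
    have : 2 ≤ |s / N| := by
      rw [abs_div, abs_of_pos hN0, le_div_iff₀ hN0]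
      exact hs.le
    simp [χ, κ, logBump_eq_zero this]
  -- On the diagonal, antisymmetry says that `2 Re(conj w X · p) + (div X) |w|²` integrates to zero;
  -- the divergence is to dominate twice the weight.
  have key := integral_symOp_antisymm hA (X := radialField χ) (K := annulus n (2 * N))
    (fun k => (contDiff_radialField hχ hR k).of_le (by simp)) (isCompact_annulus _)
    (annulus_subset _) (tsupport_radialField hR) hp hh hp hh
  let g : Space n → ℝ := fun x =>
    2 * χ (logSq x) * ((starRingEnd ℂ) (w x) * ∑ j, (x j : ℂ) * p x j).re
      + (n * χ (logSq x) + 2 * deriv χ (logSq x)) * ‖w x‖ ^ 2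
  have eg : (fun x => (starRingEnd ℂ) (w x) * symOp (radialField χ) (fun k x => p x k) w x
      + (starRingEnd ℂ) (symOp (radialField χ) (fun k x => p x k) w x) * w x)
      =ᵐ[volume] fun x => (g x : ℂ) := by
    filter_upwards [ae_ne_zero hn] with x hx
    have a1 : ∀ z y : ℂ, (starRingEnd ℂ) z * y + (starRingEnd ℂ) y * z
        = 2 * ((((starRingEnd ℂ) z * y).re : ℝ) : ℂ) := by
      intro z y
      rw [← Complex.ofReal_ofNat 2, ← Complex.ofReal_mul, ← Complex.add_conj]
      simp [mul_comm]
    have a2 : symOp (radialField χ) (fun k x => p x k) w x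
        = (χ (logSq x) : ℂ) * (∑ j, (x j : ℂ) * p x j)
          + 1 / 2 * ((n * χ (logSq x) + 2 * deriv χ (logSq x) : ℝ) : ℂ) * w x := by
      rw [symOp, fieldDiv_radialField hχ hx, Finset.mul_sum]
      congr 1
      refine Finset.sum_congr rfl fun k _ => ?_
      simp only [radialField]
      push_cast
      ring
    have a3 : (starRingEnd ℂ) (w x) * symOp (radialField χ) (fun k x => p x k) w x
        = (χ (logSq x) : ℂ) * ((starRingEnd ℂ) (w x) * ∑ j, (x j : ℂ) * p x j)
          + (((1 / 2 * (n * χ (logSq x) + 2 * deriv χ (logSq x)) * ‖w x‖ ^ 2 : ℝ)) : ℂ) := by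
      have : ((‖w x‖ ^ 2 : ℝ) : ℂ) = w x * (starRingEnd ℂ) (w x) := by
        rw [Complex.mul_conj, Complex.normSq_eq_norm_sq]
      rw [a2, Complex.ofReal_mul _ (‖w x‖ ^ 2), this]
      push_cast
      ring
    rw [a1, a3, Complex.add_re, Complex.ofReal_re, Complex.re_ofReal_mul]
    simp only [g]
    push_cast
    ring
  have ig : Integrable g := by
    have := (key.1.congr eg).re
    exact this.congr (.of_forall fun x => by simp)
  have zg : ∫ x, g x = 0 := by
    have h1 := key.2
    rw [integral_congr_ae eg, integral_complex_ofReal] at h1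
    exact_mod_cast h1
  have hpt : ∀ᵐ x : Space n, hardyWeight N x * ‖w x‖ ^ 2
      ≤ g x + (25 * ‖p x‖ ^ 2 + 2 * (2 + 10 * D) * ‖w x‖ ^ 2) := by
    filter_upwards [ae_ne_zero hn] with x hx
    have hr : 0 < ‖x‖ := norm_pos_iff.2 hx
    set s := logSq x with hs
    set σ := s / N with hσ
    set b := logBump σ with hb
    have hb0 : 0 ≤ b := logBump_nonneg _
    have hb1 : b ≤ 1 := logBump_le_one _
    have he : Real.exp (-s) = (‖x‖ ^ 2)⁻¹ := exp_neg_logSq hx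
    have hy : hardyWeight N x = Real.exp (-s) * b ^ 2 / N ^ 2 := by
      rw [he, hardyWeight, ← hs, ← hσ, ← hb]
      field_simp
    have hbσ : b ≠ 0 → |σ| < 2 := by
      intro h0
      by_contra h1
      exact h0 (logBump_eq_zero (not_lt.1 h1))
    have hκ0 : 0 ≤ κ σ ∧ κ σ ≤ 5 * b := by
      by_cases h0 : b = 0
      · simp [κ, ← hb, h0]
      · have := abs_lt.1 (hbσ h0)
        simp only [κ, ← hb]
        constructor
        · exact mul_nonneg (by linarith) (by positivity)
        · nlinarith [mul_nonneg hb0 (sub_nonneg.2 hb1)]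
    have hχ0 : 0 ≤ χ s := by
      simp only [χ]
      have := hκ0.1
      positivity
    -- lower bound of the divergence
    have hdiv : 2 * hardyWeight N x - 2 * (2 + 10 * D) ≤ n * χ s + 2 * deriv χ s := by
      have hn' : (2 : ℝ) ≤ n := by exact_mod_cast hn
      -- Differentiating the exponential costs `-2χ`, which `n χ` absorbs because `n ≥ 2` and `χ ≥
      -- 0`; in the plane the two cancel exactly.
      have h1 : 2 * (Real.exp (-s) * κ' σ / N ^ 2) ≤ n * χ s + 2 * deriv χ s := by
        rw [hχd s]
        nlinarith [mul_nonneg (sub_nonneg.2 hn') hχ0]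
      refine le_trans ?_ h1
      rw [hy]
      have hE : 0 < Real.exp (-s) := Real.exp_pos _
      -- Inside the unit ball the weight is unbounded and `κ' ≥ b²` is needed; outside, `exp(-s) /
      -- N² ≤ 1`, so a bounded error suffices and is charged to `|w|²`.
      rcases le_total s 0 with h0 | h0
      · have hσ0 : σ ≤ 0 := div_nonpos_of_nonpos_of_nonneg h0 hN0.le
        have : b ^ 2 ≤ κ' σ := by
          simp only [hκ', ← hb]
          have hd := deriv_logBump_nonneg hσ0
          by_cases h2 : b = 0
          · simp [h2]
          · have := abs_lt.1 (hbσ h2)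
            have : 0 ≤ (σ + 3) * (2 * b * deriv logBump σ) :=
              mul_nonneg (by linarith) (by positivity)
            linarith
        have h3 : Real.exp (-s) * b ^ 2 / N ^ 2 ≤ Real.exp (-s) * κ' σ / N ^ 2 := by gcongr
        linarith
      · have h4 : |κ' σ| ≤ 1 + 10 * D := by
          by_cases h2 : b = 0
          · simp only [hκ', ← hb, h2]
            simp
            positivity
          · have h5 := abs_lt.1 (hbσ h2)
            have h6 : |σ + 3| ≤ 5 := by rw [abs_le]; constructor <;> linarith
            simp only [hκ', ← hb]
            calc _ ≤ |b ^ 2| + |σ + 3| * (2 * |b| * |deriv logBump σ|) := by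
                  refine (abs_add_le _ _).trans (le_of_eq ?_)
                  simp [abs_mul]
              _ ≤ 1 + 5 * (2 * 1 * D) := by
                  have := (hD σ).1
                  rw [abs_of_nonneg hb0, abs_of_nonneg (by positivity : 0 ≤ b ^ 2)]
                  have h7 : b ^ 2 ≤ 1 := pow_le_one₀ hb0 hb1
                  gcongr
              _ = _ := by ring
        have hE1 : Real.exp (-s) / N ^ 2 ≤ 1 := by
          rw [div_le_one (by positivity)]
          exact (Real.exp_le_one_iff.2 (by linarith)).trans (one_le_pow₀ hN)
        have hE0 : 0 ≤ Real.exp (-s) / N ^ 2 := by positivity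
        have h8 : b ^ 2 - κ' σ ≤ 2 + 10 * D := by
          have := (abs_le.1 h4).1
          have h7 : b ^ 2 ≤ 1 := pow_le_one₀ hb0 hb1
          linarith
        have h9 : Real.exp (-s) / N ^ 2 * (b ^ 2 - κ' σ) ≤ 2 + 10 * D := by
          have : 0 ≤ 2 + 10 * D := by positivity
          nlinarith
        have h10 : Real.exp (-s) / N ^ 2 * (b ^ 2 - κ' σ)
            = Real.exp (-s) * b ^ 2 / N ^ 2 - Real.exp (-s) * κ' σ / N ^ 2 := by ring
        linarith
    -- upper bound of the first order term
    have hfirst : |2 * χ s * ((starRingEnd ℂ) (w x) * ∑ j, (x j : ℂ) * p x j).re|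
        ≤ hardyWeight N x * ‖w x‖ ^ 2 + 25 * ‖p x‖ ^ 2 := by
      have h1 : |((starRingEnd ℂ) (w x) * ∑ j, (x j : ℂ) * p x j).re| ≤ ‖w x‖ * (‖x‖ * ‖p x‖) := by
        refine (Complex.abs_re_le_norm _).trans ?_
        rw [norm_mul, RCLike.norm_conj]
        gcongr
        exact norm_sum_coord_mul_le x (p x)
      have h2 : χ s * ‖x‖ ≤ 5 * (b / (N * ‖x‖)) := by
        have : χ s * ‖x‖ = κ σ / (N * ‖x‖) := by
          simp only [χ, ← hσ, he]
          field_simp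
        rw [this, mul_div_assoc']
        gcongr
        exact hκ0.2
      have h3 : hardyWeight N x = (b / (N * ‖x‖)) ^ 2 := by
        rw [hardyWeight, ← hs, ← hσ, ← hb]
        field_simp
      rw [abs_mul, abs_of_nonneg (by positivity : 0 ≤ 2 * χ s), h3]
      calc _ ≤ 2 * χ s * (‖w x‖ * (‖x‖ * ‖p x‖)) := by gcongr
        _ = 2 * (χ s * ‖x‖) * (‖w x‖ * ‖p x‖) := by ring
        _ ≤ 2 * (5 * (b / (N * ‖x‖))) * (‖w x‖ * ‖p x‖) := by gcongr
        _ ≤ _ := by nlinarith [sq_nonneg (b / (N * ‖x‖) * ‖w x‖ - 5 * ‖p x‖)]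
    have h1 := (abs_le.1 hfirst).1
    have h2 := mul_le_mul_of_nonneg_right hdiv (sq_nonneg ‖w x‖)
    simp only [g, ← hs]
    linarith
  have ip := integrable_norm_sq p
  have iw := integrable_norm_sq w
  have ipw : Integrable (fun x => 25 * ‖p x‖ ^ 2 + 2 * (2 + 10 * D) * ‖w x‖ ^ 2) :=
    (ip.const_mul _).add (iw.const_mul _)
  calc ∫ x, hardyWeight N x * ‖w x‖ ^ 2
      ≤ ∫ x, (g x + (25 * ‖p x‖ ^ 2 + 2 * (2 + 10 * D) * ‖w x‖ ^ 2)) :=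
        integral_mono_ae (integrable_hardyWeight_mul hN w)
          (ig.add ipw) hpt
    _ = 25 * ‖p‖ ^ 2 + 2 * (2 + 10 * D) * ‖w‖ ^ 2 := by
        rw [integral_add ig ipw, zg,
          integral_add (ip.const_mul _) (iw.const_mul _), integral_const_mul, integral_const_mul,
          integral_norm_sq_eq, integral_norm_sq_eq, zero_add]
    _ ≤ _ := by nlinarith [sq_nonneg ‖p‖, sq_nonneg ‖w‖]

end Hardy

/-! ### Pointwise bounds for the virial density with logarithmic cutoff. -/

section Limit

variable {n : ℕ} {A : Space n → Space n} {V : Space n → ℝ}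

/-- The logarithmic cutoff profile at scale `N`. -/
noncomputable def logCutoff (N : ℝ) (s : ℝ) : ℝ := logBump (s / N)

lemma contDiff_logCutoff (N : ℝ) : ContDiff ℝ ∞ (logCutoff N) :=
  contDiff_logBump.comp (contDiff_id.div_const N)

lemma logCutoff_eq_zero {N : ℝ} (hN : 0 < N) : ∀ s, 2 * N < |s| → logCutoff N s = 0 := by
  intro s hs
  refine logBump_eq_zero ?_
  rw [abs_div, abs_of_pos hN, le_div_iff₀ hN]
  exact hs.le

lemma logCutoff_nonneg (N s : ℝ) : 0 ≤ logCutoff N s := logBump_nonneg _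

lemma logCutoff_le_one (N s : ℝ) : logCutoff N s ≤ 1 := logBump_le_one _

lemma deriv_logCutoff (N : ℝ) : deriv (logCutoff N) = fun s => deriv logBump (s / N) / N := by
  ext s
  have h : HasDerivAt (logCutoff N) (deriv logBump (s / N) * (1 / N)) s :=
    HasDerivAt.comp (h₂ := logBump) s
      (contDiff_logBump.differentiable (by simp) _).hasDerivAt ((hasDerivAt_id s).div_const N)
  rw [h.deriv]
  ring

lemma deriv_deriv_logCutoff (N : ℝ) :
    deriv (deriv (logCutoff N)) = fun s => deriv (deriv logBump) (s / N) / N ^ 2 := by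
  rw [deriv_logCutoff]
  ext s
  have h1 := (contDiff_infty_iff_deriv.1 contDiff_logBump).2
  have h : HasDerivAt (fun s => deriv logBump (s / N) / N)
      (deriv (deriv logBump) (s / N) * (1 / N) / N) s :=
    (HasDerivAt.comp (h₂ := deriv logBump) s
      (h1.differentiable (by simp) _).hasDerivAt ((hasDerivAt_id s).div_const N)).div_const N
  rw [h.deriv]
  ring

/-- The part of `radialVirial` that has an integrable limit. -/
noncomputable def radialMain (A : Space n → Space n) (V : Space n → ℝ) (χ : ℝ → ℝ) (w : L2 n)
    (p : L2Vec n) (x : Space n) : ℝ :=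
  2 * χ (logSq x) * ‖p x‖ ^ 2
    + 4 * deriv χ (logSq x) / ‖x‖ ^ 2 * ‖∑ j, (x j : ℂ) * p x j‖ ^ 2
    - χ (logSq x) * electricDensity V w x
    + 2 * χ (logSq x) * (magneticDensity A w p x).im

/-- The part of `radialVirial` that comes from the derivative of the divergence. -/
noncomputable def radialTail (χ : ℝ → ℝ) (w : L2 n) (p : L2Vec n) (x : Space n) : ℝ :=
  (n * deriv χ (logSq x) + 2 * deriv (deriv χ) (logSq x)) * (2 / ‖x‖ ^ 2)
      * ((starRingEnd ℂ) (w x) * ∑ j, (x j : ℂ) * p x j).re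

lemma radialVirial_eq (χ : ℝ → ℝ) (w : L2 n) (p : L2Vec n) (x : Space n) :
    radialVirial A V χ w p x = radialMain A V χ w p x + radialTail χ w p x := by
  rw [radialVirial, radialMain, radialTail]
  ring

lemma aestronglyMeasurable_sum_coord (p : L2Vec n) :
    AEStronglyMeasurable (fun x : Space n => ∑ j, (x j : ℂ) * p x j) volume := by
  refine Finset.aestronglyMeasurable_fun_sum _ fun j _ => ?_
  have : Continuous fun x : Space n => (x j : ℂ) :=
    Complex.continuous_ofReal.comp (EuclideanSpace.proj j : Space n →L[ℝ] ℝ).continuous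
  exact this.aestronglyMeasurable.mul (memLp_component p j).1

lemma aestronglyMeasurable_comp_logSq {g : ℝ → ℝ} (hg : Continuous g) :
    AEStronglyMeasurable (fun x : Space n => g (logSq x)) volume :=
  (hg.measurable.comp measurable_logSq).aestronglyMeasurable

lemma continuous_deriv_logCutoff (N : ℝ) : Continuous (deriv (logCutoff N)) :=
  (contDiff_infty_iff_deriv.1 (contDiff_logCutoff N)).2.continuous

lemma continuous_deriv_deriv_logCutoff (N : ℝ) : Continuous (deriv (deriv (logCutoff N))) :=
  (contDiff_infty_iff_deriv.1 (contDiff_infty_iff_deriv.1 (contDiff_logCutoff N)).2).2.continuous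

lemma aestronglyMeasurable_radialMain {w : L2 n} {p : L2Vec n}
    (hE : Integrable (electricDensity V w)) (hM : Integrable (magneticDensity A w p)) (N : ℝ) :
    AEStronglyMeasurable (radialMain A V (logCutoff N) w p) volume := by
  have h1 := aestronglyMeasurable_comp_logSq (n := n) (contDiff_logCutoff N).continuous
  have h2 := aestronglyMeasurable_comp_logSq (n := n) (continuous_deriv_logCutoff N)
  have hx : AEStronglyMeasurable (fun x : Space n => (‖x‖ ^ 2)⁻¹) volume :=
    (by fun_prop : Measurable fun x : Space n => (‖x‖ ^ 2)⁻¹).aestronglyMeasurable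
  have hp := (Lp.memLp p).1.norm.pow 2
  refine ((((h1.const_mul 2).mul hp).add ?_).sub (h1.mul hE.1)).add ((h1.const_mul 2).mul hM.im.1)
  simp only [div_eq_mul_inv]
  exact ((h2.const_mul 4).mul hx).mul ((aestronglyMeasurable_sum_coord p).norm.pow 2)

lemma aestronglyMeasurable_radialTail (w : L2 n) (p : L2Vec n) (N : ℝ) :
    AEStronglyMeasurable (radialTail (logCutoff N) w p) volume := by
  have h2 := aestronglyMeasurable_comp_logSq (n := n) (continuous_deriv_logCutoff N)
  have h3 := aestronglyMeasurable_comp_logSq (n := n) (continuous_deriv_deriv_logCutoff N)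
  have hx : AEStronglyMeasurable (fun x : Space n => 2 / ‖x‖ ^ 2) volume :=
    (by fun_prop : Measurable fun x : Space n => 2 / ‖x‖ ^ 2).aestronglyMeasurable
  refine (((h2.const_mul _).add (h3.const_mul 2)).mul hx).mul ?_
  exact Complex.continuous_re.comp_aestronglyMeasurable
    ((Lp.memLp w).star.1.mul (aestronglyMeasurable_sum_coord p))

/-- A common bound of the first two derivatives of `logBump`. -/
noncomputable def logBumpBound : ℝ := exists_bound_deriv_logBump.choose

lemma logBumpBound_nonneg : 0 ≤ logBumpBound := exists_bound_deriv_logBump.choose_spec.1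

lemma abs_deriv_logCutoff_le {N : ℝ} (hN : 1 ≤ N) (s : ℝ) :
    |deriv (logCutoff N) s| ≤ logBumpBound / N ∧
      |deriv (deriv (logCutoff N)) s| ≤ logBumpBound / N := by
  have hN0 : 0 < N := by linarith
  have h := exists_bound_deriv_logBump.choose_spec.2 (s / N)
  rw [deriv_deriv_logCutoff, deriv_logCutoff, abs_div, abs_div, abs_of_pos hN0,
    abs_of_pos (by positivity : 0 < N ^ 2)]
  refine ⟨div_le_div_of_nonneg_right h.1 hN0.le, ?_⟩
  exact div_le_div₀ logBumpBound_nonneg h.2 hN0 (by nlinarith)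

/-- The bound is independent of `N`, so it serves as the dominating function. The term with `χ'` is
harmless because `|x · p|² ≤ |x|² |p|²`. -/
lemma abs_radialMain_le {N : ℝ} (hN : 1 ≤ N) (w : L2 n) (p : L2Vec n) (x : Space n) :
    |radialMain A V (logCutoff N) w p x| ≤ (2 + 4 * logBumpBound) * ‖p x‖ ^ 2
      + |electricDensity V w x| + 2 * ‖magneticDensity A w p x‖ := by
  have hD := logBumpBound_nonneg
  have c0 := logCutoff_nonneg N (logSq x)
  have c1 := logCutoff_le_one N (logSq x)
  have d1 : |deriv (logCutoff N) (logSq x)| ≤ logBumpBound :=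
    (abs_deriv_logCutoff_le hN _).1.trans (div_le_self hD hN)
  have hS : ‖∑ j, (x j : ℂ) * p x j‖ ^ 2 / ‖x‖ ^ 2 ≤ ‖p x‖ ^ 2 := by
    rcases eq_or_ne x 0 with rfl | hx
    · simp
    rw [div_le_iff₀ (by positivity)]
    calc _ ≤ (‖x‖ * ‖p x‖) ^ 2 := by gcongr; exact norm_sum_coord_mul_le _ _
      _ = _ := by ring
  have t1 : |2 * logCutoff N (logSq x) * ‖p x‖ ^ 2| ≤ 2 * ‖p x‖ ^ 2 := by
    rw [abs_of_nonneg (by positivity)]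
    nlinarith [sq_nonneg ‖p x‖]
  have t2 : |4 * deriv (logCutoff N) (logSq x) / ‖x‖ ^ 2 * ‖∑ j, (x j : ℂ) * p x j‖ ^ 2|
      ≤ 4 * logBumpBound * ‖p x‖ ^ 2 := by
    calc _ = 4 * |deriv (logCutoff N) (logSq x)|
          * (‖∑ j, (x j : ℂ) * p x j‖ ^ 2 / ‖x‖ ^ 2) := by
          rw [abs_mul, abs_div, abs_mul]
          simp
          ring
      _ ≤ _ := by gcongr
  have t3 : |logCutoff N (logSq x) * electricDensity V w x| ≤ |electricDensity V w x| := by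
    rw [abs_mul, abs_of_nonneg c0]
    exact mul_le_of_le_one_left (abs_nonneg _) c1
  have t4 : |2 * logCutoff N (logSq x) * (magneticDensity A w p x).im|
      ≤ 2 * ‖magneticDensity A w p x‖ := by
    rw [abs_mul, abs_of_nonneg (by positivity)]
    have := Complex.abs_im_le_norm (magneticDensity A w p x)
    calc _ ≤ 2 * 1 * ‖magneticDensity A w p x‖ := by gcongr
      _ = _ := by ring
  rw [radialMain]
  refine (abs_add_le _ _).trans ?_
  refine add_le_add ((abs_sub _ _).trans (add_le_add ((abs_add_le _ _).trans ?_) t3)) t4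
  linarith

/-- The derivatives of the cutoff live on `N ≤ |log|x|²| ≤ 2N` and are `O(1/N)`, so the density is
at most a constant times `|w| |p| / (N|x|)`. The inequality between means splits this, and the free
`δ` makes the part with `w` small. -/
lemma abs_radialTail_le {N : ℝ} (hN : 1 ≤ N) {δ : ℝ} (hδ : 0 < δ) (w : L2 n) (p : L2Vec n)
    {x : Space n} (hx : x ≠ 0) :
    |radialTail (logCutoff N) w p x| ≤ 2 * (n + 2) * logBumpBound *
      (δ * (hardyWeight (2 * N) x * ‖w x‖ ^ 2)
        + δ⁻¹ * ({y : Space n | N ≤ |logSq y|}.indicator (fun y => ‖p y‖ ^ 2) x)) := by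
  have hN0 : 0 < N := by linarith
  have hD := logBumpBound_nonneg
  have hr : 0 < ‖x‖ := norm_pos_iff.2 hx
  have hi : 0 ≤ {y : Space n | N ≤ |logSq y|}.indicator (fun y => ‖p y‖ ^ 2) x :=
    indicator_nonneg (fun _ _ => by positivity) x
  have hw := hardyWeight_nonneg (2 * N) x
  have key : ∀ h : deriv (logCutoff N) (logSq x) = 0 ∧ deriv (deriv (logCutoff N)) (logSq x) = 0,
      |radialTail (logCutoff N) w p x| ≤ 2 * (n + 2) * logBumpBound *
      (δ * (hardyWeight (2 * N) x * ‖w x‖ ^ 2)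
        + δ⁻¹ * ({y : Space n | N ≤ |logSq y|}.indicator (fun y => ‖p y‖ ^ 2) x)) := by
    rintro ⟨h1, h2⟩
    rw [radialTail, h1, h2]
    simp only [mul_zero, add_zero, zero_mul, abs_zero]
    positivity
  by_cases hlt : |logSq x| < N
  · have := deriv_logBump_eq_zero (s := logSq x / N)
      (by rwa [abs_div, abs_of_pos hN0, div_lt_one hN0])
    exact key (by rw [deriv_deriv_logCutoff, deriv_logCutoff]; simp [this])
  by_cases hgt : 2 * N < |logSq x|
  · have := deriv_logBump_eq_zero' (s := logSq x / N)
      (by rwa [abs_div, abs_of_pos hN0, lt_div_iff₀ hN0])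
    exact key (by rw [deriv_deriv_logCutoff, deriv_logCutoff]; simp [this])
  rw [indicator_of_mem (show x ∈ {y : Space n | N ≤ |logSq y|} from not_lt.1 hlt)]
  -- Scale `2N` instead of `N`: there the bump is identically one on the whole shell, so the Hardy
  -- weight is exactly `1/(2N|x|)²`.
  have hb : logBump (logSq x / (2 * N)) = 1 := logBump_eq_one (by
    rw [abs_div, abs_of_pos (by linarith : 0 < 2 * N), div_le_one (by linarith)]
    exact not_lt.1 hgt)
  have hwe : hardyWeight (2 * N) x = (1 / (2 * N * ‖x‖)) ^ 2 := by
    rw [hardyWeight, hb]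
    field_simp
  obtain ⟨d1, d2⟩ := abs_deriv_logCutoff_le hN (logSq x)
  have hc : |n * deriv (logCutoff N) (logSq x) + 2 * deriv (deriv (logCutoff N)) (logSq x)|
      ≤ (n + 2) * (logBumpBound / N) := by
    calc _ ≤ |n * deriv (logCutoff N) (logSq x)| + |2 * deriv (deriv (logCutoff N)) (logSq x)| :=
          abs_add_le _ _
      _ = n * |deriv (logCutoff N) (logSq x)| + 2 * |deriv (deriv (logCutoff N)) (logSq x)| := by
          rw [abs_mul, abs_mul]
          simp
      _ ≤ n * (logBumpBound / N) + 2 * (logBumpBound / N) := by gcongr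
      _ = _ := by ring
  have h1 : |((starRingEnd ℂ) (w x) * ∑ j, (x j : ℂ) * p x j).re| ≤ ‖w x‖ * (‖x‖ * ‖p x‖) := by
    refine (Complex.abs_re_le_norm _).trans ?_
    rw [norm_mul, RCLike.norm_conj]
    gcongr
    exact norm_sum_coord_mul_le x (p x)
  calc |radialTail (logCutoff N) w p x|
      ≤ (n + 2) * (logBumpBound / N) * (2 / ‖x‖ ^ 2) * (‖w x‖ * (‖x‖ * ‖p x‖)) := by
        rw [radialTail, abs_mul, abs_mul, abs_of_pos (by positivity : 0 < 2 / ‖x‖ ^ 2)]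
        gcongr
    _ = 2 * (n + 2) * logBumpBound * (2 * ((1 / (2 * N * ‖x‖)) * ‖w x‖ * ‖p x‖)) := by
        field_simp
    _ ≤ _ := by
        gcongr
        rw [hwe]
        have hsq := sq_nonneg (δ * ((1 / (2 * N * ‖x‖)) * ‖w x‖) - ‖p x‖)
        have : 2 * (1 / (2 * N * ‖x‖) * ‖w x‖ * ‖p x‖)
            = δ⁻¹ * (2 * (δ * ((1 / (2 * N * ‖x‖)) * ‖w x‖)) * ‖p x‖) := by
          field_simp
        rw [this]
        have h2 : δ * ((1 / (2 * N * ‖x‖)) ^ 2 * ‖w x‖ ^ 2)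
            = δ⁻¹ * (δ * ((1 / (2 * N * ‖x‖)) * ‖w x‖)) ^ 2 := by
          field_simp
        rw [h2, ← mul_add]
        gcongr
        linarith

end Limit

/-! ### Removal of the logarithmic cutoff. -/

section RadialLimit

variable {n : ℕ} {A : Space n → Space n} {V : Space n → ℝ}

lemma measurableSet_le_abs_logSq (N : ℝ) : MeasurableSet {x : Space n | N ≤ |logSq x|} :=
  measurableSet_le measurable_const measurable_logSq.abs

lemma integrable_radialMain {w : L2 n} {p : L2Vec n}
    (hE : Integrable (electricDensity V w)) (hM : Integrable (magneticDensity A w p))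
    {N : ℝ} (hN : 1 ≤ N) : Integrable (radialMain A V (logCutoff N) w p) := by
  have hb : Integrable (fun x => (2 + 4 * logBumpBound) * ‖p x‖ ^ 2
      + |electricDensity V w x| + 2 * ‖magneticDensity A w p x‖) :=
    (((integrable_norm_sq p).const_mul _).add hE.abs).add (hM.norm.const_mul 2)
  exact hb.mono' (aestronglyMeasurable_radialMain hE hM N)
    (.of_forall fun x => abs_radialMain_le hN w p x)

lemma integrable_tail_bound {N : ℝ} (hN : 1 ≤ N) (δ : ℝ) (w : L2 n) (p : L2Vec n) :
    Integrable (fun x => 2 * (n + 2) * logBumpBound *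
      (δ * (hardyWeight (2 * N) x * ‖w x‖ ^ 2)
        + δ⁻¹ * ({y : Space n | N ≤ |logSq y|}.indicator (fun y => ‖p y‖ ^ 2) x))) :=
  (((integrable_hardyWeight_mul (by linarith) w).const_mul δ).add
    (((integrable_norm_sq p).indicator (measurableSet_le_abs_logSq N)).const_mul δ⁻¹)).const_mul _

lemma integrable_radialTail (hn : 2 ≤ n) {N : ℝ} (hN : 1 ≤ N) (w : L2 n) (p : L2Vec n) :
    Integrable (radialTail (logCutoff N) w p) :=
  (integrable_tail_bound hN 1 w p).mono' (aestronglyMeasurable_radialTail w p N) (by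
    filter_upwards [ae_ne_zero hn] with x hx using abs_radialTail_le hN one_pos w p hx)

/-- With `δ = 1` this is a bound uniform in `N`. For the limit, `δ` is fixed while `N → ∞`, which
removes the second term, and is then taken small. -/
lemma exists_abs_integral_radialTail_le (hn : 2 ≤ n) (hA : ContDiffOn ℝ 1 A {0}ᶜ) :
    ∃ C : ℝ, 0 ≤ C ∧ ∀ (N : ℝ), 1 ≤ N → ∀ (w h : L2 n) (p : L2Vec n),
      IsCovariantGradient A w p → IsFormSolution A p h → ∀ δ : ℝ, 0 < δ →
      |∫ x, radialTail (logCutoff N) w p x| ≤ δ * (C * (‖p‖ ^ 2 + ‖w‖ ^ 2))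
        + δ⁻¹ * (C * ∫ x, {y : Space n | N ≤ |logSq y|}.indicator (fun y => ‖p y‖ ^ 2) x) := by
  obtain ⟨C, hC0, hC⟩ := exists_hardy_const hn hA
  have hD := logBumpBound_nonneg
  refine ⟨2 * (n + 2) * logBumpBound * (C + 1), by positivity, fun N hN w h p hp hh δ hδ => ?_⟩
  set J := ∫ x, {y : Space n | N ≤ |logSq y|}.indicator (fun y => ‖p y‖ ^ 2) x with hJ
  have hJ0 : 0 ≤ J := integral_nonneg fun x => indicator_nonneg (fun _ _ => by positivity) x
  have i1 := (integrable_hardyWeight_mul (show 1 ≤ 2 * N by linarith) w).const_mul δ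
  have i2 := ((integrable_norm_sq p).indicator (measurableSet_le_abs_logSq N)).const_mul δ⁻¹
  have hw := hC (2 * N) (by linarith) w h p hp hh
  calc |∫ x, radialTail (logCutoff N) w p x| ≤ ∫ x, |radialTail (logCutoff N) w p x| :=
        abs_integral_le_integral_abs
    _ ≤ ∫ x, 2 * (n + 2) * logBumpBound *
      (δ * (hardyWeight (2 * N) x * ‖w x‖ ^ 2)
        + δ⁻¹ * ({y : Space n | N ≤ |logSq y|}.indicator (fun y => ‖p y‖ ^ 2) x)) := by
        refine integral_mono_ae (integrable_radialTail hn hN w p).abs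
          (integrable_tail_bound hN δ w p) ?_
        filter_upwards [ae_ne_zero hn] with x hx using abs_radialTail_le hN hδ w p hx
    _ = 2 * (n + 2) * logBumpBound *
      (δ * (∫ x, hardyWeight (2 * N) x * ‖w x‖ ^ 2) + δ⁻¹ * J) := by
        rw [integral_const_mul, integral_add i1 i2, integral_const_mul, integral_const_mul]
    _ ≤ 2 * (n + 2) * logBumpBound *
      (δ * ((C + 1) * (‖p‖ ^ 2 + ‖w‖ ^ 2)) + δ⁻¹ * ((C + 1) * J)) := by
        gcongr
        · exact hw.trans (by gcongr; linarith)
        · nlinarith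
    _ = _ := by ring

/-- A bound of the virial integral, uniform in the cutoff. -/
lemma exists_abs_integral_radialVirial_le (hn : 2 ≤ n) (hA : ContDiffOn ℝ 1 A {0}ᶜ) :
    ∃ C : ℝ, 0 ≤ C ∧ ∀ (N : ℝ), 1 ≤ N → ∀ (w h : L2 n) (p : L2Vec n),
      IsCovariantGradient A w p → IsFormSolution A p h →
      Integrable (electricDensity V w) → Integrable (magneticDensity A w p) →
      |∫ x, radialVirial A V (logCutoff N) w p x| ≤ C * (‖p‖ ^ 2 + ‖w‖ ^ 2)
        + (∫ x, |electricDensity V w x|) + 2 * ∫ x, ‖magneticDensity A w p x‖ := by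
  obtain ⟨C, hC0, hC⟩ := exists_abs_integral_radialTail_le hn hA
  have hD := logBumpBound_nonneg
  refine ⟨2 + 4 * logBumpBound + 2 * C, by positivity, fun N hN w h p hp hh hE hM => ?_⟩
  have ht := hC N hN w h p hp hh 1 one_pos
  have hJ : ∫ x, {y : Space n | N ≤ |logSq y|}.indicator (fun y => ‖p y‖ ^ 2) x ≤ ‖p‖ ^ 2 := by
    rw [← integral_norm_sq_eq]
    exact integral_mono ((integrable_norm_sq p).indicator (measurableSet_le_abs_logSq N))
      (integrable_norm_sq p) fun x => indicator_le_self' (fun _ _ => by positivity) x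
  have j1 := ((integrable_norm_sq p).const_mul (2 + 4 * logBumpBound))
  have j2 : Integrable (fun x => (2 + 4 * logBumpBound) * ‖p x‖ ^ 2
      + |electricDensity V w x|) := j1.add hE.abs
  have hm : |∫ x, radialMain A V (logCutoff N) w p x| ≤ (2 + 4 * logBumpBound) * ‖p‖ ^ 2
      + (∫ x, |electricDensity V w x|) + 2 * ∫ x, ‖magneticDensity A w p x‖ := by
    calc _ ≤ ∫ x, |radialMain A V (logCutoff N) w p x| := abs_integral_le_integral_abs
      _ ≤ ∫ x, ((2 + 4 * logBumpBound) * ‖p x‖ ^ 2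
          + |electricDensity V w x| + 2 * ‖magneticDensity A w p x‖) :=
        integral_mono (integrable_radialMain hE hM hN).abs (j2.add (hM.norm.const_mul 2))
          fun x => abs_radialMain_le hN w p x
      _ = _ := by
        rw [integral_add j2 (hM.norm.const_mul 2), integral_add j1 hE.abs, integral_const_mul,
          integral_const_mul, integral_norm_sq_eq]
  simp only [radialVirial_eq]
  rw [integral_add (integrable_radialMain hE hM hN) (integrable_radialTail hn hN w p)]
  refine (abs_add_le _ _).trans ((add_le_add hm ht).trans ?_)
  have := mul_le_mul_of_nonneg_left hJ hC0
  simp only [one_mul, inv_one]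
  nlinarith [mul_nonneg hD (sq_nonneg ‖w‖), mul_nonneg hC0 (sq_nonneg ‖w‖), sq_nonneg ‖w‖]

lemma eventually_abs_logSq_lt (x : Space n) : ∀ᶠ m : ℕ in atTop, |logSq x| < (m : ℝ) + 1 := by
  obtain ⟨k, hk⟩ := exists_nat_gt |logSq x|
  filter_upwards [eventually_ge_atTop k] with m hm
  have : (k : ℝ) ≤ m := by exact_mod_cast hm
  linarith

lemma logCutoff_of_abs_lt {N s : ℝ} (h : |s| < N) : logCutoff N s = 1 ∧
    deriv (logCutoff N) s = 0 := by
  have hN : 0 < N := (abs_nonneg s).trans_lt h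
  have h1 : |s / N| < 1 := by rwa [abs_div, abs_of_pos hN, div_lt_one hN]
  exact ⟨logBump_eq_one h1.le, by rw [deriv_logCutoff]; simp [(deriv_logBump_eq_zero h1).1]⟩

lemma tendsto_zero_of_abs_le_add {a b : ℕ → ℝ} {K : ℝ} (hb : Tendsto b atTop (𝓝 0))
    (h : ∀ δ : ℝ, 0 < δ → ∀ m, |a m| ≤ δ * K + δ⁻¹ * b m) : Tendsto a atTop (𝓝 0) := by
  rw [Metric.tendsto_nhds]
  intro ε hε
  -- Makes the first term at most `ε/2`; the added `1` covers `K = 0`.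
  let δ := ε / (2 * (|K| + 1))
  have hδ : 0 < δ := by positivity
  have h1 : ∀ᶠ m in atTop, δ⁻¹ * b m < ε / 2 := by
    have : Tendsto (fun m => δ⁻¹ * b m) atTop (𝓝 0) := by simpa using hb.const_mul δ⁻¹
    exact this.eventually (gt_mem_nhds (by positivity))
  filter_upwards [h1] with m hm
  rw [Real.dist_eq, sub_zero]
  have h2 : δ * K ≤ ε / 2 := by
    have : δ * (|K| + 1) = ε / 2 := by
      simp only [δ]
      field_simp
    nlinarith [le_abs_self K]
  linarith [h δ hδ m]

/-- The virial integrals with logarithmic cutoffs converge to the right side of the virial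
identity. -/
lemma tendsto_integral_radialVirial (hn : 2 ≤ n) (hA : ContDiffOn ℝ 1 A {0}ᶜ) {w h : L2 n}
    {p : L2Vec n} (hp : IsCovariantGradient A w p) (hh : IsFormSolution A p h)
    (hE : Integrable (electricDensity V w)) (hM : Integrable (magneticDensity A w p)) :
    Tendsto (fun m : ℕ => ∫ x, radialVirial A V (logCutoff (m + 1)) w p x) atTop
      (𝓝 (virialRHS A V w p / 4)) := by
  have h1m : ∀ m : ℕ, (1 : ℝ) ≤ m + 1 := fun m => by
    have : (0 : ℝ) ≤ m := Nat.cast_nonneg m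
    linarith
  have ip := integrable_norm_sq p
  have main : Tendsto (fun m : ℕ => ∫ x, radialMain A V (logCutoff (m + 1)) w p x) atTop
      (𝓝 (∫ x, (2 * ‖p x‖ ^ 2 - electricDensity V w x + 2 * (magneticDensity A w p x).im))) := by
    have hb : Integrable (fun x => (2 + 4 * logBumpBound) * ‖p x‖ ^ 2
        + |electricDensity V w x| + 2 * ‖magneticDensity A w p x‖) :=
      ((ip.const_mul _).add hE.abs).add (hM.norm.const_mul 2)
    refine tendsto_integral_of_dominated_convergence _
      (fun m => aestronglyMeasurable_radialMain hE hM _) hb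
      (fun m => .of_forall fun x => abs_radialMain_le (h1m m) w p x) (.of_forall fun x => ?_)
    refine tendsto_const_nhds.congr' ?_
    filter_upwards [eventually_abs_logSq_lt x] with m hm
    obtain ⟨e1, e2⟩ := logCutoff_of_abs_lt hm
    rw [radialMain, e1, e2]
    ring
  have tail : Tendsto (fun m : ℕ => ∫ x, radialTail (logCutoff (m + 1)) w p x) atTop (𝓝 0) := by
    obtain ⟨C, hC0, hC⟩ := exists_abs_integral_radialTail_le hn hA
    have hJ : Tendsto (fun m : ℕ => C * ∫ x, {y : Space n | (m : ℝ) + 1 ≤ |logSq y|}.indicator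
        (fun y => ‖p y‖ ^ 2) x) atTop (𝓝 0) := by
      have : Tendsto (fun m : ℕ => ∫ x, {y : Space n | (m : ℝ) + 1 ≤ |logSq y|}.indicator
          (fun y => ‖p y‖ ^ 2) x) atTop (𝓝 (∫ _ : Space n, (0 : ℝ))) := by
        refine tendsto_integral_of_dominated_convergence (fun x => ‖p x‖ ^ 2)
          (fun m => (ip.indicator (measurableSet_le_abs_logSq _)).1) ip
          (fun m => .of_forall fun x => ?_) (.of_forall fun x => ?_)
        · rw [Real.norm_eq_abs, abs_of_nonneg (indicator_nonneg (fun _ _ => by positivity) x)]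
          exact indicator_le_self' (fun _ _ => by positivity) x
        · refine tendsto_const_nhds.congr' ?_
          filter_upwards [eventually_abs_logSq_lt x] with m hm
          rw [indicator_of_notMem]
          simpa using hm
      simpa using this.const_mul C
    exact tendsto_zero_of_abs_le_add hJ fun δ hδ m => hC _ (h1m m) w h p hp hh δ hδ
  have e : virialRHS A V w p / 4
      = (∫ x, (2 * ‖p x‖ ^ 2 - electricDensity V w x + 2 * (magneticDensity A w p x).im)) + 0 := by
    have i1 : Integrable (fun x => 2 * ‖p x‖ ^ 2 - electricDensity V w x) :=
      (ip.const_mul 2).sub hE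
    have i2 : Integrable (fun x => (magneticDensity A w p x).im) := hM.im
    have hi : ∫ x, (magneticDensity A w p x).im = (∫ x, magneticDensity A w p x).im :=
      integral_im hM
    rw [integral_add i1 (i2.const_mul 2), integral_sub (ip.const_mul 2) hE, integral_const_mul,
      integral_const_mul, hi, virialRHS]
    ring
  rw [e]
  refine (main.add tail).congr fun m => ?_
  simp only [radialVirial_eq]
  rw [integral_add (integrable_radialMain hE hM (h1m m)) (integrable_radialTail hn (h1m m) w p)]

/-- The virial identity for the radial fields with logarithmic cutoff. -/
lemma integral_pairing_eq_integral_radialVirial (hn : 2 ≤ n) (hA : ContDiffOn ℝ 1 A {0}ᶜ)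
    (hV : ContDiffOn ℝ 1 V {0}ᶜ) {N : ℝ} (hN : 1 ≤ N) {w h : L2 n} {p : L2Vec n}
    (hp : IsCovariantGradient A w p) (hh : IsFormSolution A p h) :
    ∫ x, pairingDensity V (radialField (logCutoff N)) (fun k x => p x k) w h x
      = ((∫ x, radialVirial A V (logCutoff N) w p x : ℝ) : ℂ) := by
  have hR := logCutoff_eq_zero (show 0 < N by linarith)
  rw [(integral_pairing_eq_integral_virial hA hV
    (fun k => contDiff_infty.1 (contDiff_radialField (contDiff_logCutoff N) hR k) 2)
    (isCompact_annulus (2 * N)) (annulus_subset _) (tsupport_radialField hR) hp hh).2,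
    ← integral_complex_ofReal]
  refine integral_congr_ae ?_
  filter_upwards [ae_ne_zero hn] with x hx
  exact virialDensity_radialField (contDiff_logCutoff N) w p hx

end RadialLimit

/-! ### Form domain, Kato–Rellich bound and continuity in time of the gradient. -/

section Operator

variable {n : ℕ} {A : Space n → Space n} {V : Space n → ℝ}

lemma aestronglyMeasurable_potential (hn : 2 ≤ n) (hA : ContDiffOn ℝ 1 A {0}ᶜ) :
    AEStronglyMeasurable A volume := by
  have h : AEStronglyMeasurable A (volume.restrict ({0}ᶜ : Set (Space n))) :=
    hA.continuousOn.aestronglyMeasurable isOpen_compl_singleton.measurableSet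
  rwa [Measure.restrict_eq_self_of_ae_mem] at h
  filter_upwards [ae_ne_zero hn] with x hx using hx

/-- Local square integrability of `A` enters here: it makes `w A φ` integrable for test functions
that do not vanish at the origin, without which covariant gradients could not be subtracted. -/
lemma memLp_potential_mul (hn : 2 ≤ n) (hA : ContDiffOn ℝ 1 A {0}ᶜ)
    (hA2 : LocallyIntegrable (fun x => ‖A x‖ ^ 2)) {φ : Space n → ℂ} (hφ : Continuous φ)
    (hφc : HasCompactSupport φ) (j : Fin n) : MemLp (fun x => (A x j : ℂ) * φ x) 2 volume := by
  have hm : AEStronglyMeasurable (fun x => (A x j : ℂ) * φ x) volume :=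
    ((Complex.continuous_ofReal.comp (EuclideanSpace.proj j : Space n →L[ℝ] ℝ).continuous
      ).comp_aestronglyMeasurable (aestronglyMeasurable_potential hn hA)).mul
      hφ.aestronglyMeasurable
  rw [memLp_two_iff_integrable_sq_norm hm]
  have hi := hA2.integrable_smul_left_of_hasCompactSupport (g := fun x => ‖φ x‖ ^ 2)
    (hφ.norm.pow 2) (hφc.comp_left (g := fun z : ℂ => ‖z‖ ^ 2) (by simp))
  refine hi.mono' (hm.norm.pow 2) (.of_forall fun x => ?_)
  have : |A x j| ≤ ‖A x‖ := PiLp.norm_apply_le (A x) j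
  rw [norm_mul, Complex.norm_real, Real.norm_eq_abs, Real.norm_eq_abs,
    abs_of_nonneg (by positivity),
    smul_eq_mul, mul_pow, mul_comm]
  gcongr

lemma integrable_mul_test (hn : 2 ≤ n) (hA : ContDiffOn ℝ 1 A {0}ᶜ)
    (hA2 : LocallyIntegrable (fun x => ‖A x‖ ^ 2)) (w : L2 n) {φ : Space n → ℂ}
    (hφ : ContDiff ℝ ∞ φ) (hφc : HasCompactSupport φ) (j : Fin n) :
    Integrable (fun x => w x * (fderiv ℝ φ x (basisVec j) + Complex.I * (A x j : ℂ) * φ x)) := by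
  have h1 : MemLp (pd j φ) 2 volume :=
    (continuous_pd (hφ.of_le (by simp)) j).memLp_of_hasCompactSupport (HasCompactSupport.pd hφc j)
  have h2 := (memLp_potential_mul hn hA hA2 hφ.continuous hφc j).const_mul Complex.I
  have h3 : MemLp (fun x => fderiv ℝ φ x (basisVec j) + Complex.I * (A x j : ℂ) * φ x) 2 volume :=
    (h1.add h2).ae_eq (.of_forall fun x => by simp [pd, mul_assoc])
  exact memLp_one_iff_integrable.1 (h3.mul' (Lp.memLp w))

lemma IsCovariantGradient.unique {w : L2 n} {p q : L2Vec n} (hp : IsCovariantGradient A w p)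
    (hq : IsCovariantGradient A w q) : p = q := by
  have h : ∀ j, ∀ᵐ x, p x j = q x j := by
    intro j
    refine ae_eq_of_integral_contDiff_smul_eq
      (locallyIntegrable_of_memLp_two (memLp_component p j))
      (locallyIntegrable_of_memLp_two (memLp_component q j)) fun g hg hgc => ?_
    have hc : HasCompactSupport fun x => ((g x : ℝ) : ℂ) :=
      hgc.comp_left (g := fun r : ℝ => (r : ℂ)) (by simp)
    have e := (hp _ (Complex.ofRealCLM.contDiff.comp hg) hc j).symm.trans
      (hq _ (Complex.ofRealCLM.contDiff.comp hg) hc j)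
    have e2 := neg_injective e
    simpa [mul_comm] using e2
  refine Lp.ext ?_
  filter_upwards [ae_all_iff.2 h] with x hx
  ext j
  exact hx j

lemma IsCovariantGradient.sub (hn : 2 ≤ n) (hA : ContDiffOn ℝ 1 A {0}ᶜ)
    (hA2 : LocallyIntegrable (fun x => ‖A x‖ ^ 2)) {w v : L2 n} {p q : L2Vec n}
    (hp : IsCovariantGradient A w p) (hq : IsCovariantGradient A v q) :
    IsCovariantGradient A (w - v) (p - q) := by
  intro φ hφ hφc j
  have i1 := integrable_mul_test hn hA hA2 w hφ hφc j
  have i2 := integrable_mul_test hn hA hA2 v hφ hφc j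
  have i3 := integrable_mul_of_continuous (memLp_component p j) hφ.continuous hφc
  have i4 := integrable_mul_of_continuous (memLp_component q j) hφ.continuous hφc
  calc _ = ∫ x, (w x * (fderiv ℝ φ x (basisVec j) + Complex.I * (A x j : ℂ) * φ x)
        - v x * (fderiv ℝ φ x (basisVec j) + Complex.I * (A x j : ℂ) * φ x)) := by
        refine integral_congr_ae ?_
        filter_upwards [Lp.coeFn_sub w v] with x hx
        rw [hx, Pi.sub_apply, sub_mul]
    _ = - ∫ x, (p x j * φ x - q x j * φ x) := by
        rw [integral_sub i1 i2, integral_sub i3 i4, hp φ hφ hφc j, hq φ hφ hφc j]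
        ring
    _ = _ := by
        congr 1
        refine integral_congr_ae ?_
        filter_upwards [Lp.coeFn_sub p q] with x hx
        rw [hx, Pi.sub_apply, PiLp.sub_apply, sub_mul]

lemma IsFormSolution.sub {p q : L2Vec n} {g h : L2 n} (hp : IsFormSolution A p g)
    (hq : IsFormSolution A q h) : IsFormSolution A (p - q) (g - h) := by
  intro v r hr
  rw [inner_sub_right, inner_sub_right, hp v r hr, hq v r hr]

/-- The form equation tested with `w` itself. -/
lemma IsFormSolution.norm_sq_le {w h : L2 n} {p : L2Vec n} (hp : IsCovariantGradient A w p)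
    (hh : IsFormSolution A p h) : ‖p‖ ^ 2 ≤ ‖w‖ * ‖h‖ := by
  have e := hh w p hp
  have h1 : ‖p‖ ^ 2 = (inner ℂ p p).re := by
    rw [inner_self_eq_norm_sq_to_K]
    norm_cast
  rw [h1, e]
  exact (Complex.re_le_norm _).trans (norm_inner_le_norm _ _)

/-- The graph norm of `H_A` is controlled by that of `H_A + V`. -/
lemma exists_kato_rellich_bound (hKR : IsKatoRellich A V) :
    ∃ B : ℝ, 0 ≤ B ∧ ∀ (w h k : L2 n) (p : L2Vec n), IsCovariantGradient A w p →
      IsFormSolution A p h → (∀ᵐ x, k x = h x + (V x : ℂ) * w x) →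
      ‖h‖ ≤ B * (‖k‖ + ‖w‖) := by
  obtain ⟨ε, C, hε, -, hKR⟩ := hKR
  refine ⟨ε⁻¹ * (1 + |C|), by positivity, fun w h k p hp hh hk => ?_⟩
  obtain ⟨v, hv, hb⟩ := hKR w h ⟨p, hp, hh⟩
  have e : k = h + v := by
    refine Lp.ext ?_
    filter_upwards [hk, hv, Lp.coeFn_add h v] with x h1 h2 h3
    rw [h3, Pi.add_apply, h1, h2]
  have h1 : ‖h‖ ≤ ‖k‖ + ‖v‖ := by
    have : h = k - v := by rw [e, add_sub_cancel_right]
    rw [this]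
    exact norm_sub_le _ _
  -- Relative bound `1 - ε < 1`: the part of `‖V w‖` proportional to `‖h‖` is absorbed on the left.
  have h2 : ε * ‖h‖ ≤ (1 + |C|) * (‖k‖ + ‖w‖) := by
    nlinarith [le_abs_self C, norm_nonneg w, norm_nonneg k, abs_nonneg C,
      mul_nonneg (abs_nonneg C) (norm_nonneg k),
      mul_le_mul_of_nonneg_right (le_abs_self C) (norm_nonneg w)]
  calc ‖h‖ = ε⁻¹ * (ε * ‖h‖) := by field_simp
    _ ≤ ε⁻¹ * ((1 + |C|) * (‖k‖ + ‖w‖)) := by gcongr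
    _ = _ := by ring

/-- The covariant gradient depends continuously on time along a solution. -/
lemma continuous_covariantGradient (hn : 2 ≤ n) (hA : ContDiffOn ℝ 1 A {0}ᶜ)
    (hA2 : LocallyIntegrable (fun x => ‖A x‖ ^ 2)) (hKR : IsKatoRellich A V)
    {u h k : ℝ → L2 n} {p : ℝ → L2Vec n} (hu : Continuous u) (hk : Continuous k)
    (hp : ∀ t, IsCovariantGradient A (u t) (p t)) (hh : ∀ t, IsFormSolution A (p t) (h t))
    (hkh : ∀ t, ∀ᵐ x, k t x = h t x + (V x : ℂ) * u t x) : Continuous p := by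
  obtain ⟨B, hB0, hB⟩ := exists_kato_rellich_bound hKR
  -- The differences again satisfy the linear equations, so the energy bound and the Kato–Rellich
  -- bound apply to them.
  have key : ∀ t s, ‖p t - p s‖ ^ 2 ≤ ‖u t - u s‖ * (B * (‖k t - k s‖ + ‖u t - u s‖)) := by
    intro t s
    have hp' := (hp t).sub hn hA hA2 (hp s)
    have hh' := (hh t).sub (hh s)
    refine (hh'.norm_sq_le hp').trans ?_
    gcongr
    refine hB _ _ _ _ hp' hh' ?_
    filter_upwards [hkh t, hkh s, Lp.coeFn_sub (k t) (k s), Lp.coeFn_sub (h t) (h s),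
      Lp.coeFn_sub (u t) (u s)] with x h1 h2 h3 h4 h5
    rw [h3, h4, h5, Pi.sub_apply, Pi.sub_apply, Pi.sub_apply, h1, h2]
    ring
  rw [continuous_iff_continuousAt]
  intro s
  rw [ContinuousAt, tendsto_iff_norm_sub_tendsto_zero]
  have h1 : Tendsto (fun t => ‖u t - u s‖ * (B * (‖k t - k s‖ + ‖u t - u s‖))) (𝓝 s) (𝓝 0) := by
    have : Continuous fun t => ‖u t - u s‖ * (B * (‖k t - k s‖ + ‖u t - u s‖)) := by fun_prop
    have := this.tendsto s
    simpa using this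
  have h2 := squeeze_zero (fun t => sq_nonneg _) (fun t => key t s) h1
  have h3 := (Real.continuous_sqrt.tendsto 0).comp h2
  simpa [Function.comp_def, Real.sqrt_sq] using h3

end Operator

/-! ### Multiplication operators and differentiation of antisymmetric pairings. -/

section Multiplier

variable {n : ℕ} {E F : Type*} [NormedAddCommGroup E] [NormedSpace ℂ E] [NormedAddCommGroup F]
  [NormedSpace ℂ F]

/-- A bounded measurable field of operators acts on `L²`. -/
lemma exists_multiplier {c : Space n → E →L[ℂ] F} (hc : AEStronglyMeasurable c volume) {B : ℝ}
    (hB : ∀ x, ‖c x‖ ≤ B) :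
    ∃ T : Lp E 2 (volume : Measure (Space n)) →L[ℂ] Lp F 2 (volume : Measure (Space n)),
      ∀ f, ∀ᵐ x, T f x = c x (f x) := by
  have hm : ∀ f : Lp E 2 (volume : Measure (Space n)), MemLp (fun x => c x (f x)) 2 volume := by
    intro f
    refine (Lp.memLp f).of_le_mul (c := B) ?_ (.of_forall fun x => (c x).le_of_opNorm_le (hB x) _)
    exact isBoundedBilinearMap_apply.continuous.comp_aestronglyMeasurable (hc.prodMk (Lp.memLp f).1)
  let T : Lp E 2 (volume : Measure (Space n)) →ₗ[ℂ] Lp F 2 (volume : Measure (Space n)) :=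
    { toFun := fun f => (hm f).toLp _
      map_add' := fun f g => by
        refine Lp.ext ?_
        filter_upwards [(hm (f + g)).coeFn_toLp, Lp.coeFn_add ((hm f).toLp _) ((hm g).toLp _),
          (hm f).coeFn_toLp, (hm g).coeFn_toLp, Lp.coeFn_add f g] with x h1 h2 h3 h4 h5
        rw [h1, h2, Pi.add_apply, h3, h4, h5, Pi.add_apply, map_add]
      map_smul' := fun a f => by
        refine Lp.ext ?_
        filter_upwards [(hm (a • f)).coeFn_toLp, Lp.coeFn_smul a ((hm f).toLp _),
          (hm f).coeFn_toLp, Lp.coeFn_smul a f] with x h1 h2 h3 h4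
        rw [h1, RingHom.id_apply, h2, Pi.smul_apply, h3, h4, Pi.smul_apply, map_smul] }
  refine ⟨T.mkContinuous B fun f => ?_, fun f => (hm f).coeFn_toLp⟩
  refine Lp.norm_le_mul_norm_of_ae_le_mul ?_
  filter_upwards [(hm f).coeFn_toLp] with x hx
  exact (congrArg norm hx).trans_le ((c x).le_of_opNorm_le (hB x) _)

lemma exists_scalar_multiplier {c : Space n → ℂ} (hc : AEStronglyMeasurable c volume) {B : ℝ}
    (hB : ∀ x, ‖c x‖ ≤ B) : ∃ T : L2 n →L[ℂ] L2 n, ∀ f, ∀ᵐ x, T f x = c x * f x :=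
  exists_multiplier (c := fun x => ContinuousLinearMap.mul ℂ ℂ (c x))
    ((ContinuousLinearMap.mul ℂ ℂ).continuous.comp_aestronglyMeasurable hc)
    (fun x => (ContinuousLinearMap.opNorm_mul_apply_le ℂ ℂ (c x)).trans (hB x))

lemma exists_field_multiplier {c : Fin n → Space n → ℂ}
    (hc : ∀ j, AEStronglyMeasurable (c j) volume) {B : Fin n → ℝ} (hB : ∀ j x, ‖c j x‖ ≤ B j) :
    ∃ T : L2Vec n →L[ℂ] L2 n, ∀ p, ∀ᵐ x, T p x = ∑ j, c j x * p x j := by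
  obtain ⟨T, hT⟩ := exists_multiplier (n := n)
    (c := fun x => ∑ j, c j x • (EuclideanSpace.proj j : EuclideanSpace ℂ (Fin n) →L[ℂ] ℂ))
    (Finset.aestronglyMeasurable_fun_sum _ fun j _ => (hc j).smul_const _)
    (B := ∑ j : Fin n, B j * ‖(EuclideanSpace.proj j : EuclideanSpace ℂ (Fin n) →L[ℂ] ℂ)‖)
    (fun x => (norm_sum_le _ _).trans (Finset.sum_le_sum fun j _ => by
      rw [norm_smul]
      gcongr
      exact hB j x))
  refine ⟨T, fun p => ?_⟩
  filter_upwards [hT p] with x hx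
  simpa [_root_.sum_apply] using hx

/-- Differentiation of `⟪u, G⟫` for an antisymmetric pairing. -/
lemma hasDerivAt_inner_of_antisymm {H : Type*} [NormedAddCommGroup H] [InnerProductSpace ℂ H]
    {u G : ℝ → H} {u' : H} {t : ℝ} (hu : HasDerivAt u u' t) (hG : ContinuousAt G t)
    (hanti : ∀ s r, inner ℂ (u s) (G r) = -inner ℂ (G s) (u r)) :
    HasDerivAt (fun s => inner ℂ (u s) (G s)) (inner ℂ u' (G t) - inner ℂ (G t) u') t := by
  rw [hasDerivAt_iff_tendsto_slope] at hu ⊢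
  have hG' : Tendsto G (𝓝[≠] t) (𝓝 (G t)) := hG.tendsto.mono_left nhdsWithin_le_nhds
  refine ((hu.inner hG').sub (tendsto_const_nhds.inner hu)).congr fun s => ?_
  -- The cross terms `⟪u t, G s⟫` and `⟪G t, u s⟫` cancel, so the difference quotient involves only
  -- the slope of `u`; continuity of `G` is enough.
  have h1 := hanti t s
  have h2 := hanti t t
  simp only [slope_def_module, inner_smul_right_eq_smul]
  rw [inner_smul_left_eq_smul, inner_sub_left, inner_sub_right, ← smul_sub]
  congr 1
  linear_combination -h1 + h2

end Multiplier

/-! ### Weighted mass and the weak equation. -/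

section Weight

variable {n : ℕ} {A : Space n → Space n} {V : Space n → ℝ}

lemma IsCovariantGradient.mul_contDiff (hn : 2 ≤ n) (hA : ContDiffOn ℝ 1 A {0}ᶜ)
    (hA2 : LocallyIntegrable (fun x => ‖A x‖ ^ 2)) {w v : L2 n} {p q : L2Vec n}
    (hp : IsCovariantGradient A w p) {φ : Space n → ℝ} (hφ : ContDiff ℝ ∞ φ)
    (hv : ∀ᵐ x, v x = (φ x : ℂ) * w x)
    (hq : ∀ᵐ x, ∀ j, q x j = (φ x : ℂ) * p x j + ((pd j φ x : ℝ) : ℂ) * w x) :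
    IsCovariantGradient A v q := by
  intro ψ hψ hψc j
  let φc : Space n → ℂ := fun x => (φ x : ℂ)
  have hφc : ContDiff ℝ ∞ φc := Complex.ofRealCLM.contDiff.comp hφ
  have hpd : ∀ x, pd j φc x = ((pd j φ x : ℝ) : ℂ) := fun x =>
    pd_ofReal (hφ.differentiable (by simp) x) j
  have cd : Continuous fun x => pd j φc x * ψ x :=
    (continuous_pd (hφc.of_le (by simp)) j).mul hψ.continuous
  have i1 := integrable_mul_test hn hA hA2 w (hφc.mul hψ) hψc.mul_left j
  have i2 : Integrable fun x => w x * (pd j φc x * ψ x) :=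
    integrable_mul_of_continuous (Lp.memLp w) cd hψc.mul_left
  have i3 : Integrable fun x => p x j * (φc x * ψ x) :=
    integrable_mul_of_continuous (memLp_component p j) (hφc.continuous.mul hψ.continuous)
      hψc.mul_left
  calc _ = ∫ x, (w x * (fderiv ℝ (fun y => φc y * ψ y) x (basisVec j)
          + Complex.I * (A x j : ℂ) * (φc x * ψ x)) - w x * (pd j φc x * ψ x)) := by
        refine integral_congr_ae ?_
        filter_upwards [hv] with x hx
        have h1 := pd_mul (hφc.differentiable (by simp) x) (hψ.differentiable (by simp) x) j
        rw [pd] at h1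
        rw [hx, h1]
        simp only [φc, pd]
        ring
    _ = - ∫ x, (p x j * (φc x * ψ x) + w x * (pd j φc x * ψ x)) := by
        rw [integral_sub i1 i2, integral_add i3 i2, hp _ (hφc.mul hψ) hψc.mul_left j]
        ring
    _ = _ := by
        congr 1
        refine integral_congr_ae ?_
        filter_upwards [hq] with x hx
        rw [hx j, ← hpd]
        simp only [φc]
        ring

/-- The function `φ w` lies in the form domain with gradient `φ p + w ∇φ`. Hence `⟪φ w, h⟫ = ∫ φ
|p|² + ⟪w, ∇φ · p⟫`; the first term and the potential term are real, so only the last has an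
imaginary part. -/
lemma im_inner_weight (hn : 2 ≤ n) (hA : ContDiffOn ℝ 1 A {0}ᶜ)
    (hA2 : LocallyIntegrable (fun x => ‖A x‖ ^ 2)) {w h k : L2 n} {p : L2Vec n}
    (hp : IsCovariantGradient A w p) (hh : IsFormSolution A p h)
    (hk : ∀ᵐ x, k x = h x + (V x : ℂ) * w x) {φ : Space n → ℝ} (hφ : ContDiff ℝ ∞ φ) {B : ℝ}
    (hB : ∀ x, |φ x| ≤ B) (hB' : ∀ j x, |pd j φ x| ≤ B) {T : L2 n →L[ℂ] L2 n}
    {R : L2Vec n →L[ℂ] L2 n} (hT : ∀ f, ∀ᵐ x, T f x = (φ x : ℂ) * f x)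
    (hR : ∀ p, ∀ᵐ x, R p x = ∑ j, ((pd j φ x : ℝ) : ℂ) * p x j) :
    (inner ℂ (T w) k).im = (inner ℂ w (R p)).im := by
  have cφ : Continuous fun x => (φ x : ℂ) := Complex.continuous_ofReal.comp hφ.continuous
  have cpd : ∀ j, Continuous fun x => ((pd j φ x : ℝ) : ℂ) := fun j =>
    Complex.continuous_ofReal.comp (continuous_pd (hφ.of_le (by simp)) j)
  have m1 : ∀ j, MemLp (fun x => (φ x : ℂ) * p x j + ((pd j φ x : ℝ) : ℂ) * w x) 2 volume := by
    intro j
    refine MemLp.add (f := fun x => (φ x : ℂ) * p x j) (g := fun x => ((pd j φ x : ℝ) : ℂ) * w x)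
      ((memLp_component p j).of_le_mul (c := B) ?_ (.of_forall fun x => ?_))
      ((Lp.memLp w).of_le_mul (c := B) ?_ (.of_forall fun x => ?_))
    · exact cφ.aestronglyMeasurable.mul (memLp_component p j).1
    · rw [norm_mul, Complex.norm_real]
      exact mul_le_mul_of_nonneg_right (hB x) (norm_nonneg _)
    · exact (cpd j).aestronglyMeasurable.mul (Lp.memLp w).1
    · rw [norm_mul, Complex.norm_real]
      exact mul_le_mul_of_nonneg_right (hB' j x) (norm_nonneg _)
  obtain ⟨q, hq⟩ := exists_toL2Vec m1
  have e1 : inner ℂ (T w) k = inner ℂ q p + inner ℂ (T w) (k - h) := by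
    rw [hh _ q (hp.mul_contDiff hn hA hA2 hφ (hT w) hq), ← inner_add_right, add_sub_cancel]
  have e2 : inner ℂ (T w) (k - h) = ((∫ x, φ x * V x * ‖w x‖ ^ 2 : ℝ) : ℂ) := by
    rw [inner_L2_eq, ← integral_complex_ofReal]
    refine integral_congr_ae ?_
    filter_upwards [hT w, hk, Lp.coeFn_sub k h] with x h1 h2 h3
    rw [h1, h3, Pi.sub_apply, h2, add_sub_cancel_left, map_mul, Complex.conj_ofReal,
      mul_mul_mul_comm, Complex.conj_mul']
    push_cast
    ring
  have i1 : Integrable fun x => φ x * ‖p x‖ ^ 2 :=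
    (integrable_norm_sq p).bdd_mul hφ.continuous.aestronglyMeasurable (.of_forall hB)
  have i1' : Integrable fun x => ((φ x * ‖p x‖ ^ 2 : ℝ) : ℂ) := i1.ofReal
  have i2 : Integrable fun x => (starRingEnd ℂ) (w x) * R p x :=
    memLp_one_iff_integrable.1 ((Lp.memLp (R p)).mul' (Lp.memLp w).star)
  have e3 : inner ℂ q p = ((∫ x, φ x * ‖p x‖ ^ 2 : ℝ) : ℂ) + inner ℂ w (R p) := by
    rw [inner_L2_eq, ← integral_complex_ofReal, ← integral_add i1' i2, L2.inner_def]
    refine integral_congr_ae ?_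
    filter_upwards [hq, hR p] with x h1 h2
    rw [h2, Complex.ofReal_mul, norm_sq_eq_sum, Finset.mul_sum, Finset.mul_sum,
      ← Finset.sum_add_distrib, PiLp.inner_apply]
    refine Finset.sum_congr rfl fun j _ => ?_
    rw [h1 j]
    simp only [RCLike.inner_apply, map_add, map_mul, Complex.conj_ofReal]
    ring
  rw [e1, e2, e3, Complex.add_im, Complex.add_im, Complex.ofReal_im, Complex.ofReal_im]
  ring

lemma inner_weight_symm {φ : Space n → ℝ} {T : L2 n →L[ℂ] L2 n}
    (hT : ∀ f, ∀ᵐ x, T f x = (φ x : ℂ) * f x) (f g : L2 n) :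
    inner ℂ (T f) g = inner ℂ f (T g) := by
  rw [inner_L2_eq, inner_L2_eq]
  refine integral_congr_ae ?_
  filter_upwards [hT f, hT g] with x h1 h2
  rw [h1, h2, map_mul, Complex.conj_ofReal]
  ring

/-- The operator `T` is symmetric because the weight is real, so the two terms of the derivative are
conjugate; `u' = -i k` converts their real part into an imaginary part. -/
lemma hasDerivAt_inner_weight {φ : Space n → ℝ} {T : L2 n →L[ℂ] L2 n}
    (hT : ∀ f, ∀ᵐ x, T f x = (φ x : ℂ) * f x) {u : ℝ → L2 n} {u' k : L2 n} {t : ℝ}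
    (hu : HasDerivAt u u' t) (hk : Complex.I • u' = k) :
    HasDerivAt (fun s => (inner ℂ (u s) (T (u s))).re) (2 * (inner ℂ (T (u t)) k).im) t := by
  have h1 : HasDerivAt (fun s => T (u s)) (T u') t :=
    (T.restrictScalars ℝ).hasFDerivAt.comp_hasDerivAt t hu
  have h2 := Complex.reCLM.hasFDerivAt.comp_hasDerivAt t (hu.inner ℂ h1)
  refine h2.congr_deriv ?_
  have e : u' = -Complex.I • k := by rw [← hk, smul_smul]; simp
  have e2 : (inner ℂ k (T (u t))).im = -(inner ℂ (T (u t)) k).im := by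
    rw [← inner_conj_symm, Complex.conj_im]
  rw [← inner_weight_symm hT, e, inner_smul_right, inner_smul_left]
  simp [e2]
  ring

end Weight

/-! ### Bounded regularization of `|x|²`. -/

section Variance

variable {n : ℕ}

/-- The bounded approximation `|x|² / (1 + δ |x|²)` of `|x|²`. -/
noncomputable def varWeight (δ : ℝ) (x : Space n) : ℝ := ‖x‖ ^ 2 / (1 + δ * ‖x‖ ^ 2)

variable {δ : ℝ}

lemma contDiff_varWeight (hδ : 0 < δ) : ContDiff ℝ ∞ (varWeight δ : Space n → ℝ) :=
  (contDiff_norm_sq ℝ).div (contDiff_const.add (contDiff_const.mul (contDiff_norm_sq ℝ)))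
    fun x => by positivity

lemma pd_varWeight (hδ : 0 < δ) (j : Fin n) (x : Space n) :
    pd j (varWeight δ) x = 2 * x j / (1 + δ * ‖x‖ ^ 2) ^ 2 := by
  have h1 := (hasStrictFDerivAt_norm_sq x).hasFDerivAt
  have hpos : 1 + δ * ‖x‖ ^ 2 ≠ 0 := by positivity
  have hd : HasDerivAt (fun r : ℝ => r / (1 + δ * r)) (1 / (1 + δ * ‖x‖ ^ 2) ^ 2) (‖x‖ ^ 2) := by
    refine ((hasDerivAt_id _).div (((hasDerivAt_id _).const_mul δ).const_add 1) hpos).congr_deriv ?_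
    simp only [id_eq]
    ring
  have h2 : fderiv ℝ (varWeight δ) x = _ :=
    (HasDerivAt.comp_hasFDerivAt (h₂ := fun r : ℝ => r / (1 + δ * r)) x hd h1).fderiv
  rw [pd, h2]
  simp [basisVec, EuclideanSpace.inner_single_right]
  ring

lemma varWeight_nonneg (hδ : 0 < δ) (x : Space n) : 0 ≤ varWeight δ x := by
  unfold varWeight
  positivity

lemma varWeight_le (hδ : 0 < δ) (x : Space n) : varWeight δ x ≤ ‖x‖ ^ 2 :=
  div_le_self (by positivity) (by nlinarith [mul_nonneg hδ.le (sq_nonneg ‖x‖)])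

lemma varWeight_le_inv (hδ : 0 < δ) (x : Space n) : varWeight δ x ≤ δ⁻¹ := by
  rw [varWeight, div_le_iff₀ (by positivity), mul_add, ← mul_assoc, inv_mul_cancel₀ hδ.ne']
  have := inv_pos.2 hδ
  linarith

lemma sum_pd_varWeight (hδ : 0 < δ) (x : Space n) (p : EuclideanSpace ℂ (Fin n)) :
    ∑ j, ((pd j (varWeight δ) x : ℝ) : ℂ) * p j
      = ((2 / (1 + δ * ‖x‖ ^ 2) ^ 2 : ℝ) : ℂ) * ∑ j, (x j : ℂ) * p j := by
  rw [Finset.mul_sum]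
  refine Finset.sum_congr rfl fun j _ => ?_
  rw [pd_varWeight hδ]
  push_cast
  ring

lemma norm_sum_pd_varWeight_le (hδ : 0 < δ) (x : Space n) (p : EuclideanSpace ℂ (Fin n)) :
    ‖∑ j, ((pd j (varWeight δ) x : ℝ) : ℂ) * p j‖ ≤ 2 * (‖x‖ / (1 + δ * ‖x‖ ^ 2) ^ 2 * ‖p‖) := by
  rw [sum_pd_varWeight hδ, norm_mul, Complex.norm_real, Real.norm_eq_abs,
    abs_of_nonneg (by positivity)]
  calc _ ≤ 2 / (1 + δ * ‖x‖ ^ 2) ^ 2 * (‖x‖ * ‖p‖) := by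
        gcongr
        exact norm_sum_coord_mul_le x p
    _ = _ := by ring

lemma abs_pd_varWeight_le (hδ : 0 < δ) (j : Fin n) (x : Space n) :
    |pd j (varWeight δ) x| ≤ 2 * (1 + δ⁻¹) := by
  have hx : |x j| ≤ ‖x‖ := PiLp.norm_apply_le x j
  have hpos : 1 ≤ 1 + δ * ‖x‖ ^ 2 := by nlinarith [mul_nonneg hδ.le (sq_nonneg ‖x‖)]
  have h0 := inv_pos.2 hδ
  have h1 : ‖x‖ ≤ (1 + δ⁻¹) * (1 + δ * ‖x‖ ^ 2) := by
    have : δ⁻¹ * (δ * ‖x‖ ^ 2) = ‖x‖ ^ 2 := by field_simp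
    nlinarith [sq_nonneg (‖x‖ - 1), mul_nonneg hδ.le (sq_nonneg ‖x‖), sq_nonneg ‖x‖]
  rw [pd_varWeight hδ, abs_div, abs_of_nonneg (by positivity : 0 ≤ (1 + δ * ‖x‖ ^ 2) ^ 2),
    div_le_iff₀ (by positivity), abs_mul, abs_two]
  have h2 : (1 + δ⁻¹) * (1 + δ * ‖x‖ ^ 2) ≤ (1 + δ⁻¹) * (1 + δ * ‖x‖ ^ 2) ^ 2 := by
    gcongr
    nlinarith
  linarith

/-- The pointwise bound behind the growth estimate of the variance. -/
lemma norm_pd_varWeight_pairing_le (hδ : 0 < δ) (x : Space n) (z : ℂ)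
    (p : EuclideanSpace ℂ (Fin n)) :
    ‖(starRingEnd ℂ) z * ∑ j, ((pd j (varWeight δ) x : ℝ) : ℂ) * p j‖
      ≤ varWeight δ x * ‖z‖ ^ 2 + ‖p‖ ^ 2 := by
  have hpos : 1 ≤ 1 + δ * ‖x‖ ^ 2 := by nlinarith [mul_nonneg hδ.le (sq_nonneg ‖x‖)]
  set D := 1 + δ * ‖x‖ ^ 2 with hD
  -- The squared gradient of the weight is controlled by the weight itself with a constant
  -- independent of `δ`; this makes the Gronwall estimate uniform.
  have h1 : (‖x‖ / D ^ 2) ^ 2 ≤ varWeight δ x := by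
    rw [varWeight, ← hD, div_pow]
    gcongr
    calc D ≤ D ^ 4 := le_self_pow₀ hpos (by norm_num)
      _ = _ := by ring
  rw [norm_mul, RCLike.norm_conj]
  calc _ ≤ ‖z‖ * (2 * (‖x‖ / D ^ 2 * ‖p‖)) := by
        gcongr
        exact norm_sum_pd_varWeight_le hδ x p
    _ ≤ (‖x‖ / D ^ 2) ^ 2 * ‖z‖ ^ 2 + ‖p‖ ^ 2 := by
        nlinarith [sq_nonneg (‖x‖ / D ^ 2 * ‖z‖ - ‖p‖)]
    _ ≤ _ := by gcongr

end Variance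

/-! ### Finiteness of the variance and its first derivative. -/

section Growth

variable {n : ℕ} {A : Space n → Space n} {V : Space n → ℝ}

/-- A solution `u` of the Schrödinger equation together with `p = ∇_A u`, `h = H_A u` and
`k = H u`. -/
structure IsFlow (A : Space n → Space n) (V : Space n → ℝ) (u h k : ℝ → L2 n)
    (p : ℝ → L2Vec n) : Prop where
  two_le : 2 ≤ n
  potential : ContDiffOn ℝ 1 A {0}ᶜ
  locallyIntegrable : LocallyIntegrable (fun x => ‖A x‖ ^ 2)
  hasDerivAt : ∀ t, HasDerivAt u (deriv u t) t
  equation : ∀ t, Complex.I • deriv u t = k t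
  continuous_hamiltonian : Continuous k
  gradient : ∀ t, IsCovariantGradient A (u t) (p t)
  formSolution : ∀ t, IsFormSolution A (p t) (h t)
  hamiltonian : ∀ t, ∀ᵐ x, k t x = h t x + (V x : ℂ) * u t x
  continuous_gradient : Continuous p

lemma IsFlow.continuous {u h k : ℝ → L2 n} {p : ℝ → L2Vec n} (S : IsFlow A V u h k p) :
    Continuous u :=
  continuous_iff_continuousAt.2 fun t => (S.hasDerivAt t).continuousAt

lemma integrable_varWeight_mul {δ : ℝ} (hδ : 0 < δ) (w : L2 n) :
    Integrable (fun x => varWeight δ x * ‖w x‖ ^ 2) :=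
  (integrable_norm_sq w).bdd_mul (contDiff_varWeight hδ).continuous.aestronglyMeasurable
    (.of_forall fun x => by
      rw [Real.norm_eq_abs, abs_of_nonneg (varWeight_nonneg hδ x)]
      exact varWeight_le_inv hδ x)

/-- The density of the derivative of the regularized variance. -/
noncomputable def weightFlux (δ : ℝ) (w : L2 n) (p : L2Vec n) (x : Space n) : ℝ :=
  ((starRingEnd ℂ) (w x) * ∑ j, ((pd j (varWeight δ) x : ℝ) : ℂ) * p x j).im

lemma abs_weightFlux_le {δ : ℝ} (hδ : 0 < δ) (w : L2 n) (p : L2Vec n) (x : Space n) :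
    |weightFlux δ w p x| ≤ varWeight δ x * ‖w x‖ ^ 2 + ‖p x‖ ^ 2 :=
  (Complex.abs_im_le_norm _).trans (norm_pd_varWeight_pairing_le hδ x (w x) (p x))

lemma aestronglyMeasurable_weightFlux {δ : ℝ} (hδ : 0 < δ) (w : L2 n) (p : L2Vec n) :
    AEStronglyMeasurable (weightFlux δ w p) volume := by
  refine Complex.continuous_im.comp_aestronglyMeasurable ((Lp.memLp w).star.1.mul ?_)
  refine Finset.aestronglyMeasurable_fun_sum _ fun j _ => ?_
  have : Continuous fun x : Space n => ((pd j (varWeight δ) x : ℝ) : ℂ) :=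
    Complex.continuous_ofReal.comp (continuous_pd ((contDiff_varWeight hδ).of_le (by simp)) j)
  exact this.aestronglyMeasurable.mul (memLp_component p j).1

lemma abs_integral_weightFlux_le {δ : ℝ} (hδ : 0 < δ) (w : L2 n) (p : L2Vec n) :
    |∫ x, weightFlux δ w p x| ≤ (∫ x, varWeight δ x * ‖w x‖ ^ 2) + ‖p‖ ^ 2 := by
  have hb := (integrable_varWeight_mul hδ w).add (integrable_norm_sq p)
  have hi : Integrable (weightFlux δ w p) :=
    hb.mono' (aestronglyMeasurable_weightFlux hδ w p) (.of_forall (abs_weightFlux_le hδ w p))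
  calc _ ≤ ∫ x, |weightFlux δ w p x| := abs_integral_le_integral_abs
    _ ≤ ∫ x, (varWeight δ x * ‖w x‖ ^ 2 + ‖p x‖ ^ 2) :=
      integral_mono hi.abs hb (abs_weightFlux_le hδ w p)
    _ = _ := by
      rw [integral_add (integrable_varWeight_mul hδ w) (integrable_norm_sq p), integral_norm_sq_eq]

lemma IsFlow.hasDerivAt_varWeight {u h k : ℝ → L2 n} {p : ℝ → L2Vec n} (S : IsFlow A V u h k p)
    {δ : ℝ} (hδ : 0 < δ) :
    (Continuous fun t => ∫ x, weightFlux δ (u t) (p t) x) ∧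
      ∀ t, HasDerivAt (fun s => ∫ x, varWeight δ x * ‖u s x‖ ^ 2)
        (2 * ∫ x, weightFlux δ (u t) (p t) x) t := by
  have hφ := contDiff_varWeight (n := n) hδ
  have hB : ∀ x : Space n, |varWeight δ x| ≤ 2 * (1 + δ⁻¹) := fun x => by
    rw [abs_of_nonneg (varWeight_nonneg hδ x)]
    have := varWeight_le_inv hδ x
    have := inv_pos.2 hδ
    linarith
  obtain ⟨T, hT⟩ := exists_scalar_multiplier (n := n) (c := fun x => (varWeight δ x : ℂ))
    (Complex.continuous_ofReal.comp hφ.continuous).aestronglyMeasurable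
    (B := 2 * (1 + δ⁻¹)) (fun x => by simpa using hB x)
  obtain ⟨R, hR⟩ := exists_field_multiplier (n := n)
    (c := fun j x => ((pd j (varWeight δ) x : ℝ) : ℂ))
    (fun j => (Complex.continuous_ofReal.comp
      (continuous_pd (hφ.of_le (by simp)) j)).aestronglyMeasurable)
    (B := fun _ => 2 * (1 + δ⁻¹)) (fun j x => by simpa using abs_pd_varWeight_le hδ j x)
  have eR : ∀ w p, (inner ℂ w (R p)).im = ∫ x, weightFlux δ w p x := by
    intro w p
    rw [inner_L2_eq]
    have i2 : Integrable fun x => (starRingEnd ℂ) (w x) * R p x :=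
      memLp_one_iff_integrable.1 ((Lp.memLp (R p)).mul' (Lp.memLp w).star)
    have := integral_im i2
    refine this.symm.trans (integral_congr_ae ?_)
    filter_upwards [hR p] with x hx
    rw [hx]
    rfl
  have eT : ∀ w, (inner ℂ w (T w)).re = ∫ x, varWeight δ x * ‖w x‖ ^ 2 := by
    intro w
    have : inner ℂ w (T w) = ((∫ x, varWeight δ x * ‖w x‖ ^ 2 : ℝ) : ℂ) := by
      rw [inner_L2_eq, ← integral_complex_ofReal]
      refine integral_congr_ae ?_
      filter_upwards [hT w] with x hx
      rw [hx, mul_left_comm, Complex.conj_mul']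
      push_cast
      ring
    rw [this, Complex.ofReal_re]
  constructor
  · simp only [← eR]
    exact Complex.continuous_im.comp (S.continuous.inner (R.continuous.comp S.continuous_gradient))
  · intro t
    simp only [← eT, ← eR]
    rw [← im_inner_weight S.two_le S.potential S.locallyIntegrable (S.gradient t)
      (S.formSolution t) (S.hamiltonian t) hφ hB (abs_pd_varWeight_le hδ) hT hR]
    exact hasDerivAt_inner_weight hT (S.hasDerivAt t) (S.equation t)

lemma tendsto_varWeight (x : Space n) :
    Tendsto (fun m : ℕ => varWeight (1 / ((m : ℝ) + 1)) x) atTop (𝓝 (‖x‖ ^ 2)) := by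
  have h : Tendsto (fun m : ℕ => ‖x‖ ^ 2 / (1 + 1 / ((m : ℝ) + 1) * ‖x‖ ^ 2)) atTop
      (𝓝 (‖x‖ ^ 2 / (1 + 0 * ‖x‖ ^ 2))) :=
    tendsto_const_nhds.div
      ((tendsto_one_div_add_atTop_nhds_zero_nat.mul_const _).const_add 1) (by simp)
  simpa [varWeight] using h

/-- Fatou's lemma as the regularization is removed. It yields integrability and the bound together.
-/
lemma integrable_variance_of_le {w : L2 n} {B : ℝ}
    (hB : ∀ m : ℕ, ∫ x, varWeight (1 / ((m : ℝ) + 1)) x * ‖w x‖ ^ 2 ≤ B) :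
    Integrable (fun x => ‖x‖ ^ 2 * ‖w x‖ ^ 2) ∧ variance w ≤ B := by
  have hδ : ∀ m : ℕ, 0 < 1 / ((m : ℝ) + 1) := fun m => Nat.one_div_pos_of_nat
  have hB0 : 0 ≤ B := (integral_nonneg fun x =>
    mul_nonneg (varWeight_nonneg (hδ 0) x) (sq_nonneg _)).trans (hB 0)
  have hmeas : AEStronglyMeasurable (fun x : Space n => ‖x‖ ^ 2 * ‖w x‖ ^ 2) volume :=
    (by fun_prop : Continuous fun x : Space n => ‖x‖ ^ 2).aestronglyMeasurable.mul
      (integrable_norm_sq w).1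
  have hle : ∫⁻ x, ENNReal.ofReal (‖x‖ ^ 2 * ‖w x‖ ^ 2) ≤ ENNReal.ofReal B := by
    have h1 : ∀ x : Space n, ENNReal.ofReal (‖x‖ ^ 2 * ‖w x‖ ^ 2) = liminf (fun m : ℕ =>
        ENNReal.ofReal (varWeight (1 / ((m : ℝ) + 1)) x * ‖w x‖ ^ 2)) atTop := fun x =>
      ((ENNReal.continuous_ofReal.tendsto _).comp
        ((tendsto_varWeight x).mul_const _)).liminf_eq.symm
    simp only [h1]
    refine (lintegral_liminf_le' fun m =>
      (integrable_varWeight_mul (hδ m) w).1.aemeasurable.ennreal_ofReal).trans ?_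
    refine liminf_le_of_le (by isBoundedDefault) fun b hb => ?_
    obtain ⟨m, hm⟩ := hb.exists
    refine hm.trans ?_
    rw [← ofReal_integral_eq_lintegral_ofReal (integrable_varWeight_mul (hδ m) w)
      (.of_forall fun x => mul_nonneg (varWeight_nonneg (hδ m) x) (sq_nonneg _))]
    exact ENNReal.ofReal_le_ofReal (hB m)
  have hnn : 0 ≤ᵐ[volume] fun x : Space n => ‖x‖ ^ 2 * ‖w x‖ ^ 2 :=
    .of_forall fun x => by positivity
  have hi : Integrable (fun x : Space n => ‖x‖ ^ 2 * ‖w x‖ ^ 2) := by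
    refine ⟨hmeas, ?_⟩
    rw [hasFiniteIntegral_iff_ofReal hnn]
    exact hle.trans_lt ENNReal.ofReal_lt_top
  refine ⟨hi, ?_⟩
  rw [variance, integral_eq_lintegral_of_nonneg_ae hnn hmeas]
  exact ENNReal.toReal_le_of_le_ofReal hB0 hle

/-- Gronwall forward in time, and applied to the reversed function for negative times. -/
lemma abs_le_gronwallBound {f D : ℝ → ℝ} (hf : ∀ t, HasDerivAt f (D t) t) {T K P a : ℝ}
    (ha0 : 0 ≤ a) (hK : 0 ≤ K) (hP : 0 ≤ P)
    (hD : ∀ t, |t| ≤ T → |D t| ≤ K * |f t| + P) (ha : |f 0| ≤ a) {t : ℝ} (ht : |t| ≤ T) :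
    |f t| ≤ gronwallBound a K P T := by
  have aux : ∀ g E : ℝ → ℝ, (∀ t, HasDerivAt g (E t) t) →
      (∀ t, |t| ≤ T → |E t| ≤ K * |g t| + P) → |g 0| ≤ a → ∀ t, 0 ≤ t → t ≤ T →
      |g t| ≤ gronwallBound a K P T := by
    intro g E hg hE hg0 t h0 hT
    have h1 := norm_le_gronwallBound_of_norm_deriv_right_le (f := g) (f' := E) (a := 0) (b := T)
      (δ := a) (K := K) (ε := P)
      (fun t _ => (hg t).continuousAt.continuousWithinAt) (fun t _ => (hg t).hasDerivWithinAt) hg0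
      (fun t ht => hE t (by rw [abs_of_nonneg ht.1]; exact ht.2.le)) t ⟨h0, hT⟩
    refine h1.trans ?_
    rw [sub_zero]
    exact gronwallBound_mono ha0 hP hK hT
  rcases le_total 0 t with h0 | h0
  · exact aux f D hf hD ha t h0 ((le_abs_self t).trans ht)
  · have := aux (fun s => f (-s)) (fun s => -D (-s)) (fun s => by
        simpa [Function.comp_def] using HasDerivAt.comp s (hf (-s)) (hasDerivAt_neg s))
      (fun s hs => by simpa using hD (-s) (by simpa using hs)) (by simpa using ha) (-t)
      (by linarith) ((neg_le_abs t).trans ht)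
    simpa using this

/-- The variance stays finite, locally uniformly in time. -/
lemma IsFlow.exists_variance_le {u h k : ℝ → L2 n} {p : ℝ → L2Vec n} (S : IsFlow A V u h k p)
    (h0 : Integrable (fun x => ‖x‖ ^ 2 * ‖u 0 x‖ ^ 2)) (T : ℝ) :
    ∃ B : ℝ, ∀ t, |t| ≤ T → ‖p t‖ ^ 2 ≤ B ∧
      Integrable (fun x => ‖x‖ ^ 2 * ‖u t x‖ ^ 2) ∧ variance (u t) ≤ B := by
  -- Continuity of the gradient in time gives a bound on compact intervals. The maximum with `0`
  -- keeps the constant nonnegative when the interval is empty.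
  obtain ⟨P, hP⟩ := (isCompact_Icc (a := -T) (b := T)).bddAbove_image
    (S.continuous_gradient.norm.pow 2).continuousOn
  have hP' : ∀ t, |t| ≤ T → ‖p t‖ ^ 2 ≤ max P 0 := fun t ht =>
    (hP ⟨t, abs_le.1 ht, rfl⟩).trans (le_max_left _ _)
  have hv0 : 0 ≤ variance (u 0) := integral_nonneg fun x => by positivity
  refine ⟨max (max P 0) (gronwallBound (variance (u 0)) 2 (2 * max P 0) T), fun t ht =>
    ⟨(hP' t ht).trans (le_max_left _ _), ?_⟩⟩
  have key : ∀ m : ℕ, ∫ x, varWeight (1 / ((m : ℝ) + 1)) x * ‖u t x‖ ^ 2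
      ≤ gronwallBound (variance (u 0)) 2 (2 * max P 0) T := by
    intro m
    have hδ : 0 < 1 / ((m : ℝ) + 1) := Nat.one_div_pos_of_nat
    have hnn : ∀ t, 0 ≤ ∫ x, varWeight (1 / ((m : ℝ) + 1)) x * ‖u t x‖ ^ 2 := fun t =>
      integral_nonneg fun x => mul_nonneg (varWeight_nonneg hδ x) (sq_nonneg _)
    refine (le_abs_self _).trans (abs_le_gronwallBound (S.hasDerivAt_varWeight hδ).2 hv0 zero_le_two
      (by positivity) (fun t ht => ?_) ?_ ht)
    · rw [abs_mul, abs_two, abs_of_nonneg (hnn t), ← mul_add]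
      gcongr
      exact (abs_integral_weightFlux_le hδ _ _).trans (by gcongr; exact hP' t ht)
    · rw [abs_of_nonneg (hnn 0)]
      exact integral_mono (integrable_varWeight_mul hδ _) h0 fun x =>
        mul_le_mul_of_nonneg_right (varWeight_le hδ x) (sq_nonneg _)
  obtain ⟨h1, h2⟩ := integrable_variance_of_le key
  exact ⟨h1, h2.trans (le_max_right _ _)⟩

/-- The density of the radial momentum `Im (conj w x · p)`. -/
noncomputable def radialMomentum (w : L2 n) (p : L2Vec n) (x : Space n) : ℝ :=
  ((starRingEnd ℂ) (w x) * ∑ j, (x j : ℂ) * p x j).im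

lemma abs_radialMomentum_le (w : L2 n) (p : L2Vec n) (x : Space n) :
    |radialMomentum w p x| ≤ ‖x‖ ^ 2 * ‖w x‖ ^ 2 + ‖p x‖ ^ 2 := by
  refine (Complex.abs_im_le_norm _).trans ?_
  rw [norm_mul, RCLike.norm_conj]
  calc _ ≤ ‖w x‖ * (‖x‖ * ‖p x‖) := by
        gcongr
        exact norm_sum_coord_mul_le x (p x)
    _ ≤ _ := by nlinarith [sq_nonneg (‖x‖ * ‖w x‖ - ‖p x‖), sq_nonneg (‖x‖ * ‖w x‖),
        sq_nonneg ‖p x‖]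

lemma aestronglyMeasurable_radialMomentum (w : L2 n) (p : L2Vec n) :
    AEStronglyMeasurable (radialMomentum w p) volume :=
  Complex.continuous_im.comp_aestronglyMeasurable
    ((Lp.memLp w).star.1.mul (aestronglyMeasurable_sum_coord p))

lemma tendsto_integral_weightFlux {w : L2 n} (p : L2Vec n)
    (hw : Integrable (fun x => ‖x‖ ^ 2 * ‖w x‖ ^ 2)) :
    Tendsto (fun m : ℕ => ∫ x, weightFlux (1 / ((m : ℝ) + 1)) w p x) atTop
      (𝓝 (∫ x, 2 * radialMomentum w p x)) := by
  have hδ : ∀ m : ℕ, 0 < 1 / ((m : ℝ) + 1) := fun m => Nat.one_div_pos_of_nat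
  have hb : Integrable (fun x => ‖x‖ ^ 2 * ‖w x‖ ^ 2 + ‖p x‖ ^ 2) := hw.add (integrable_norm_sq p)
  refine tendsto_integral_of_dominated_convergence _
    (fun m => aestronglyMeasurable_weightFlux (hδ m) w p) hb
    (fun m => .of_forall fun x => (abs_weightFlux_le (hδ m) w p x).trans ?_)
    (.of_forall fun x => ?_)
  · gcongr
    exact varWeight_le (hδ m) x
  · have e : ∀ m : ℕ, weightFlux (1 / ((m : ℝ) + 1)) w p x
        = 2 / (1 + 1 / ((m : ℝ) + 1) * ‖x‖ ^ 2) ^ 2 * radialMomentum w p x := by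
      intro m
      rw [weightFlux, radialMomentum, ← Complex.im_ofReal_mul, sum_pd_varWeight (hδ m),
        mul_left_comm]
    simp only [e]
    have h : Tendsto (fun m : ℕ => 2 / (1 + 1 / ((m : ℝ) + 1) * ‖x‖ ^ 2) ^ 2) atTop
        (𝓝 (2 / (1 + 0 * ‖x‖ ^ 2) ^ 2)) :=
      tendsto_const_nhds.div
        (((tendsto_one_div_add_atTop_nhds_zero_nat.mul_const _).const_add 1).pow 2) (by simp)
    simpa using h.mul_const (radialMomentum w p x)

/-- The integrated first derivative of the variance. -/
lemma IsFlow.variance_sub {u h k : ℝ → L2 n} {p : ℝ → L2Vec n} (S : IsFlow A V u h k p)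
    (h0 : Integrable (fun x => ‖x‖ ^ 2 * ‖u 0 x‖ ^ 2)) (s t : ℝ) :
    variance (u t) - variance (u s)
      = ∫ τ in s..t, 2 * ∫ x, 2 * radialMomentum (u τ) (p τ) x := by
  obtain ⟨B, hB⟩ := S.exists_variance_le h0 (max |s| |t|)
  have hδ : ∀ m : ℕ, 0 < 1 / ((m : ℝ) + 1) := fun m => Nat.one_div_pos_of_nat
  have hmem : ∀ τ ∈ uIcc s t, |τ| ≤ max |s| |t| := fun τ hτ => by
    rw [abs_le]
    rcases mem_uIcc.1 hτ with h | h
    · exact ⟨by linarith [neg_abs_le s, le_max_left |s| |t|],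
        by linarith [le_abs_self t, le_max_right |s| |t|]⟩
    · exact ⟨by linarith [neg_abs_le t, le_max_right |s| |t|],
        by linarith [le_abs_self s, le_max_left |s| |t|]⟩
  have hQ : ∀ τ ∈ uIcc s t, Tendsto (fun m : ℕ => ∫ x, varWeight (1 / ((m : ℝ) + 1)) x
      * ‖u τ x‖ ^ 2) atTop (𝓝 (variance (u τ))) := by
    intro τ hτ
    refine tendsto_integral_of_dominated_convergence _
      (fun m => (integrable_varWeight_mul (hδ m) _).1) (hB τ (hmem τ hτ)).2.1
      (fun m => .of_forall fun x => ?_) (.of_forall fun x => (tendsto_varWeight x).mul_const _)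
    rw [Real.norm_eq_abs, abs_of_nonneg (mul_nonneg (varWeight_nonneg (hδ m) x) (sq_nonneg _))]
    exact mul_le_mul_of_nonneg_right (varWeight_le (hδ m) x) (sq_nonneg _)
  have hl := (hQ t right_mem_uIcc).sub (hQ s left_mem_uIcc)
  have hr : Tendsto (fun m : ℕ =>
      ∫ τ in s..t, 2 * ∫ x, weightFlux (1 / ((m : ℝ) + 1)) (u τ) (p τ) x)
      atTop (𝓝 (∫ τ in s..t, 2 * ∫ x, 2 * radialMomentum (u τ) (p τ) x)) := by
    -- One `B` bounds the variance and the other the squared gradient, uniformly on the time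
    -- interval.
    refine intervalIntegral.tendsto_integral_filter_of_dominated_convergence (fun _ => 2 * (B + B))
      (.of_forall fun m => ?_) (.of_forall fun m => .of_forall fun τ hτ => ?_)
      intervalIntegrable_const (.of_forall fun τ hτ => ?_)
    · exact ((S.hasDerivAt_varWeight (hδ m)).1.const_mul 2).aestronglyMeasurable
    · obtain ⟨b1, b2, b3⟩ := hB τ (hmem τ (uIoc_subset_uIcc hτ))
      rw [norm_mul, Real.norm_two]
      gcongr
      refine (abs_integral_weightFlux_le (hδ m) _ _).trans (add_le_add (le_trans ?_ b3) b1)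
      exact integral_mono (integrable_varWeight_mul (hδ m) _) b2 fun x =>
        mul_le_mul_of_nonneg_right (varWeight_le (hδ m) x) (sq_nonneg _)
    · exact (tendsto_integral_weightFlux _ (hB τ (hmem τ (uIoc_subset_uIcc hτ))).2.1).const_mul 2
  refine tendsto_nhds_unique hl (hr.congr fun m => ?_)
  obtain ⟨c, hd⟩ := S.hasDerivAt_varWeight (hδ m)
  exact intervalIntegral.integral_eq_sub_of_hasDerivAt (fun τ _ => hd τ)
    ((c.const_mul 2).intervalIntegrable _ _)

end Growth

/-! ### The derivative of the radial momentum. -/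

section Momentum

variable {n : ℕ} {A : Space n → Space n} {V : Space n → ℝ} {u h k : ℝ → L2 n} {p : ℝ → L2Vec n}

lemma integrable_conj_mul (f g : L2 n) : Integrable fun x => (starRingEnd ℂ) (f x) * g x :=
  memLp_one_iff_integrable.1 ((Lp.memLp g).mul' (Lp.memLp f).star)

/-- The operator `X · ∇_A + ½ div X`, for a compactly supported field `X`. -/
lemma exists_symOp_clm {X : Fin n → Space n → ℝ} (hX : ∀ k, ContDiff ℝ 1 (X k)) {K : Set (Space n)}
    (hK : IsCompact K) (hXK : ∀ k, tsupport (X k) ⊆ K) :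
    ∃ (S : L2Vec n →L[ℂ] L2 n) (T : L2 n →L[ℂ] L2 n), ∀ q v,
      ∀ᵐ x, (S q + T v) x = symOp X (fun k x => q x k) v x := by
  have hc : ∀ k, HasCompactSupport (X k) := fun k =>
    hK.of_isClosed_subset (isClosed_tsupport _) (hXK k)
  have cX : ∀ k, Continuous fun x => (X k x : ℂ) := fun k =>
    Complex.continuous_ofReal.comp (hX k).continuous
  have hd : Continuous (fieldDiv X) := continuous_finsetSum _ fun k _ => continuous_pd (hX k) k
  choose B hB using fun k => (hX k).continuous.bounded_above_of_compact_support (hc k)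
  obtain ⟨D, hD⟩ := hd.bounded_above_of_compact_support
    (hK.of_isClosed_subset (isClosed_tsupport _) (tsupport_fieldDiv_subset hK.isClosed hXK))
  obtain ⟨S, hS⟩ := exists_field_multiplier (n := n) (c := fun k x => (X k x : ℂ))
    (fun k => (cX k).aestronglyMeasurable) (B := B) (fun k x => by simpa using hB k x)
  obtain ⟨T, hT⟩ := exists_scalar_multiplier (n := n) (c := fun x => 1 / 2 * (fieldDiv X x : ℂ))
    (continuous_const.mul (Complex.continuous_ofReal.comp hd)).aestronglyMeasurable
    (B := 1 / 2 * D) (fun x => by simpa using hD x)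
  refine ⟨S, T, fun q v => ?_⟩
  filter_upwards [hS q, hT v, Lp.coeFn_add (S q) (T v)] with x h1 h2 h3
  rw [h3, Pi.add_apply, h1, h2]
  rfl

/-- The half divergence, which makes the operator antisymmetric, contributes a real density and is
invisible in the imaginary part. -/
lemma conj_mul_symOp_radialField_im (χ : ℝ → ℝ) (w : L2 n) (q : L2Vec n) (x : Space n) :
    ((starRingEnd ℂ) (w x) * symOp (radialField χ) (fun k x => q x k) w x).im
      = χ (logSq x) * radialMomentum w q x := by
  have e : (starRingEnd ℂ) (w x) * symOp (radialField χ) (fun k x => q x k) w x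
      = (χ (logSq x) : ℂ) * ((starRingEnd ℂ) (w x) * ∑ j, (x j : ℂ) * q x j)
        + ((1 / 2 * fieldDiv (radialField χ) x * ‖w x‖ ^ 2 : ℝ) : ℂ) := by
    have h1 : ((‖w x‖ ^ 2 : ℝ) : ℂ) = (starRingEnd ℂ) (w x) * w x := by
      rw [Complex.conj_mul']
      push_cast
      rfl
    rw [Complex.ofReal_mul, h1, symOp]
    have h2 : ∑ j, (radialField χ j x : ℂ) * q x j
        = (χ (logSq x) : ℂ) * ∑ j, (x j : ℂ) * q x j := by
      rw [Finset.mul_sum]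
      refine Finset.sum_congr rfl fun j _ => ?_
      simp only [radialField]
      push_cast
      ring
    rw [h2]
    push_cast
    ring
  rw [e, Complex.add_im, Complex.ofReal_im, add_zero, Complex.im_ofReal_mul, radialMomentum]

/-- The derivative of the momentum with logarithmic cutoff. -/
lemma IsFlow.hasDerivAt_cutoff_momentum (S : IsFlow A V u h k p) (hV : ContDiffOn ℝ 1 V {0}ᶜ)
    {N : ℝ} (hN : 1 ≤ N) :
    (Continuous fun t => ∫ x, radialVirial A V (logCutoff N) (u t) (p t) x) ∧
      ∀ t, HasDerivAt (fun s => ∫ x, logCutoff N (logSq x) * radialMomentum (u s) (p s) x)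
        (∫ x, radialVirial A V (logCutoff N) (u t) (p t) x) t := by
  have hR := logCutoff_eq_zero (show 0 < N by linarith)
  have hX : ∀ k, ContDiff ℝ 1 (radialField (logCutoff N) k : Space n → ℝ) := fun k =>
    (contDiff_radialField (contDiff_logCutoff N) hR k).of_le (by simp)
  have hXK := tsupport_radialField (n := n) hR
  obtain ⟨P, T, hPT⟩ := exists_symOp_clm hX (isCompact_annulus (2 * N)) hXK
  let G : ℝ → L2 n := fun t => P (p t) + T (u t)
  have hG : Continuous G :=
    (P.continuous.comp S.continuous_gradient).add (T.continuous.comp S.continuous)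
  have hGx : ∀ t, ∀ᵐ x, G t x = symOp (radialField (logCutoff N)) (fun k x => p t x k) (u t) x :=
    fun t => hPT (p t) (u t)
  -- Antisymmetry is needed between two different times, because the difference quotient mixes them.
  have hanti : ∀ s r, inner ℂ (u s) (G r) = -inner ℂ (G s) (u r) := by
    intro s r
    have key := (integral_symOp_antisymm S.potential hX (isCompact_annulus (2 * N))
      (annulus_subset _) hXK (S.gradient s) (S.formSolution s) (S.gradient r)
      (S.formSolution r)).2
    rw [eq_neg_iff_add_eq_zero, inner_L2_eq, inner_L2_eq,
      ← integral_add (integrable_conj_mul _ _) (integrable_conj_mul _ _), ← key]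
    refine integral_congr_ae ?_
    filter_upwards [hGx s, hGx r] with x h1 h2
    rw [h1, h2]
  have hpair : ∀ t, ∫ x, radialVirial A V (logCutoff N) (u t) (p t) x
      = 2 * (inner ℂ (G t) (k t)).re := by
    intro t
    have e1 := integral_pairing_eq_integral_radialVirial S.two_le S.potential hV hN
      (S.gradient t) (S.formSolution t)
    have e2 : ∫ x, pairingDensity V (radialField (logCutoff N)) (fun k x => p t x k) (u t) (h t) x
        = inner ℂ (G t) (k t) + inner ℂ (k t) (G t) := by
      rw [inner_L2_eq, inner_L2_eq,
        ← integral_add (integrable_conj_mul _ _) (integrable_conj_mul _ _)]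
      refine integral_congr_ae ?_
      filter_upwards [hGx t, S.hamiltonian t] with x h1 h2
      rw [h1, h2, pairingDensity]
      ring
    have e3 := congrArg Complex.re (e1.symm.trans e2)
    rw [Complex.ofReal_re, Complex.add_re, ← inner_conj_symm (k t), Complex.conj_re] at e3
    linarith
  have hmom : ∀ t, (inner ℂ (u t) (G t)).im
      = ∫ x, logCutoff N (logSq x) * radialMomentum (u t) (p t) x := by
    intro t
    rw [inner_L2_eq]
    have := integral_im (integrable_conj_mul (u t) (G t))
    refine this.symm.trans (integral_congr_ae ?_)
    filter_upwards [hGx t] with x h1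
    rw [h1]
    exact conj_mul_symOp_radialField_im (logCutoff N) (u t) (p t) x
  constructor
  · simp only [hpair]
    exact continuous_const.mul (Complex.continuous_re.comp (hG.inner S.continuous_hamiltonian))
  · intro t
    simp only [← hmom, hpair]
    have hd := Complex.imCLM.hasFDerivAt.comp_hasDerivAt t
      (hasDerivAt_inner_of_antisymm (S.hasDerivAt t) hG.continuousAt hanti)
    refine hd.congr_deriv ?_
    have e : deriv u t = -Complex.I • k t := by rw [← S.equation t, smul_smul]; simp
    have e2 : (inner ℂ (k t) (G t)).re = (inner ℂ (G t) (k t)).re := by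
      rw [← inner_conj_symm, Complex.conj_re]
    rw [e, inner_smul_left, inner_smul_right]
    simp [e2]
    ring

lemma tendsto_integral_cutoff_momentum {w : L2 n} (q : L2Vec n)
    (hw : Integrable (fun x => ‖x‖ ^ 2 * ‖w x‖ ^ 2)) :
    Tendsto (fun m : ℕ => ∫ x, logCutoff (m + 1) (logSq x) * radialMomentum w q x) atTop
      (𝓝 (∫ x, radialMomentum w q x)) := by
  have hb : Integrable (fun x => ‖x‖ ^ 2 * ‖w x‖ ^ 2 + ‖q x‖ ^ 2) := hw.add (integrable_norm_sq q)
  refine tendsto_integral_of_dominated_convergence _ (fun m =>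
    (aestronglyMeasurable_comp_logSq (contDiff_logCutoff _).continuous).mul
      (aestronglyMeasurable_radialMomentum w q)) hb
    (fun m => .of_forall fun x => ?_) (.of_forall fun x => ?_)
  · rw [Real.norm_eq_abs, abs_mul, abs_of_nonneg (logCutoff_nonneg _ _)]
    exact (mul_le_of_le_one_left (abs_nonneg _) (logCutoff_le_one _ _)).trans
      (abs_radialMomentum_le w q x)
  · refine tendsto_const_nhds.congr' ?_
    filter_upwards [eventually_abs_logSq_lt x] with m hm
    rw [(logCutoff_of_abs_lt hm).1, one_mul]

/-- The integrated derivative of the radial momentum. -/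
lemma IsFlow.momentum_sub (S : IsFlow A V u h k p) (hV : ContDiffOn ℝ 1 V {0}ᶜ)
    (h0 : Integrable (fun x => ‖x‖ ^ 2 * ‖u 0 x‖ ^ 2))
    (hE : ∀ t, Integrable (electricDensity V (u t)))
    (hE' : LocallyIntegrable (fun t : ℝ => ∫ x, |electricDensity V (u t) x|))
    (hM : ∀ t, Integrable (magneticDensity A (u t) (p t)))
    (hM' : LocallyIntegrable (fun t : ℝ => ∫ x, ‖magneticDensity A (u t) (p t) x‖)) :
    LocallyIntegrable (fun t => virialRHS A V (u t) (p t)) ∧ ∀ s t,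
      (∫ x, radialMomentum (u t) (p t) x) - ∫ x, radialMomentum (u s) (p s) x
        = ∫ τ in s..t, virialRHS A V (u τ) (p τ) / 4 := by
  obtain ⟨C, hC0, hC⟩ := exists_abs_integral_radialVirial_le (V := V) S.two_le S.potential
  have h1m : ∀ m : ℕ, (1 : ℝ) ≤ m + 1 := fun m => by
    have : (0 : ℝ) ≤ m := Nat.cast_nonneg m
    linarith
  -- A bound in time valid for every cutoff. It dominates the time integrals and, in the limit,
  -- gives the local integrability of the virial expression.
  let b : ℝ → ℝ := fun t => C * (‖p t‖ ^ 2 + ‖u t‖ ^ 2) + (∫ x, |electricDensity V (u t) x|)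
    + 2 * ∫ x, ‖magneticDensity A (u t) (p t) x‖
  have hb : LocallyIntegrable b := by
    have c : Continuous fun t => C * (‖p t‖ ^ 2 + ‖u t‖ ^ 2) :=
      continuous_const.mul ((S.continuous_gradient.norm.pow 2).add (S.continuous.norm.pow 2))
    exact (c.locallyIntegrable.add hE').add (hM'.smul (2 : ℝ))
  have hbound : ∀ (m : ℕ) t, |∫ x, radialVirial A V (logCutoff (m + 1)) (u t) (p t) x| ≤ b t :=
    fun m t => hC _ (h1m m) _ _ _ (S.gradient t) (S.formSolution t) (hE t) (hM t)
  have hlim : ∀ t, Tendsto (fun m : ℕ => ∫ x, radialVirial A V (logCutoff (m + 1)) (u t) (p t) x)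
      atTop (𝓝 (virialRHS A V (u t) (p t) / 4)) := fun t =>
    tendsto_integral_radialVirial S.two_le S.potential (S.gradient t) (S.formSolution t)
      (hE t) (hM t)
  have hmeas : ∀ m : ℕ, AEStronglyMeasurable
      (fun t => ∫ x, radialVirial A V (logCutoff (m + 1)) (u t) (p t) x) volume := fun m =>
    (S.hasDerivAt_cutoff_momentum hV (h1m m)).1.aestronglyMeasurable
  have hF4 : LocallyIntegrable fun t => virialRHS A V (u t) (p t) / 4 := by
    refine hb.mono (aestronglyMeasurable_of_tendsto_ae atTop hmeas (.of_forall hlim))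
      (.of_forall fun t => ?_)
    exact (le_of_tendsto (hlim t).abs (.of_forall fun m => hbound m t)).trans (le_abs_self _)
  refine ⟨(hF4.smul (4 : ℝ)).congr (.of_forall fun t => ?_), fun s t => ?_⟩
  · simp only [Pi.smul_apply, smul_eq_mul]
    ring
  have hint : ∀ τ, Integrable (fun x => ‖x‖ ^ 2 * ‖u τ x‖ ^ 2) := fun τ => by
    obtain ⟨B, hB⟩ := S.exists_variance_le h0 |τ|
    exact (hB τ le_rfl).2.1
  have hbi : IntervalIntegrable b volume s t :=
    intervalIntegrable_iff.2 ((hb.integrableOn_isCompact isCompact_uIcc).mono_set uIoc_subset_uIcc)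
  have hl := (tendsto_integral_cutoff_momentum (p t) (hint t)).sub
    (tendsto_integral_cutoff_momentum (p s) (hint s))
  have hr := intervalIntegral.tendsto_integral_filter_of_dominated_convergence
    (μ := volume) (a := s) (b := t) (l := atTop)
    (F := fun (m : ℕ) τ => ∫ x, radialVirial A V (logCutoff (m + 1)) (u τ) (p τ) x)
    b (.of_forall fun m => (hmeas m).restrict)
    (.of_forall fun m => .of_forall fun τ _ => hbound m τ) hbi (.of_forall fun τ _ => hlim τ)
  refine tendsto_nhds_unique hl (hr.congr fun m => ?_)
  obtain ⟨c, hd⟩ := S.hasDerivAt_cutoff_momentum hV (h1m m)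
  exact intervalIntegral.integral_eq_sub_of_hasDerivAt (fun τ _ => hd τ)
    (c.intervalIntegrable _ _)

/-- A function whose first and second derivatives are given in integrated form. -/
lemma second_derivative_of_integral {Q M F : ℝ → ℝ} (hF : LocallyIntegrable F)
    (hQ : ∀ s t, Q t - Q s = ∫ τ in s..t, M τ) (hM : ∀ s t, M t - M s = ∫ τ in s..t, F τ) :
    ContDiff ℝ 1 Q ∧
      (∀ s t, IntervalIntegrable F volume s t ∧ deriv Q t - deriv Q s = ∫ τ in s..t, F τ) ∧
      (∀ᵐ t, HasDerivAt (deriv Q) (F t) t) ∧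
      (∀ t, ContinuousAt F t → HasDerivAt (deriv Q) (F t) t) := by
  have hFi : ∀ s t, IntervalIntegrable F volume s t := fun s t =>
    intervalIntegrable_iff.2 ((hF.integrableOn_isCompact isCompact_uIcc).mono_set uIoc_subset_uIcc)
  have eM : M = fun t => M 0 + ∫ τ in (0 : ℝ)..t, F τ := by
    ext t
    rw [← hM]
    ring
  -- As a primitive of a locally integrable function, `M` is continuous, so `Q` is classically
  -- differentiable with derivative `M`; `M` itself is differentiable at the Lebesgue points of `F`.
  have cM : Continuous M := by
    rw [eM]
    exact continuous_const.add (intervalIntegral.continuous_primitive hFi 0)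
  have eQ : Q = fun t => Q 0 + ∫ τ in (0 : ℝ)..t, M τ := by
    ext t
    rw [← hQ]
    ring
  have dQ : ∀ t, HasDerivAt Q (M t) t := by
    intro t
    rw [eQ]
    exact (intervalIntegral.integral_hasDerivAt_right (cM.intervalIntegrable _ _)
      (cM.stronglyMeasurableAtFilter _ _) cM.continuousAt).const_add _
  have hd : deriv Q = M := funext fun t => (dQ t).deriv
  rw [hd]
  refine ⟨contDiff_one_iff_deriv.2 ⟨fun t => (dQ t).differentiableAt, hd ▸ cM⟩,
    fun s t => ⟨hFi s t, hM s t⟩, ?_, fun t ht => ?_⟩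
  · filter_upwards [LocallyIntegrable.ae_hasDerivAt_integral hF] with t ht
    rw [eM]
    exact (ht 0).const_add _
  · rw [eM]
    exact (intervalIntegral.integral_hasDerivAt_right (hFi _ _)
      hF.aestronglyMeasurable.stronglyMeasurableAtFilter ht).const_add _

end Momentum

end MagneticVirial

/-! ### The variance identity. -/

theorem corollary1p4 (n : ℕ) (hn : 2 ≤ n)
    (A : MagneticVirial.Space n → MagneticVirial.Space n) (V : MagneticVirial.Space n → ℝ)
    -- the potentials are `C¹` away from the origin, where they may be singular
    (hA : ContDiffOn ℝ 1 A {0}ᶜ) (hV : ContDiffOn ℝ 1 V {0}ᶜ)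
    (hA2 : LocallyIntegrable (fun x => ‖A x‖ ^ 2))
    (hgauge : ∀ x, x ≠ 0 → MagneticVirial.divergence A x = 0)
    (hKR : MagneticVirial.IsKatoRellich A V)
    -- the datum: `f ∈ L²`, `H_A f ∈ L²`, with finite variance
    (f : MagneticVirial.L2 n) (hf : ∃ h, MagneticVirial.IsMagneticLaplacian A f h)
    (hfvar : Integrable (fun x : MagneticVirial.Space n => ‖x‖ ^ 2 * ‖f x‖ ^ 2))
    -- the solution `u` and `Du = ∇_A u`
    (u : ℝ → MagneticVirial.L2 n) (hu : MagneticVirial.IsSchrodingerSolution A V f u)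
    (Du : ℝ → MagneticVirial.L2Vec n)
    (hDu : ∀ t, MagneticVirial.IsCovariantGradient A (u t) (Du t))
    -- the last two integrals of the identity converge absolutely, locally integrably in time
    (hE : ∀ t, Integrable (MagneticVirial.electricDensity V (u t)))
    (hE' : LocallyIntegrable (fun t : ℝ => ∫ x, |MagneticVirial.electricDensity V (u t) x|))
    (hM : ∀ t, Integrable (MagneticVirial.magneticDensity A (u t) (Du t)))
    (hM' : LocallyIntegrable
      (fun t : ℝ => ∫ x, ‖MagneticVirial.magneticDensity A (u t) (Du t) x‖)) :
    let Q : ℝ → ℝ := fun t => MagneticVirial.variance (u t)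
    let F : ℝ → ℝ := fun t => MagneticVirial.virialRHS A V (u t) (Du t)
    (∀ t, Integrable (fun x : MagneticVirial.Space n => ‖x‖ ^ 2 * ‖u t x‖ ^ 2)) ∧
      ContDiff ℝ 1 Q ∧
      (∀ s t : ℝ, IntervalIntegrable F volume s t ∧ deriv Q t - deriv Q s = ∫ τ in s..t, F τ) ∧
      (∀ᵐ t : ℝ, HasDerivAt (deriv Q) (F t) t) ∧
      (∀ t : ℝ, ContinuousAt F t → HasDerivAt (deriv Q) (F t) t) := by
  obtain ⟨hu1, hu0, hueq⟩ := hu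
  choose k hk hku using hueq
  choose h hh hkh using hk
  -- Membership in the domain of `H_A` comes with a gradient of its own; uniqueness of covariant
  -- gradients identifies it with `Du t`.
  have hform : ∀ t, MagneticVirial.IsFormSolution A (Du t) (h t) := fun t => by
    obtain ⟨p, hp, hph⟩ := hh t
    rwa [(hDu t).unique hp]
  have ek : ∀ t, Complex.I • deriv u t = k t := fun t => sub_eq_zero.1 (hku t)
  have hdc : Continuous (deriv u) := (contDiff_one_iff_deriv.1 hu1).2
  have hkc : Continuous k := (hdc.const_smul Complex.I).congr ek
  have S : MagneticVirial.IsFlow A V u h k Du :=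
    { two_le := hn
      potential := hA
      locallyIntegrable := hA2
      hasDerivAt := fun t => (hu1.differentiable one_ne_zero t).hasDerivAt
      equation := ek
      continuous_hamiltonian := hkc
      gradient := hDu
      formSolution := hform
      hamiltonian := hkh
      continuous_gradient := MagneticVirial.continuous_covariantGradient hn hA hA2 hKR
        hu1.continuous hkc hDu hform hkh }
  have h0 : Integrable (fun x : MagneticVirial.Space n => ‖x‖ ^ 2 * ‖u 0 x‖ ^ 2) := by
    rwa [hu0]
  intro Q F
  refine ⟨fun t => ?_, ?_⟩
  · obtain ⟨B, hB⟩ := S.exists_variance_le h0 |t|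
    exact (hB t le_rfl).2.1
  obtain ⟨hF, hsub⟩ := S.momentum_sub hV h0 hE hE' hM hM'
  refine MagneticVirial.second_derivative_of_integral hF
    -- One factor `2` comes from differentiating the squared modulus, the other from `∇|x|² = 2x`.
    -- Together they cancel the quarter in the derivative of the momentum.
    (M := fun τ => 2 * ∫ x, 2 * MagneticVirial.radialMomentum (u τ) (Du τ) x)
    (fun s t => S.variance_sub h0 s t) fun s t => ?_
  have e := hsub s t
  rw [intervalIntegral.integral_div] at e
  simp only [integral_const_mul]
  simp only [F]
  linarith
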